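/- Let $L,g,c,\tau,F_\infty>0$ and $s_*\in(0,1)$. Let $k:[0,1]\to[0,\infty)$ be differentiable, $C^2$ on $(0,1)$, with $k'>0$ and $k''>0$ on $(0,1)$. Let $p_c:(0,1)\to\mathbb R$ be differentiable with $p_c'\ge\rho$ for some $\rho>0$, $p_c(s_*)=0$, $p_c(\sigma)\to-\infty$ as $\sigma\searrow0$ and $p_c(\sigma)\to+\infty$ as $\sigma\nearrow1$. Let $s_0,p_0$ be real functions on $(0,L)$ with $s_*\le s_0\le 1$. Points of the plane are written $(y,z)$, and $\Omega^H=(0,L)\times(0,H)$, $\Omega=(0,L)\times(0,\infty)$. For $H>0$, a pair $(s,p)$ is a *solution of the truncated problem* on $\Omega^H$ if $s,\partial_z s\in L^2(\Omega^H)$, $0<s<1$ a.e., $p\in H^1(\Omega^H)$, $s=s_0$ and $p=p_0$ on $\{z=0\}$ in the sense of traces, $p$ equals some (free) constant $p^*$ on $\{z=H\}$, $$c\tau\,\partial_z s=[p-p_c(s)]_+\quad\text{a.e. in }\Omega^H,$$ and, in the weak sense, $$c\,\partial_z s=\nabla\cdot\bigl(k(s)[\nabla p+g e_z]\bigr)\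 \text{ in }\Omega^H,\qquad \int_0^L k(s)[\partial_z p+g]\,dy=F_\infty\ \text{ on }\{z=H\},$$ with no flux through the lateral sides, that is, $$\int_{\Omega^H}c\,\partial_z s\,\varphi+k(s)[\nabla p+g e_z]\cdot\nabla\varphi=F_\infty\,\varphi^*$$ for all $\varphi\in H^1(\Omega^H)$ with zero trace on $\{z=0\}$ and constant trace $\varphi^*$ on $\{z=H\}$. **Lemma.** Let $H_n>0$, $H_n\to\infty$, and let $(s_n,p_n)$ be solutions of the truncated problem on $\Omega^{H_n}$ with the same data. Assume that for some $z_0>0$ and some $C_k$ $$\int_0^L g\,k(s_n(y,z_0))\,dy\ \ge\ C_k\ >\ F_\infty\qquad\text{for all } n \text{ with } H_n>z_0 .$$ Then $$\|p_n\|_{L^\infty(\Omega^{H_n})}\to\infty ,$$ where the norm takes values in $[0,\infty]$. In particular, the sequence generates a large (Type I) solution in the following sense. Assume in addition that $s_0,p_0\in C^1((0,L))$, that $s_0<1$ and $p_c(s_0)<p_0$, and that there are constants $\bar p,C_P$ with $p_n\le\bar p$ and $|\nabla p_n|\le C_P$ a.e. in $\Omega^{H_n}$ for all $n$. Then there are a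 subsequence of $(s_n,p_n)$ and a limit pair $(s,p)$ with $s_n\to s$ and $p_n\to p$ in $L^2(K)$ for every compact $K\subset\Omega$ along that subsequence, such that: 1. $s$ is continuous on $\Omega$ with values in $(0,1)$, $\partial_z s\in L^2(\Omega)$, $p\in H^2_{\mathrm{loc}}(\Omega)$, $p\in H^1(\Omega^R)$ for every $R>0$, $(s,p)=(s_0,p_0)$ on $\{z=0\}$ in the sense of traces, $c\tau\,\partial_z s=[p-p_c(s)]_+$ a.e. in $\Omega$, and $c\,\partial_z s=\nabla\cdot(k(s)[\nabla p+g e_z])$ holds weakly in $\Omega$ with no flux through the lateral sides; 2. there is $h>0$ with $\partial_z s=0$ a.e. in $\{z\ge h\}$; 3. the limit $s^*(y)=\lim_{z\to\infty}s(y,z)$ exists for every $y\in(0,L)$, and $g\int_0^L k(s^*(y))\,dy>F_\infty$; 4. $p\to-\infty$ as $z\to\infty$, uniformly in $y$; 5. $\int_0^L k(s(y,z))[\partial_z p(y,z)+g]\,dy\to F_\infty$ as $z\to\infty$, outside a null set of heights $z$. -/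

import Mathlib

open Set Filter Topology MeasureTheory

namespace Fingering

/-- Points of the plane are pairs `(y, z)`; `rect L a b` is the open rectangle `(0,L) × (a,b)`.
The truncated domain `Ω^H` is `rect L 0 H`. -/
def rect (L a b : ℝ) : Set (ℝ × ℝ) := Ioo 0 L ×ˢ Ioo a b

/-- The half-infinite strip `Ω = (0,L) × (0,∞)`. -/
def strip (L : ℝ) : Set (ℝ × ℝ) := Ioo 0 L ×ˢ Ioi 0

/-- `∂_y φ` of a differentiable function. -/
noncomputable def dy (φ : ℝ × ℝ → ℝ) (x : ℝ × ℝ) : ℝ := fderiv ℝ φ x (1, 0)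

/-- `∂_z φ` of a differentiable function. -/
noncomputable def dz (φ : ℝ × ℝ → ℝ) (x : ℝ × ℝ) : ℝ := fderiv ℝ φ x (0, 1)

/-- Smooth functions on the plane whose compact support lies in `W`. -/
structure IsTestOn (W : Set (ℝ × ℝ)) (φ : ℝ × ℝ → ℝ) : Prop where
  smooth : ContDiff ℝ (⊤ : ℕ∞) φ
  compact : HasCompactSupport φ
  supp : tsupport φ ⊆ W

/-- `v` is the weak derivative `∂_y u` on the open set `U`. -/
def IsWeakDy (U : Set (ℝ × ℝ)) (u v : ℝ × ℝ → ℝ) : Prop :=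
  LocallyIntegrableOn u U ∧ LocallyIntegrableOn v U ∧
    ∀ φ, IsTestOn U φ → ∫ x in U, u x * dy φ x = -∫ x in U, v x * φ x

/-- `v` is the weak derivative `∂_z u` on the open set `U`. -/
def IsWeakDz (U : Set (ℝ × ℝ)) (u v : ℝ × ℝ → ℝ) : Prop :=
  LocallyIntegrableOn u U ∧ LocallyIntegrableOn v U ∧
    ∀ φ, IsTestOn U φ → ∫ x in U, u x * dz φ x = -∫ x in U, v x * φ x

/-- `f ∈ L²(U)`. -/
def InL2 (U : Set (ℝ × ℝ)) (f : ℝ × ℝ → ℝ) : Prop := MemLp f 2 (volume.restrict U)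

/-- `f ∈ L²_loc(U)`. -/
def InL2loc (U : Set (ℝ × ℝ)) (f : ℝ × ℝ → ℝ) : Prop :=
  ∀ K, IsCompact K → K ⊆ U → InL2 K f

/-- `u ∈ H¹(U)` with weak gradient `(uy, uz)`. -/
structure IsH1 (U : Set (ℝ × ℝ)) (u uy uz : ℝ × ℝ → ℝ) : Prop where
  mem : InL2 U u
  mem_y : InL2 U uy
  mem_z : InL2 U uz
  weak_y : IsWeakDy U u uy
  weak_z : IsWeakDz U u uz

/-- `t ∈ L²(0,L)` is the trace on the upper side `(0,L) × {b}` of a function `u` on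
`(0,L) × (a,b)` whose weak derivative `∂_z u` is `uz` (Gauss-Green formula, for test functions
that vanish near the lower side). -/
def IsTopTrace (L a b : ℝ) (u uz : ℝ × ℝ → ℝ) (t : ℝ → ℝ) : Prop :=
  MemLp t 2 (volume.restrict (Ioo 0 L)) ∧
    ∀ φ, IsTestOn {x | a < x.2} φ →
      ∫ x in rect L a b, (u x * dz φ x + uz x * φ x) = ∫ y in Ioo 0 L, t y * φ (y, b)

/-- `t ∈ L²(0,L)` is the trace on the lower side `(0,L) × {a}` of a function `u` on
`(0,L) × (a,b)` whose weak derivative `∂_z u` is `uz`. -/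
def IsBottomTrace (L a b : ℝ) (u uz : ℝ × ℝ → ℝ) (t : ℝ → ℝ) : Prop :=
  MemLp t 2 (volume.restrict (Ioo 0 L)) ∧
    ∀ φ, IsTestOn {x | x.2 < b} φ →
      ∫ x in rect L a b, (u x * dz φ x + uz x * φ x) = -∫ y in Ioo 0 L, t y * φ (y, a)

/-- Assumptions on the capillary pressure `p_c : (0,1) → ℝ`, normalized by `p_c(s_*) = 0`. -/
structure CapillaryAssumption (pc : ℝ → ℝ) (sstar : ℝ) : Prop where
  diff : DifferentiableOn ℝ pc (Ioo 0 1)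
  slope : ∃ ρ > 0, ∀ σ ∈ Ioo (0 : ℝ) 1, ρ ≤ deriv pc σ
  normalized : pc sstar = 0
  at_zero : Tendsto pc (𝓝[>] 0) atBot
  at_one : Tendsto pc (𝓝[<] 1) atTop

/-- Assumptions on the permeability `k : [0,1] → [0,∞)`. -/
structure PermeabilityAssumption (k : ℝ → ℝ) : Prop where
  nonneg : ∀ σ ∈ Icc (0 : ℝ) 1, 0 ≤ k σ
  diff : DifferentiableOn ℝ k (Icc 0 1)
  smooth : ContDiffOn ℝ 2 k (Ioo 0 1)
  deriv_pos : ∀ σ ∈ Ioo (0 : ℝ) 1, 0 < deriv k σ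
  deriv2_pos : ∀ σ ∈ Ioo (0 : ℝ) 1, 0 < deriv (deriv k) σ

/-- The data of the travelling wave problem: width `L`, gravity `g`, wave speed `c`, relaxation
parameter `τ`, influx `Finf = F_∞`, permeability `k`, capillary pressure `pc`, and boundary values
`s0`, `p0` on the bottom. -/
structure TWData where
  L : ℝ
  g : ℝ
  c : ℝ
  τ : ℝ
  Finf : ℝ
  k : ℝ → ℝ
  pc : ℝ → ℝ
  s0 : ℝ → ℝ
  p0 : ℝ → ℝ

/-- `φ ∈ H¹_♯(Ω^H)` with weak gradient `(φy, φz)`: an `H¹` function with trace `0` on the bottom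
and constant trace `φtop` on the top. -/
structure IsH1Sharp (L H : ℝ) (φ φy φz : ℝ × ℝ → ℝ) (φtop : ℝ) : Prop where
  h1 : IsH1 (rect L 0 H) φ φy φz
  bottom : IsBottomTrace L 0 H φ φz (fun _ => 0)
  top : IsTopTrace L 0 H φ φz (fun _ => φtop)

/-- `(s, p)` is a solution of the truncated travelling wave problem on `Ω^H = (0,L) × (0,H)`, with
`s, ∂_z s ∈ L²` and `p ∈ H¹`. Here `sz = ∂_z s`, `(py, pz) = ∇p` are the weak derivatives and
`pstar` is the (free) constant pressure on the top. The field `weak` is the weak form of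
`c ∂_z s = ∇ · (k(s) [∇p + g e_z])` together with the no-flux condition on the lateral sides and
the total flux condition `∫ k(s) [∂_z p + g] dy = F_∞` on the top. -/
structure IsTWSolutionWith (D : TWData) (H : ℝ) (s sz p py pz : ℝ × ℝ → ℝ) (pstar : ℝ) :
    Prop where
  s_mem : InL2 (rect D.L 0 H) s
  sz_mem : InL2 (rect D.L 0 H) sz
  s_weak : IsWeakDz (rect D.L 0 H) s sz
  p_h1 : IsH1 (rect D.L 0 H) p py pz
  s_range : ∀ᵐ x ∂volume.restrict (rect D.L 0 H), s x ∈ Ioo (0 : ℝ) 1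
  closure_eq : ∀ᵐ x ∂volume.restrict (rect D.L 0 H),
    D.c * D.τ * sz x = max 0 (p x - D.pc (s x))
  s_bottom : IsBottomTrace D.L 0 H s sz D.s0
  p_bottom : IsBottomTrace D.L 0 H p pz D.p0
  p_top : IsTopTrace D.L 0 H p pz (fun _ => pstar)
  weak : ∀ (φ φy φz : ℝ × ℝ → ℝ) (φtop : ℝ), IsH1Sharp D.L H φ φy φz φtop →
    ∫ x in rect D.L 0 H,
      (D.c * sz x * φ x + D.k (s x) * (py x * φy x + (pz x + D.g) * φz x)) = D.Finf * φtop

/-- `(s, p)` is a solution of the truncated travelling wave problem on `Ω^H`. -/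
def IsTWSolution (D : TWData) (H : ℝ) (s p : ℝ × ℝ → ℝ) : Prop :=
  ∃ (sz py pz : ℝ × ℝ → ℝ) (pstar : ℝ), IsTWSolutionWith D H s sz p py pz pstar

/-- The function `t = s(·, z)` of a function `s` on `Ω` near `(0,L) × (0,z]` with
`s, ∂_z s ∈ L²`. -/
def IsValueAtHeight (L z : ℝ) (s : ℝ × ℝ → ℝ) (t : ℝ → ℝ) : Prop :=
  ∃ sz, InL2 (rect L 0 z) sz ∧ IsWeakDz (rect L 0 z) s sz ∧ IsTopTrace L 0 z s sz t

/-- `‖∇u‖_{L^∞(U)} ≤ C`, with the Euclidean length of the gradient. -/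
def GradientBound (U : Set (ℝ × ℝ)) (u : ℝ × ℝ → ℝ) (C : ℝ) : Prop :=
  ∃ uy uz, IsWeakDy U u uy ∧ IsWeakDz U u uz ∧
    ∀ᵐ x ∂volume.restrict U, Real.sqrt (uy x ^ 2 + uz x ^ 2) ≤ C

/-- `(s, p)` is a travelling wave solution on the half-infinite strip `Ω`:
`s` is continuous with values in `(0,1)`, `∂_z s = sz ∈ L²(Ω)`, `p` lies in `H²_loc(Ω)` and in
`H¹((0,L) × (0,R))` for every `R`, `(s,p) = (s_0,p_0)` on the bottom, and the two equations hold.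
The test functions in `weak` need not vanish on the lateral sides, which is the no-flux
condition there. -/
structure IsStripSolutionWith (D : TWData) (s sz p py pz : ℝ × ℝ → ℝ) : Prop where
  s_cont : ContinuousOn s (strip D.L)
  s_range : ∀ x ∈ strip D.L, s x ∈ Ioo (0 : ℝ) 1
  sz_mem : InL2 (strip D.L) sz
  s_weak : IsWeakDz (strip D.L) s sz
  p_h1 : ∀ R > 0, IsH1 (rect D.L 0 R) p py pz
  p_h2loc : ∃ pyy pyz pzy pzz : ℝ × ℝ → ℝ,
    (InL2loc (strip D.L) pyy ∧ InL2loc (strip D.L) pyz ∧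
      InL2loc (strip D.L) pzy ∧ InL2loc (strip D.L) pzz) ∧
    IsWeakDy (strip D.L) py pyy ∧ IsWeakDz (strip D.L) py pyz ∧
    IsWeakDy (strip D.L) pz pzy ∧ IsWeakDz (strip D.L) pz pzz
  s_bottom : ∀ R > 0, IsBottomTrace D.L 0 R s sz D.s0
  p_bottom : ∀ R > 0, IsBottomTrace D.L 0 R p pz D.p0
  weak : ∀ φ, IsTestOn {x | 0 < x.2} φ →
    ∫ x in strip D.L,
      (D.c * sz x * φ x + D.k (s x) * (py x * dy φ x + (pz x + D.g) * dz φ x)) = 0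
  closure_eq : ∀ᵐ x ∂volume.restrict (strip D.L),
    D.c * D.τ * sz x = max 0 (p x - D.pc (s x))

/-- `(s, p)` is a "large" (Type I) solution on `Ω`: a travelling wave solution with a free boundary
(`∂_z s = 0` above some height `h`), with `g ∫ k(s^*(y)) dy > F_∞` for `s^* = lim_{z → ∞} s(·,z)`,
with `p → -∞` as `z → ∞`, and with total influx `F_∞` at `z → ∞`. The slices of `∂_z p` are defined
for almost every `z`, so the last limit is taken outside a null set of heights. -/
def IsTypeI (D : TWData) (s p : ℝ × ℝ → ℝ) : Prop :=
  ∃ sz py pz : ℝ × ℝ → ℝ, IsStripSolutionWith D s sz p py pz ∧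
    (∃ h > 0, ∀ᵐ x ∂volume.restrict (strip D.L), h ≤ x.2 → sz x = 0) ∧
    (∃ slim : ℝ → ℝ,
      (∀ y ∈ Ioo 0 D.L, Tendsto (fun z => s (y, z)) atTop (𝓝 (slim y))) ∧
      D.Finf < D.g * ∫ y in Ioo 0 D.L, D.k (slim y)) ∧
    (∀ M : ℝ, ∃ Z : ℝ, ∀ᵐ x ∂volume.restrict (strip D.L), Z ≤ x.2 → p x ≤ M) ∧
    Tendsto (fun z => ∫ y in Ioo 0 D.L, D.k (s (y, z)) * (pz (y, z) + D.g))
      (atTop ⊓ ae volume) (𝓝 D.Finf)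

/-- `u_n → u` locally in `L²(Ω)`. -/
def ConvergesL2loc (L : ℝ) (u : ℕ → ℝ × ℝ → ℝ) (v : ℝ × ℝ → ℝ) : Prop :=
  ∀ K, IsCompact K → K ⊆ strip L →
    Tendsto (fun n => eLpNorm (fun x => u n x - v x) 2 (volume.restrict K)) atTop (𝓝 0)

end Fingering

/-! The first claim is a flux balance. Testing the weak equation with a piecewise linear function of
`z` alone shows that the mean over `z1 < z < z2` of `∫ k(s) [∂_z p + g] dy` is `F_∞` minus `c` times
an integral of `∂_z s` (`IsTWSolutionWith.flux_eq`). The saturation equation forces `∂_z s ≥ 0`. So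
the total flux is at most `F_∞`, while the gravity part `g ∫ k(s) dy` is nondecreasing in `z` and
stays above `C_k > F_∞` from `z0` on. Hence `∫ k(s) ∂_z p dy` is, on average, at most `-(C_k -
F_∞)`. On a vertical line `k(s)` is nondecreasing, so integrating by parts with `p ≤ M` costs only a
fixed multiple of `M`, and `∫ k(s) p dy` decays linearly in `z` (`IsTWSolutionWith.pressure_decay`).
A bound on `‖p‖` uniform along the sequence contradicts this once `H_n` is large
(`tendsto_norm_pressure`).

For the limit, the gradient bound makes the pressures equi-Lipschitz, so a subsequence converges
pointwise to a Lipschitz `P`. On each vertical line the saturation solves `cτ σ' = [P - p_c(σ)]_+`.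
Its right-hand side is nonincreasing in `σ`, so two solutions differ by at most the difference of
the initial values plus the `L¹` distance of the pressures, with no Grönwall factor
(`IsImbibition.sub_le`). Thus the saturations converge pointwise on slices to a locally Lipschitz
`S`. Bounded pointwise convergence of `k(s_n)` and weak convergence of `∇p_n` suffice for the limit
equation (`limit_weak_eq`).

Linear decay together with the bounded horizontal oscillation of a Lipschitz pressure gives `P → -∞`
uniformly (`IsLipschitzSolution.pressure_le`). Since `p_c ≥ 0` on `[s_*, 1)`, imbibition stops where
`P ≤ 0`: this is the free boundary. Above it the flux is exactly `F_∞`, and monotonicity in `z`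
carries the bound `C_k` over to `s^*`. Local `H²` regularity follows from difference quotients, as
`k(S)` is locally Lipschitz and bounded below by `k(s_*) > 0` (`dq_gradient_bound`). -/

namespace Fingering

/-! ### Weak derivatives in a fixed direction -/

/-- `v` is the weak derivative of `u` in direction `e` on `U`. -/
def IsWeakD (e : ℝ × ℝ) (U : Set (ℝ × ℝ)) (u v : ℝ × ℝ → ℝ) : Prop :=
  LocallyIntegrableOn u U ∧ LocallyIntegrableOn v U ∧
    ∀ φ, IsTestOn U φ → ∫ x in U, u x * fderiv ℝ φ x e = -∫ x in U, v x * φ x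

lemma isOpen_rect (L a b : ℝ) : IsOpen (rect L a b) := isOpen_Ioo.prod isOpen_Ioo

lemma isOpen_strip (L : ℝ) : IsOpen (strip L) := isOpen_Ioo.prod isOpen_Ioi

lemma measurableSet_rect (L a b : ℝ) : MeasurableSet (rect L a b) := (isOpen_rect L a b).measurableSet

lemma volume_restrict_rect (L a b : ℝ) : (volume : Measure (ℝ × ℝ)).restrict (rect L a b) =
    (volume.restrict (Ioo 0 L)).prod (volume.restrict (Ioo a b)) :=
  (Measure.prod_restrict _ _).symm

instance isFiniteMeasure_rect (L a b : ℝ) :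
    IsFiniteMeasure ((volume : Measure (ℝ × ℝ)).restrict (rect L a b)) := by
  rw [volume_restrict_rect]; infer_instance

lemma IsTestOn.mono {U V : Set (ℝ × ℝ)} {φ : ℝ × ℝ → ℝ} (h : IsTestOn V φ) (hVU : V ⊆ U) :
    IsTestOn U φ := ⟨h.smooth, h.compact, h.supp.trans hVU⟩

lemma IsTestOn.lipschitz {U : Set (ℝ × ℝ)} {φ : ℝ × ℝ → ℝ} (h : IsTestOn U φ) :
    ∃ C, LipschitzWith C φ :=
  ContDiff.lipschitzWith_of_hasCompactSupport h.compact h.smooth (by simp)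

lemma IsTestOn.eq_zero {U : Set (ℝ × ℝ)} {φ : ℝ × ℝ → ℝ} (h : IsTestOn U φ) {x : ℝ × ℝ}
    (hx : x ∉ U) : φ x = 0 := image_eq_zero_of_notMem_tsupport fun h' => hx (h.supp h')

lemma IsTestOn.fderiv_eq_zero {U : Set (ℝ × ℝ)} {φ : ℝ × ℝ → ℝ} (h : IsTestOn U φ) {x : ℝ × ℝ}
    (hx : x ∉ U) : fderiv ℝ φ x = 0 :=
  image_eq_zero_of_notMem_tsupport fun h' => hx (h.supp (tsupport_fderiv_subset ℝ h'))

lemma IsTestOn.setIntegral_mul {U : Set (ℝ × ℝ)} {φ : ℝ × ℝ → ℝ} (h : IsTestOn U φ)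
    (u : ℝ × ℝ → ℝ) : ∫ x in U, u x * φ x = ∫ x, u x * φ x :=
  setIntegral_eq_integral_of_forall_compl_eq_zero fun x hx => by simp [h.eq_zero hx]

lemma IsTestOn.setIntegral_mul_fderiv {U : Set (ℝ × ℝ)} {φ : ℝ × ℝ → ℝ} (h : IsTestOn U φ)
    (u : ℝ × ℝ → ℝ) (e : ℝ × ℝ) :
    ∫ x in U, u x * fderiv ℝ φ x e = ∫ x, u x * fderiv ℝ φ x e :=
  setIntegral_eq_integral_of_forall_compl_eq_zero fun x hx => by simp [h.fderiv_eq_zero hx]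

lemma integrable_mul_of_locallyIntegrableOn {U : Set (ℝ × ℝ)} {φ u : ℝ × ℝ → ℝ}
    (hu : LocallyIntegrableOn u U) (hφ : Continuous φ) (hc : HasCompactSupport φ)
    (hs : tsupport φ ⊆ U) : Integrable (fun x => u x * φ x) := by
  have h1 : IntegrableOn (fun x => u x * φ x) (tsupport φ) :=
    (hu.integrableOn_compact_subset hs hc).mul_continuousOn hφ.continuousOn hc
  exact (integrableOn_iff_integrable_of_support_subset
    ((Function.support_mul_subset_right _ _).trans (subset_tsupport φ))).1 h1

lemma IsTestOn.integrable_mul {U : Set (ℝ × ℝ)} {φ u : ℝ × ℝ → ℝ} (h : IsTestOn U φ)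
    (hu : LocallyIntegrableOn u U) : Integrable (fun x => u x * φ x) :=
  integrable_mul_of_locallyIntegrableOn hu h.smooth.continuous h.compact h.supp

/-- A locally integrable function whose integrals against test functions vanish is zero. -/
lemma ae_eq_zero_of_test {U : Set (ℝ × ℝ)} (hU : IsOpen U) {f : ℝ × ℝ → ℝ}
    (hf : LocallyIntegrableOn f U) (h : ∀ φ, IsTestOn U φ → ∫ x in U, f x * φ x = 0) :
    ∀ᵐ x ∂volume.restrict U, f x = 0 := by
  rw [ae_restrict_iff' hU.measurableSet]
  refine hU.ae_eq_zero_of_integral_contDiff_smul_eq_zero hf fun g hg hgc hgs => ?_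
  have ht : IsTestOn U g := ⟨hg, hgc, hgs⟩
  rw [← h g ht, ht.setIntegral_mul]
  simp [mul_comm]

/-- `IsWeakDy` and `IsWeakDz` unfold to `IsWeakD` with `e = (1, 0)` and `e = (0, 1)`, so uniqueness
is proved once for both. It allows weak derivatives given by a hypothesis to be exchanged for the
`fderiv` of a Lipschitz representative. -/
lemma IsWeakD.ae_eq {e : ℝ × ℝ} {U : Set (ℝ × ℝ)} (hU : IsOpen U) {u v w : ℝ × ℝ → ℝ}
    (hv : IsWeakD e U u v) (hw : IsWeakD e U u w) : v =ᵐ[volume.restrict U] w := by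
  have := ae_eq_zero_of_test hU (hv.2.1.sub hw.2.1) fun φ hφ => by
    have h1 := hv.2.2 φ hφ
    have h2 := hw.2.2 φ hφ
    have : ∀ x, (v - w) x * φ x = v x * φ x - w x * φ x := fun x => by simp [sub_mul]
    simp_rw [this]
    rw [integral_sub (hφ.integrable_mul hv.2.1).integrableOn
      (hφ.integrable_mul hw.2.1).integrableOn]
    linarith
  filter_upwards [this] with x hx
  simpa [sub_eq_zero] using hx

lemma IsWeakD.mono {e : ℝ × ℝ} {U V : Set (ℝ × ℝ)} {u v : ℝ × ℝ → ℝ}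
    (h : IsWeakD e U u v) (hVU : V ⊆ U) : IsWeakD e V u v := by
  refine ⟨h.1.mono_set hVU, h.2.1.mono_set hVU, fun φ hφ => ?_⟩
  have := h.2.2 φ (hφ.mono hVU)
  rwa [(hφ.mono hVU).setIntegral_mul_fderiv, (hφ.mono hVU).setIntegral_mul,
    ← hφ.setIntegral_mul_fderiv, ← hφ.setIntegral_mul] at this

lemma locallyIntegrableOn_congr {U : Set (ℝ × ℝ)} {u u' : ℝ × ℝ → ℝ}
    (h : u =ᵐ[volume.restrict U] u') (hu : LocallyIntegrableOn u U) : LocallyIntegrableOn u' U := by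
  intro x hx
  obtain ⟨t, ht, hi⟩ := hu x hx
  refine ⟨t ∩ U, inter_mem ht self_mem_nhdsWithin, (hi.mono_set inter_subset_left).congr ?_⟩
  exact ae_mono (Measure.restrict_mono inter_subset_right le_rfl) h

lemma IsWeakD.congr {e : ℝ × ℝ} {U : Set (ℝ × ℝ)} {u v u' v' : ℝ × ℝ → ℝ}
    (h : IsWeakD e U u v) (hu : u =ᵐ[volume.restrict U] u') (hv : v =ᵐ[volume.restrict U] v') :
    IsWeakD e U u' v' := by
  refine ⟨locallyIntegrableOn_congr hu h.1, locallyIntegrableOn_congr hv h.2.1, fun φ hφ => ?_⟩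
  have h1 : ∫ x in U, u x * fderiv ℝ φ x e = ∫ x in U, u' x * fderiv ℝ φ x e :=
    integral_congr_ae (hu.mono fun x hx => by simp only [hx])
  have h2 : ∫ x in U, v x * φ x = ∫ x in U, v' x * φ x :=
    integral_congr_ae (hv.mono fun x hx => by simp only [hx])
  rw [← h1, ← h2, h.2.2 φ hφ]

/-! ### Lipschitz functions on the plane -/

lemma norm_fderiv_apply_le {u : ℝ × ℝ → ℝ} {C : NNReal} (hu : LipschitzWith C u) (x e : ℝ × ℝ) :
    |fderiv ℝ u x e| ≤ C * ‖e‖ :=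
  ((fderiv ℝ u x).le_opNorm e).trans (by gcongr; exact norm_fderiv_le_of_lipschitz ℝ hu)

lemma aestronglyMeasurable_fderiv (u : ℝ × ℝ → ℝ) (e : ℝ × ℝ) (μ : Measure (ℝ × ℝ)) :
    AEStronglyMeasurable (fun x => fderiv ℝ u x e) μ :=
  (measurable_fderiv_apply_const ℝ u e).aestronglyMeasurable

lemma lineDeriv_ae_eq_fderiv {u : ℝ × ℝ → ℝ} {C : NNReal} (hu : LipschitzWith C u) (e : ℝ × ℝ) :
    ∀ᵐ x, lineDeriv ℝ u x e = fderiv ℝ u x e := by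
  filter_upwards [hu.ae_differentiableAt] with x hx
  exact hx.lineDeriv_eq_fderiv

/-- By Rademacher's theorem line derivatives are values of `fderiv` almost everywhere. Compact
support of `φ` removes the boundary terms, so no decay of `u` is needed. -/
lemma integral_fderiv_mul {u φ : ℝ × ℝ → ℝ} {C C' : NNReal} (hu : LipschitzWith C u)
    (hφ : LipschitzWith C' φ) (hc : HasCompactSupport φ) (e : ℝ × ℝ) :
    ∫ x, fderiv ℝ u x e * φ x = -∫ x, u x * fderiv ℝ φ x e := by
  have := hu.integral_lineDeriv_mul_eq (μ := volume) hφ hc e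
  rw [← integral_neg]
  refine Eq.trans (integral_congr_ae ?_) (this.trans (integral_congr_ae ?_))
  · filter_upwards [lineDeriv_ae_eq_fderiv hu e] with x hx
    rw [hx]
  · filter_upwards [lineDeriv_ae_eq_fderiv hφ (-e)] with x hx
    rw [hx]; simp [mul_comm]

lemma memLp_top_fderiv {u : ℝ × ℝ → ℝ} {C : NNReal} (hu : LipschitzWith C u) (e : ℝ × ℝ)
    (μ : Measure (ℝ × ℝ)) : MemLp (fun x => fderiv ℝ u x e) ⊤ μ :=
  memLp_top_of_bound (aestronglyMeasurable_fderiv u e μ) (C * ‖e‖)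
    (Eventually.of_forall fun x => norm_fderiv_apply_le hu x e)

lemma memLp_top_dy {u : ℝ × ℝ → ℝ} {C : NNReal} (hu : LipschitzWith C u)
    (μ : Measure (ℝ × ℝ)) : MemLp (dy u) ⊤ μ := memLp_top_fderiv hu _ μ

lemma memLp_top_dz {u : ℝ × ℝ → ℝ} {C : NNReal} (hu : LipschitzWith C u)
    (μ : Measure (ℝ × ℝ)) : MemLp (dz u) ⊤ μ := memLp_top_fderiv hu _ μ

lemma locallyIntegrable_fderiv {u : ℝ × ℝ → ℝ} {C : NNReal} (hu : LipschitzWith C u)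
    (e : ℝ × ℝ) : LocallyIntegrable (fun x => fderiv ℝ u x e) :=
  (memLp_top_fderiv hu e volume).locallyIntegrable le_top

lemma isWeakD_of_lipschitz {u : ℝ × ℝ → ℝ} {C : NNReal} (hu : LipschitzWith C u) (e : ℝ × ℝ)
    (U : Set (ℝ × ℝ)) : IsWeakD e U u (fun x => fderiv ℝ u x e) := by
  refine ⟨hu.continuous.locallyIntegrable.locallyIntegrableOn U,
    (locallyIntegrable_fderiv hu e).locallyIntegrableOn U, fun φ hφ => ?_⟩
  obtain ⟨C', hC'⟩ := hφ.lipschitz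
  rw [hφ.setIntegral_mul, hφ.setIntegral_mul_fderiv, integral_fderiv_mul hu hC' hφ.compact e,
    neg_neg]

lemma rect_subset_Icc (L a b : ℝ) : rect L a b ⊆ Icc (0, a) (L, b) := by
  rintro ⟨y, z⟩ ⟨hy, hz⟩
  exact ⟨⟨hy.1.le, hz.1.le⟩, ⟨hy.2.le, hz.2.le⟩⟩

lemma exists_bound_rect {u : ℝ × ℝ → ℝ} (hu : Continuous u) (L a b : ℝ) :
    ∃ C, ∀ x ∈ rect L a b, |u x| ≤ C := by
  obtain ⟨C, hC⟩ := (isCompact_Icc (a := ((0 : ℝ), a)) (b := (L, b))).exists_bound_of_continuousOn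
    hu.continuousOn
  exact ⟨C, fun x hx => hC x (rect_subset_Icc L a b hx)⟩

lemma memLp_rect_of_continuous {u : ℝ × ℝ → ℝ} (hu : Continuous u) (L a b : ℝ)
    (q : ENNReal) : MemLp u q (volume.restrict (rect L a b)) := by
  obtain ⟨C, hC⟩ := exists_bound_rect hu L a b
  exact MemLp.of_bound hu.aestronglyMeasurable C
    ((ae_restrict_mem (measurableSet_rect L a b)).mono hC)

lemma isH1_of_lipschitz {u : ℝ × ℝ → ℝ} {C : NNReal} (hu : LipschitzWith C u) (L a b : ℝ) :
    IsH1 (rect L a b) u (dy u) (dz u) where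
  mem := memLp_rect_of_continuous hu.continuous L a b 2
  mem_y := (memLp_top_fderiv hu _ _).mono_exponent le_top
  mem_z := (memLp_top_fderiv hu _ _).mono_exponent le_top
  weak_y := isWeakD_of_lipschitz hu _ _
  weak_z := isWeakD_of_lipschitz hu _ _

end Fingering

namespace Fingering

/-! ### Primitives on vertical lines -/

/-- The function with `∂_z = v` on vertical lines and value `t` at height `a`. -/
noncomputable def slicePrim (a : ℝ) (t : ℝ → ℝ) (v : ℝ × ℝ → ℝ) (x : ℝ × ℝ) : ℝ :=
  t x.1 + ∫ ζ in a..x.2, v (x.1, ζ)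

variable {L a b : ℝ} {t : ℝ → ℝ} {v : ℝ × ℝ → ℝ}

lemma slicePrim_base (y : ℝ) : slicePrim a t v (y, a) = t y := by simp [slicePrim]

lemma ae_ae_of_ae_rect {p : ℝ × ℝ → Prop} (h : ∀ᵐ x ∂volume.restrict (rect L a b), p x) :
    ∀ᵐ y ∂volume.restrict (Ioo 0 L), ∀ᵐ z ∂volume.restrict (Ioo a b), p (y, z) := by
  rw [volume_restrict_rect] at h
  exact Measure.ae_ae_of_ae_prod h

lemma ae_intervalIntegrable (hab : a ≤ b) (hv : IntegrableOn v (rect L a b)) :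
    ∀ᵐ y ∂volume.restrict (Ioo 0 L), IntervalIntegrable (fun z => v (y, z)) volume a b := by
  rw [IntegrableOn, volume_restrict_rect] at hv
  filter_upwards [hv.prod_right_ae] with y hy
  rwa [intervalIntegrable_iff_integrableOn_Ioo_of_le hab]

lemma setIntegral_rect {f : ℝ × ℝ → ℝ} (hf : IntegrableOn f (rect L a b)) :
    ∫ x in rect L a b, f x = ∫ y in Ioo 0 L, ∫ z in Ioo a b, f (y, z) := by
  rw [IntegrableOn, volume_restrict_rect] at hf
  rw [volume_restrict_rect, integral_prod _ hf]

lemma intervalIntegral_eq_Ioo {f : ℝ → ℝ} (hab : a ≤ b) :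
    ∫ z in a..b, f z = ∫ z in Ioo a b, f z := by
  rw [intervalIntegral.integral_of_le hab, integral_Ioc_eq_integral_Ioo]

lemma rect_mono {L a b a' b' : ℝ} (ha : a ≤ a') (hb : b' ≤ b) : rect L a' b' ⊆ rect L a b :=
  prod_mono le_rfl (Ioo_subset_Ioo ha hb)

lemma integrableOn_slicePrim_slice (ht : IntegrableOn t (Ioo 0 L))
    (hv : IntegrableOn v (rect L a b)) {z : ℝ} (hz : z ∈ Icc a b) :
    IntegrableOn (fun y => slicePrim a t v (y, z)) (Ioo 0 L) := by
  have h : IntegrableOn v (rect L a z) := hv.mono_set (rect_mono le_rfl hz.2)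
  rw [IntegrableOn, volume_restrict_rect] at h
  refine ht.add ?_
  have h' := h.integral_prod_left
  simpa only [IntegrableOn, intervalIntegral_eq_Ioo hz.1] using! h'

lemma aestronglyMeasurable_slicePrim (ht : IntegrableOn t (Ioo 0 L))
    (hv : IntegrableOn v (rect L a b)) :
    AEStronglyMeasurable (slicePrim a t v) (volume.restrict (rect L a b)) := by
  rw [IntegrableOn, volume_restrict_rect] at hv
  rw [volume_restrict_rect]
  refine AEStronglyMeasurable.add ht.aestronglyMeasurable.comp_fst ?_
  -- With a measurable version `w` of `v`, and the upper limit `x.2` encoded by the indicator of `{a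
  -- < ζ < x.2}`, the primitive becomes a parameter integral and is measurable by Fubini.
  obtain ⟨w, hw, hvw⟩ := hv.aestronglyMeasurable
  have hms : MeasurableSet {q : (ℝ × ℝ) × ℝ | a < q.2 ∧ q.2 < q.1.2 } :=
    (measurableSet_lt measurable_const measurable_snd).inter
      (measurableSet_lt measurable_snd (measurable_snd.comp measurable_fst))
  have h1 : StronglyMeasurable (fun x : ℝ × ℝ => ∫ ζ, ({q : (ℝ × ℝ) × ℝ | a < q.2 ∧ q.2 < q.1.2 }).indicator
      (fun q => w (q.1.1, q.2)) (x, ζ)) :=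
    StronglyMeasurable.integral_prod_right (ν := volume)
      ((hw.comp_measurable (by fun_prop)).indicator hms)
  refine ⟨_, h1, ?_⟩
  have h2 : ∀ᵐ x ∂(volume.restrict (Ioo 0 L)).prod (volume.restrict (Ioo a b)),
      ∀ᵐ ζ ∂volume.restrict (Ioo a b), v (x.1, ζ) = w (x.1, ζ) :=
    Measure.quasiMeasurePreserving_fst.ae (Measure.ae_ae_of_ae_prod hvw)
  have h3 : ∀ᵐ x ∂(volume.restrict (Ioo 0 L)).prod (volume.restrict (Ioo a b)), x.2 ∈ Ioo a b :=
    Measure.quasiMeasurePreserving_snd.ae (ae_restrict_mem measurableSet_Ioo)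
  filter_upwards [h2, h3] with x hx hx2
  rw [intervalIntegral_eq_Ioo hx2.1.le, ← integral_indicator measurableSet_Ioo]
  rw [ae_restrict_iff' measurableSet_Ioo] at hx
  refine integral_congr_ae ?_
  filter_upwards [hx] with ζ hζ
  by_cases h : ζ ∈ Ioo a x.2
  · rw [indicator_of_mem h, hζ ⟨h.1, h.2.trans hx2.2⟩, indicator_of_mem]
    exact h
  · rw [indicator_of_notMem h, indicator_of_notMem]
    exact h

lemma abs_slicePrim_le {y z : ℝ} (hv : IntervalIntegrable (fun z => v (y, z)) volume a b)
    (hz : z ∈ Icc a b) : |slicePrim a t v (y, z)| ≤ |t y| + ∫ ζ in Ioo a b, |v (y, ζ)| := by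
  refine (abs_add_le _ _).trans ?_
  gcongr
  refine (intervalIntegral.abs_integral_le_integral_abs hz.1).trans ?_
  rw [intervalIntegral_eq_Ioo hz.1]
  refine setIntegral_mono_set ?_ (Eventually.of_forall fun _ => abs_nonneg _)
    (Ioo_subset_Ioo le_rfl hz.2).eventuallyLE
  exact ((intervalIntegrable_iff_integrableOn_Ioo_of_le (hz.1.trans hz.2)).1 hv).norm

lemma integrableOn_slicePrim (hab : a ≤ b) (ht : IntegrableOn t (Ioo 0 L))
    (hv : IntegrableOn v (rect L a b)) : IntegrableOn (slicePrim a t v) (rect L a b) := by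
  have hm := aestronglyMeasurable_slicePrim ht hv
  have hi := ae_intervalIntegrable hab hv
  rw [IntegrableOn, volume_restrict_rect] at *
  have hG : Integrable (fun y => |t y| + ∫ ζ in Ioo a b, |v (y, ζ)|) (volume.restrict (Ioo 0 L)) :=
    ht.norm.add hv.norm.integral_prod_left
  refine (hG.comp_fst (volume.restrict (Ioo a b))).mono' hm ?_
  have h3 : ∀ᵐ x ∂(volume.restrict (Ioo 0 L)).prod (volume.restrict (Ioo a b)), x.2 ∈ Ioo a b :=
    Measure.quasiMeasurePreserving_snd.ae (ae_restrict_mem measurableSet_Ioo)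
  filter_upwards [h3, Measure.quasiMeasurePreserving_fst.ae hi] with x hx hi
  exact abs_slicePrim_le hi ⟨hx.1.le, hx.2.le⟩

lemma absolutelyContinuous_slicePrim {y : ℝ}
    (hv : IntervalIntegrable (fun z => v (y, z)) volume a b) :
    AbsolutelyContinuousOnInterval (fun z => slicePrim a t v (y, z)) a b :=
  ((LipschitzWith.const (t y)).lipschitzOnWith.absolutelyContinuousOnInterval).add
    (hv.absolutelyContinuousOnInterval_intervalIntegral left_mem_uIcc)

lemma ae_hasDerivAt_slicePrim {y : ℝ}
    (hv : IntervalIntegrable (fun z => v (y, z)) volume a b) :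
    ∀ᵐ z, z ∈ uIcc a b → HasDerivAt (fun z => slicePrim a t v (y, z)) (v (y, z)) z := by
  filter_upwards [hv.ae_hasDerivAt_integral] with z hz hzm
  exact (hz hzm a left_mem_uIcc).const_add (t y)

/-- The slices of a Lipschitz function on the plane, for almost every abscissa. -/
lemma ae_hasDerivAt_slice {φ : ℝ × ℝ → ℝ} {C : NNReal} (hφ : LipschitzWith C φ) :
    ∀ᵐ y : ℝ, ∀ᵐ z : ℝ, HasDerivAt (fun z => φ (y, z)) (dz φ (y, z)) z := by
  have h := hφ.ae_differentiableAt (μ := volume)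
  rw [Measure.volume_eq_prod] at h
  filter_upwards [Measure.ae_ae_of_ae_prod h] with y hy
  filter_upwards [hy] with z hz
  have h2 : HasDerivAt (fun z : ℝ => (y, z)) ((0 : ℝ), (1 : ℝ)) z :=
    (hasDerivAt_const z y).prodMk (hasDerivAt_id z)
  exact hz.hasFDerivAt.comp_hasDerivAt z h2

lemma lipschitzWith_slice {φ : ℝ × ℝ → ℝ} {C : NNReal} (hφ : LipschitzWith C φ) (y : ℝ) :
    LipschitzWith C (fun z => φ (y, z)) := by
  have := hφ.comp (LipschitzWith.prodMk_left (β := ℝ) y)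
  rwa [mul_one] at this

lemma integrableOn_rect_mul {f g : ℝ × ℝ → ℝ} (hf : IntegrableOn f (rect L a b))
    (hg : MemLp g ⊤ (volume.restrict (rect L a b))) :
    IntegrableOn (fun x => f x * g x) (rect L a b) := by
  have := hf.mul_of_top_left hg
  exact this

/-- Gauss-Green formula in the vertical direction. -/
lemma gauss_green (hab : a ≤ b) (ht : IntegrableOn t (Ioo 0 L))
    (hv : IntegrableOn v (rect L a b)) {φ : ℝ × ℝ → ℝ} {C : NNReal} (hφ : LipschitzWith C φ) :
    ∫ x in rect L a b, (slicePrim a t v x * dz φ x + v x * φ x) =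
      (∫ y in Ioo 0 L, slicePrim a t v (y, b) * φ (y, b)) - ∫ y in Ioo 0 L, t y * φ (y, a) := by
  have hint : IntegrableOn (fun x => slicePrim a t v x * dz φ x + v x * φ x) (rect L a b) :=
    (integrableOn_rect_mul (integrableOn_slicePrim hab ht hv) (memLp_top_dz hφ _)).add
      (integrableOn_rect_mul hv (memLp_rect_of_continuous hφ.continuous _ _ _ _))
  have hbd : ∀ z : ℝ, ∃ B, ∀ y ∈ Ioo 0 L, ‖φ (y, z)‖ ≤ B := fun z => by
    obtain ⟨B, hB⟩ := (isCompact_Icc (a := (0 : ℝ)) (b := L)).exists_bound_of_continuousOn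
      (f := fun y => φ (y, z)) (hφ.continuous.comp (by fun_prop)).continuousOn
    exact ⟨B, fun y hy => hB y (Ioo_subset_Icc_self hy)⟩
  have hmul : ∀ (w : ℝ → ℝ) (z : ℝ), IntegrableOn w (Ioo 0 L) →
      IntegrableOn (fun y => w y * φ (y, z)) (Ioo 0 L) := fun w z hw => by
    obtain ⟨B, hB⟩ := hbd z
    exact Integrable.mul_bdd (c := B) hw
      (hφ.continuous.comp (by fun_prop : Continuous fun y : ℝ => (y, z))).aestronglyMeasurable
      ((ae_restrict_mem measurableSet_Ioo).mono hB)
  rw [setIntegral_rect hint, ← integral_sub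
    (hmul _ b (integrableOn_slicePrim_slice ht hv (right_mem_Icc.2 hab))) (hmul _ a ht)]
  refine integral_congr_ae ?_
  filter_upwards [ae_intervalIntegrable hab hv, ae_restrict_of_ae (ae_hasDerivAt_slice hφ)]
    with y hy hφy
  -- On almost every vertical line both factors are absolutely continuous, so the product rule
  -- integrates to boundary values.
  have key := (absolutelyContinuous_slicePrim (t := t) hy).integral_deriv_mul_eq_sub
    ((lipschitzWith_slice hφ y).lipschitzOnWith.absolutelyContinuousOnInterval (a := a) (b := b))
  rw [slicePrim_base] at key
  rw [← key, ← intervalIntegral_eq_Ioo hab]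
  refine intervalIntegral.integral_congr_ae ?_
  filter_upwards [ae_hasDerivAt_slicePrim (t := t) hy, hφy] with z hz1 hz2 hz
  rw [(hz1 (uIoc_subset_uIcc hz)).deriv, hz2.deriv]
  ring

end Fingering

namespace Fingering

/-! ### Representation by primitives on vertical lines -/

variable {L a b : ℝ} {t : ℝ → ℝ} {u v : ℝ × ℝ → ℝ}

/-- `x ↦ -∫_0^T ψ(x + (0,r)) dr`. -/
noncomputable def upPrim (T : ℝ) (ψ : ℝ × ℝ → ℝ) (x : ℝ × ℝ) : ℝ :=
  -∫ r in Ioc 0 T, ψ (x + (0, r))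

/-- Up to sign, `upPrim T ψ` is the convolution of `ψ` with the image of Lebesgue measure on `(0,T]`
under `r ↦ (0,-r)`, a finite measure, so it inherits the smoothness of `ψ`. -/
lemma contDiff_upPrim {T : ℝ} {ψ : ℝ × ℝ → ℝ} (h : ContDiff ℝ (⊤ : ℕ∞) ψ)
    (hc : HasCompactSupport ψ) : ContDiff ℝ (⊤ : ℕ∞) (upPrim T ψ) := by
  have hm : Measurable fun r : ℝ => ((0 : ℝ), -r) := by fun_prop
  let μ : Measure (ℝ × ℝ) := (volume.restrict (Ioc 0 T)).map fun r : ℝ => ((0 : ℝ), -r)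
  have : IsFiniteMeasure μ := by dsimp only [μ]; infer_instance
  have hl : LocallyIntegrable (fun _ : ℝ × ℝ => (1 : ℝ)) μ := (integrable_const 1).locallyIntegrable
  have h1 := hc.contDiff_convolution_right (μ := μ) (ContinuousLinearMap.lsmul ℝ ℝ) hl h
  convert h1.neg using 1
  ext x
  simp only [upPrim, convolution, ContinuousLinearMap.lsmul_apply, one_smul, μ]
  rw [integral_map hm.aemeasurable (f := fun p => ψ (x - p))
    (h.continuous.comp (continuous_const.sub continuous_id)).aestronglyMeasurable]
  congr 1
  refine integral_congr_ae (Eventually.of_forall fun r => ?_)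
  simp only
  congr 1
  ext <;> simp

lemma upPrim_eq_zero {T : ℝ} {ψ : ℝ × ℝ → ℝ} {x : ℝ × ℝ}
    (h : ∀ r ∈ Icc 0 T, ψ (x + (0, r)) = 0) : upPrim T ψ x = 0 := by
  rw [upPrim, neg_eq_zero]
  exact setIntegral_eq_zero_of_forall_eq_zero fun r hr => h r (Ioc_subset_Icc_self hr)

lemma dz_eq_of_hasDerivAt {φ : ℝ × ℝ → ℝ} {y z d : ℝ} (hφ : DifferentiableAt ℝ φ (y, z))
    (h : HasDerivAt (fun z => φ (y, z)) d z) : dz φ (y, z) = d := by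
  have h2 : HasDerivAt (fun z : ℝ => (y, z)) ((0 : ℝ), (1 : ℝ)) z :=
    (hasDerivAt_const z y).prodMk (hasDerivAt_id z)
  exact (hφ.hasFDerivAt.comp_hasDerivAt z h2).unique h

lemma dz_upPrim {T : ℝ} (hT : 0 ≤ T) {ψ : ℝ × ℝ → ℝ} (h : ContDiff ℝ (⊤ : ℕ∞) ψ)
    (hc : HasCompactSupport ψ) (x : ℝ × ℝ) :
    dz (upPrim T ψ) x = ψ x - ψ (x + (0, T)) := by
  obtain ⟨y, z⟩ := x
  refine dz_eq_of_hasDerivAt ((contDiff_upPrim h hc).differentiable (by simp) _) ?_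
  have hcont : Continuous fun r : ℝ => ψ (y, r) := h.continuous.comp (by fun_prop)
  have h1 : ∀ z, upPrim T ψ (y, z) = (∫ r in 0..z, ψ (y, r)) - ∫ r in 0..(z + T), ψ (y, r) := by
    intro z
    have e1 : ∫ r in Ioc 0 T, ψ ((y, z) + (0, r)) = ∫ r in z..(z + T), ψ (y, r) := by
      rw [← intervalIntegral.integral_of_le hT]
      have := intervalIntegral.integral_comp_add_left (a := 0) (b := T) (fun r => ψ (y, r)) z
      simpa using this
    rw [upPrim, e1, ← intervalIntegral.integral_interval_sub_left
      (hcont.intervalIntegrable 0 _) (hcont.intervalIntegrable 0 _)]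
    ring
  have h2 : ∀ z, HasDerivAt (fun z => ∫ r in 0..z, ψ (y, r)) (ψ (y, z)) z := fun z =>
    intervalIntegral.integral_hasDerivAt_right (hcont.intervalIntegrable 0 z)
      hcont.aestronglyMeasurable.stronglyMeasurableAtFilter hcont.continuousAt
  have h3 : HasDerivAt (fun z => ∫ r in 0..(z + T), ψ (y, r)) (ψ (y, z + T)) z := by
    have := (h2 (z + T)).comp z ((hasDerivAt_id z).add_const T)
    rw [mul_one] at this
    exact this
  have e : ((y, z) : ℝ × ℝ) + (0, T) = (y, z + T) := by simp
  simp_rw [h1, e]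
  exact (h2 z).sub h3

/-- The support is that of `ψ` slid downwards by at most `T`. It stays below `b` but may cross
height `a`, which the definition of the bottom trace permits. -/
lemma isTestOn_upPrim {T : ℝ} {ψ : ℝ × ℝ → ℝ} (h : IsTestOn (rect L a b) ψ) :
    IsTestOn {x | x.2 < b} (upPrim T ψ) := by
  have hcpt : IsCompact ((fun q : (ℝ × ℝ) × ℝ => q.1 - (0, q.2)) '' (tsupport ψ ×ˢ Icc 0 T)) :=
    (IsCompact.prod h.compact isCompact_Icc).image (by fun_prop)
  have hz : ∀ x, x ∉ ((fun q : (ℝ × ℝ) × ℝ => q.1 - (0, q.2)) '' (tsupport ψ ×ˢ Icc 0 T)) →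
      upPrim T ψ x = 0 := fun x hx => upPrim_eq_zero fun r hr => by
    by_contra hne
    exact hx ⟨(x + (0, r), r), ⟨subset_tsupport _ hne, hr⟩, by simp⟩
  refine ⟨contDiff_upPrim h.smooth h.compact, HasCompactSupport.intro hcpt hz, ?_⟩
  have hsub : tsupport (upPrim T ψ) ⊆ _ :=
    closure_minimal (fun x hx => by_contra fun hx' => hx (hz x hx')) hcpt.isClosed
  refine hsub.trans ?_
  rintro _ ⟨⟨x, r⟩, ⟨hx, hr⟩, rfl⟩
  have := (h.supp hx).2.2
  simp only [mem_ofPred_eq, Prod.snd_sub]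
  linarith [hr.1]

/-- A function with bottom trace `t` and vertical derivative `v` is the primitive of `v`. -/
lemma ae_eq_slicePrim (hab : a ≤ b) (ht : IntegrableOn t (Ioo 0 L))
    (hu : IntegrableOn u (rect L a b)) (hv : IntegrableOn v (rect L a b))
    (h : IsBottomTrace L a b u v t) : u =ᵐ[volume.restrict (rect L a b)] slicePrim a t v := by
  have hW := integrableOn_slicePrim hab ht hv
  have key := ae_eq_zero_of_test (isOpen_rect L a b) (hu.sub hW).locallyIntegrableOn
    fun ψ hψ => by
      have hφ := isTestOn_upPrim (T := b - a) hψ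
      obtain ⟨C, hC⟩ := hφ.lipschitz
      have e1 := h.2 _ hφ
      have e2 := gauss_green hab ht hv hC
      have e3 : ∀ y, upPrim (b - a) ψ (y, b) = 0 := fun y =>
        hφ.eq_zero (by simp)
      simp only [e3, mul_zero, integral_zero, zero_sub] at e2
      -- With `T = b - a` the shifted point lies above height `b`, outside the support of `ψ`. Hence
      -- `ψ` is a `z`-derivative on the rectangle, and subtracting the trace identity for `u` and
      -- Gauss-Green for the primitive tests their difference with `ψ`.
      have hd : ∀ x ∈ rect L a b, dz (upPrim (b - a) ψ) x = ψ x := fun x hx => by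
        rw [dz_upPrim (by linarith) hψ.smooth hψ.compact, hψ.eq_zero (x := x + (0, b - a)), sub_zero]
        intro h'
        have h1 := h'.2.2
        have h2 := hx.2.1
        simp only [Prod.snd_add] at h1
        linarith
      have hi : ∀ w, IntegrableOn w (rect L a b) →
          IntegrableOn (fun x => w x * dz (upPrim (b - a) ψ) x) (rect L a b) := fun w hw =>
        integrableOn_rect_mul hw (memLp_top_dz hC _)
      have hi2 := integrableOn_rect_mul hv (memLp_rect_of_continuous hC.continuous L a b ⊤)
      rw [integral_add (hi _ hu) hi2] at e1
      rw [integral_add (hi _ hW) hi2] at e2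
      calc ∫ x in rect L a b, (u - slicePrim a t v) x * ψ x
          = ∫ x in rect L a b, (u x * dz (upPrim (b - a) ψ) x -
              slicePrim a t v x * dz (upPrim (b - a) ψ) x) := by
            refine setIntegral_congr_fun (measurableSet_rect L a b) fun x hx => ?_
            simp only [hd x hx, Pi.sub_apply]
            ring
        _ = 0 := by
            rw [integral_sub (hi _ hu) (hi _ hW)]
            linarith
  filter_upwards [key] with x hx
  simpa [sub_eq_zero] using hx

lemma isWeakDz_slicePrim (hab : a ≤ b) (ht : IntegrableOn t (Ioo 0 L))
    (hv : IntegrableOn v (rect L a b)) : IsWeakDz (rect L a b) (slicePrim a t v) v := by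
  have hW := integrableOn_slicePrim hab ht hv
  refine ⟨hW.locallyIntegrableOn, hv.locallyIntegrableOn, fun φ hφ => ?_⟩
  obtain ⟨C, hC⟩ := hφ.lipschitz
  have e := gauss_green hab ht hv hC
  have e3 : ∀ y, φ (y, b) = 0 := fun y => hφ.eq_zero (by simp [rect])
  have e4 : ∀ y, φ (y, a) = 0 := fun y => hφ.eq_zero (by simp [rect])
  rw [integral_add (integrableOn_rect_mul hW (memLp_top_dz hC _))
    (integrableOn_rect_mul hv (memLp_rect_of_continuous hC.continuous L a b ⊤))] at e
  simp only [e3, e4, mul_zero, integral_zero, sub_zero] at e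
  linarith

lemma isBottomTrace_slicePrim (hab : a ≤ b) (ht : MemLp t 2 (volume.restrict (Ioo 0 L)))
    (hv : IntegrableOn v (rect L a b)) : IsBottomTrace L a b (slicePrim a t v) v t := by
  refine ⟨ht, fun φ hφ => ?_⟩
  obtain ⟨C, hC⟩ := hφ.lipschitz
  have e3 : ∀ y, φ (y, b) = 0 := fun y => hφ.eq_zero (by simp)
  rw [gauss_green hab (ht.integrable one_le_two) hv hC]
  simp [e3]

lemma isTopTrace_slicePrim (hab : a ≤ b) (ht : IntegrableOn t (Ioo 0 L))
    (hv : IntegrableOn v (rect L a b))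
    (h2 : MemLp (fun y => slicePrim a t v (y, b)) 2 (volume.restrict (Ioo 0 L))) :
    IsTopTrace L a b (slicePrim a t v) v (fun y => slicePrim a t v (y, b)) := by
  refine ⟨h2, fun φ hφ => ?_⟩
  obtain ⟨C, hC⟩ := hφ.lipschitz
  have e3 : ∀ y, φ (y, a) = 0 := fun y => hφ.eq_zero (by simp)
  rw [gauss_green hab ht hv hC]
  simp [e3]

lemma IsTopTrace.congr {u' v' : ℝ × ℝ → ℝ} (h : IsTopTrace L a b u v t)
    (hu : u =ᵐ[volume.restrict (rect L a b)] u') (hv : v =ᵐ[volume.restrict (rect L a b)] v') :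
    IsTopTrace L a b u' v' t := by
  refine ⟨h.1, fun φ hφ => (h.2 φ hφ).symm.trans ?_ |>.symm⟩
  refine integral_congr_ae ?_
  filter_upwards [hu, hv] with x h1 h2
  rw [h1, h2]

lemma IsBottomTrace.congr {u' v' : ℝ × ℝ → ℝ} (h : IsBottomTrace L a b u v t)
    (hu : u =ᵐ[volume.restrict (rect L a b)] u') (hv : v =ᵐ[volume.restrict (rect L a b)] v') :
    IsBottomTrace L a b u' v' t := by
  refine ⟨h.1, fun φ hφ => (h.2 φ hφ).symm.trans ?_ |>.symm⟩
  refine integral_congr_ae ?_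
  filter_upwards [hu, hv] with x h1 h2
  rw [h1, h2]

/-- The trace on the upper side is unique. -/
lemma IsTopTrace.ae_eq_slicePrim {t' : ℝ → ℝ} (hab : a < b) (ht : IntegrableOn t (Ioo 0 L))
    (hv : IntegrableOn v (rect L a b)) (h : IsTopTrace L a b (slicePrim a t v) v t') :
    ∀ᵐ y ∂volume.restrict (Ioo 0 L), t' y = slicePrim a t v (y, b) := by
  have hS := integrableOn_slicePrim_slice ht hv (right_mem_Icc.2 hab.le)
  have ht' : IntegrableOn t' (Ioo 0 L) := h.1.integrable one_le_two
  -- `β` is `1` at height `b` and supported above `a`, so the products `α(y) β(z)` see only the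
  -- upper trace, tested with an arbitrary `α`.
  obtain ⟨β, hβ, hβc, hβs, -, hβb⟩ :=
    exists_contDiff_tsupport_subset (n := ⊤) (Ioi_mem_nhds hab)
  have key : ∀ᵐ y, y ∈ Ioo 0 L → (t' - fun y => slicePrim a t v (y, b)) y = 0 := by
    refine isOpen_Ioo.ae_eq_zero_of_integral_contDiff_smul_eq_zero
      (ht'.sub hS).locallyIntegrableOn fun α hα hαc hαs => ?_
    have hφ : IsTestOn {x : ℝ × ℝ | a < x.2} (fun x => α x.1 * β x.2) := by
      have hsub : tsupport (fun x : ℝ × ℝ => α x.1 * β x.2) ⊆ tsupport α ×ˢ tsupport β := by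
        refine closure_minimal (fun x hx => ?_)
          ((isClosed_tsupport α).prod (isClosed_tsupport β))
        have hx' := mul_ne_zero_iff.1 hx
        exact ⟨subset_tsupport _ hx'.1, subset_tsupport _ hx'.2⟩
      refine ⟨(hα.comp contDiff_fst).mul (hβs.comp contDiff_snd), ?_, fun x hx => hβ (hsub hx).2⟩
      exact (IsCompact.prod hαc hβc).of_isClosed_subset (isClosed_tsupport _) hsub
    obtain ⟨C, hC⟩ := hφ.lipschitz
    have e1 := h.2 _ hφ
    have e2 := gauss_green hab.le ht hv hC
    have e3 : ∀ y : ℝ, α y * β a = 0 := fun y => by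
      rw [image_eq_zero_of_notMem_tsupport (f := β) (fun h' => lt_irrefl a (hβ h')), mul_zero]
    rw [e1] at e2
    simp only [e3, hβb, mul_one, mul_zero, integral_zero, sub_zero] at e2
    have hi : ∀ w, IntegrableOn w (Ioo 0 L) → IntegrableOn (fun y => w y * α y) (Ioo 0 L) :=
      fun w hw => by
        obtain ⟨B, hB⟩ := hαc.exists_bound_of_continuous hα.continuous
        exact Integrable.mul_bdd (c := B) hw hα.continuous.aestronglyMeasurable
          (Eventually.of_forall hB)
    rw [← setIntegral_eq_integral_of_forall_compl_eq_zero (s := Ioo 0 L) fun y hy => ?_]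
    · calc _ = ∫ y in Ioo 0 L, (t' y * α y - slicePrim a t v (y, b) * α y) := by
            congr 1; ext y; simp; ring
        _ = 0 := by rw [integral_sub (hi _ ht') (hi _ hS), e2, sub_self]
    · rw [image_eq_zero_of_notMem_tsupport (f := α) (fun h' => hy (hαs h')), zero_smul]
  rw [ae_restrict_iff' measurableSet_Ioo]
  filter_upwards [key] with y hy hym
  simpa [sub_eq_zero] using hy hym

/-- Lipschitz functions are primitives of their derivative on vertical lines. -/
lemma slicePrim_of_lipschitz {φ : ℝ × ℝ → ℝ} {C : NNReal} (hφ : LipschitzWith C φ) (a : ℝ) :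
    ∀ᵐ y : ℝ, ∀ z, slicePrim a (fun y => φ (y, a)) (dz φ) (y, z) = φ (y, z) := by
  filter_upwards [ae_hasDerivAt_slice hφ] with y hy z
  have h1 := ((lipschitzWith_slice hφ y).lipschitzOnWith.absolutelyContinuousOnInterval
    (a := a) (b := z)).integral_deriv_eq_sub
  have h2 : ∫ ζ in a..z, dz φ (y, ζ) = ∫ ζ in a..z, deriv (fun z => φ (y, z)) ζ :=
    intervalIntegral.integral_congr_ae (hy.mono fun ζ hζ _ => hζ.deriv.symm)
  rw [slicePrim, h2, h1]
  ring

lemma ae_slicePrim_of_lipschitz {φ : ℝ × ℝ → ℝ} {C : NNReal} (hφ : LipschitzWith C φ) :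
    slicePrim a (fun y => φ (y, a)) (dz φ) =ᵐ[volume.restrict (rect L a b)] φ := by
  have h := ae_restrict_of_ae (s := Ioo 0 L) (slicePrim_of_lipschitz hφ a)
  rw [volume_restrict_rect]
  filter_upwards [Measure.quasiMeasurePreserving_fst.ae h] with x hx
  exact hx x.2

lemma memLp_lipschitz_slice {φ : ℝ × ℝ → ℝ} {C : NNReal} (hφ : LipschitzWith C φ) (z : ℝ) :
    MemLp (fun y => φ (y, z)) 2 (volume.restrict (Ioo 0 L)) := by
  have hc : Continuous fun y => φ (y, z) := hφ.continuous.comp (by fun_prop)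
  obtain ⟨B, hB⟩ := (isCompact_Icc (a := (0 : ℝ)) (b := L)).exists_bound_of_continuousOn
    hc.continuousOn
  exact MemLp.of_bound hc.aestronglyMeasurable B
    ((ae_restrict_mem measurableSet_Ioo).mono fun y hy => hB y (Ioo_subset_Icc_self hy))

lemma integrableOn_dz_lipschitz {φ : ℝ × ℝ → ℝ} {C : NNReal} (hφ : LipschitzWith C φ) :
    IntegrableOn (dz φ) (rect L a b) :=
  (memLp_top_dz hφ (volume.restrict (rect L a b))).integrable le_top

lemma isBottomTrace_lipschitz (hab : a ≤ b) {φ : ℝ × ℝ → ℝ} {C : NNReal}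
    (hφ : LipschitzWith C φ) : IsBottomTrace L a b φ (dz φ) (fun y => φ (y, a)) :=
  (isBottomTrace_slicePrim hab (memLp_lipschitz_slice hφ a) (integrableOn_dz_lipschitz hφ)).congr
    (ae_slicePrim_of_lipschitz hφ) (ae_eq_refl _)

lemma isTopTrace_lipschitz (hab : a ≤ b) {φ : ℝ × ℝ → ℝ} {C : NNReal}
    (hφ : LipschitzWith C φ) : IsTopTrace L a b φ (dz φ) (fun y => φ (y, b)) := by
  have h := ae_restrict_of_ae (s := Ioo 0 L) (slicePrim_of_lipschitz hφ a)
  have h1 := (isTopTrace_slicePrim (L := L) hab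
    ((memLp_lipschitz_slice hφ a).integrable one_le_two) (integrableOn_dz_lipschitz hφ)
    ((memLp_lipschitz_slice hφ b).ae_eq (h.mono fun y hy => (hy b).symm))).congr
    (ae_slicePrim_of_lipschitz hφ) (ae_eq_refl _)
  refine ⟨memLp_lipschitz_slice hφ b, fun ψ hψ => (h1.2 ψ hψ).trans ?_⟩
  exact integral_congr_ae (h.mono fun y hy => by simp only [hy b])

end Fingering

namespace Fingering

/-! ### Functions with bounded weak gradient -/

/-- A mollification at scale `r` is controlled only on this inner parallel set. Its convexity is
what the mean value inequality needs. -/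
lemma convex_inner {U : Set (ℝ × ℝ)} (hU : Convex ℝ U) (r : ℝ) :
    Convex ℝ {x | Metric.closedBall x r ⊆ U} := by
  intro x hx y hy a b ha hb hab w hw
  rw [Metric.mem_closedBall, dist_eq_norm] at hw
  have e : w = a • (x + (w - (a • x + b • y))) + b • (y + (w - (a • x + b • y))) := by
    rw [smul_add, smul_add, add_add_add_comm, ← add_smul, hab, one_smul]; abel
  rw [e]
  refine hU (hx ?_) (hy ?_) ha hb hab <;> simpa [Metric.mem_closedBall, dist_eq_norm] using hw

/-- A function on a convex open set with bounded weak gradient agrees almost everywhere with a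
Lipschitz function on the plane. -/
lemma exists_lipschitz_of_weakD {U : Set (ℝ × ℝ)} (hU : IsOpen U) (hUc : Convex ℝ U)
    {u uy uz : ℝ × ℝ → ℝ} (hu : IntegrableOn u U) (hy : IsWeakDy U u uy) (hz : IsWeakDz U u uz)
    {C : NNReal} (hyC : ∀ᵐ x ∂volume.restrict U, |uy x| ≤ C)
    (hzC : ∀ᵐ x ∂volume.restrict U, |uz x| ≤ C) :
    ∃ P, LipschitzWith (2 * C) P ∧ u =ᵐ[volume.restrict U] P := by
  let v := U.indicator u
  have hv : LocallyIntegrable v := (hu.integrable_indicator hU.measurableSet).locallyIntegrable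
  let r : ℕ → ℝ := fun n => 1 / (n + 1)
  have hr : ∀ n, 0 < r n := fun n => by positivity
  let β : ℕ → ContDiffBump (0 : ℝ × ℝ) := fun n => ⟨r n / 2, r n, by linarith [hr n], by linarith [hr n]⟩
  let ρ : ℕ → ℝ × ℝ → ℝ := fun n => (β n).normed volume
  have hρ : ∀ n, ContDiff ℝ (⊤ : ℕ∞) (ρ n) := fun n => (β n).contDiff_normed
  have hρc : ∀ n, HasCompactSupport (ρ n) := fun n => (β n).hasCompactSupport_normed
  let M := (ContinuousLinearMap.lsmul ℝ ℝ : ℝ →L[ℝ] ℝ →L[ℝ] ℝ).flip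
  let w : ℕ → ℝ × ℝ → ℝ := fun n => convolution v (ρ n) M volume
  have hw : ∀ᵐ x, Tendsto (fun n => w n x) atTop (𝓝 (v x)) := by
    have := ContDiffBump.ae_convolution_tendsto_right_of_locallyIntegrable (φ := β) (l := atTop)
      (K := 2) (μ := volume) tendsto_one_div_add_atTop_nhds_zero_nat
      (Eventually.of_forall fun n => by simp [β]; linarith) hv
    filter_upwards [this] with x hx
    have e : ∀ n, w n x = convolution (ρ n) v (ContinuousLinearMap.lsmul ℝ ℝ) volume x := fun n => by
      rw [← convolution_flip]
    simp_rw [e]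
    exact hx
  have hder : ∀ n x, HasFDerivAt (w n) (fderiv ℝ (w n) x) x := fun n x =>
    ((hρc n).hasFDerivAt_convolution_right M hv ((hρ n).of_le (by simp)) x).differentiableAt.hasFDerivAt
  have hder' : ∀ n x e, fderiv ℝ (w n) x e = ∫ q, v q * fderiv ℝ (ρ n) (x - q) e := fun n x e => by
    rw [((hρc n).hasFDerivAt_convolution_right M hv ((hρ n).of_le (by simp)) x).fderiv,
      convolution_precompR_apply M hv ((hρc n).fderiv ℝ) ((hρ n).continuous_fderiv (by simp))]
    simp [convolution, M, mul_comm]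
  let V : ℕ → Set (ℝ × ℝ) := fun n => {x | Metric.closedBall x (r n) ⊆ U}
  -- Differentiating the mollification moves the derivative onto the kernel. When the kernel around
  -- `x` is supported in `U`, it is a test function and the derivative is an average of `ue`.
  have hbd : ∀ n, ∀ x ∈ V n, ∀ (e : ℝ × ℝ) (ue : ℝ × ℝ → ℝ), IsWeakD e U u ue →
      (∀ᵐ x ∂volume.restrict U, |ue x| ≤ C) → |fderiv ℝ (w n) x e| ≤ C := by
    intro n x hx e ue hue hC
    let ψ : ℝ × ℝ → ℝ := fun q => ρ n (x - q)
    have hψs : Function.support ψ ⊆ Metric.closedBall x (r n) := fun q hq => by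
      have : x - q ∈ Function.support (ρ n) := hq
      rw [(β n).support_normed_eq] at this
      have h2 : dist (x - q) 0 < r n := this
      rw [dist_zero_right] at h2
      rw [Metric.mem_closedBall, dist_eq_norm, norm_sub_rev]
      exact h2.le
    have hψt : tsupport ψ ⊆ Metric.closedBall x (r n) :=
      closure_minimal hψs Metric.isClosed_closedBall
    have hψ : IsTestOn U ψ := ⟨(hρ n).comp (contDiff_const.sub contDiff_id),
      (isCompact_closedBall x (r n)).of_isClosed_subset (isClosed_tsupport _) hψt, hψt.trans hx⟩
    have hdψ : ∀ q, fderiv ℝ ψ q e = -fderiv ℝ (ρ n) (x - q) e := fun q => by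
      have h1 : HasFDerivAt (fun q : ℝ × ℝ => x - q) (-ContinuousLinearMap.id ℝ (ℝ × ℝ)) q :=
        (hasFDerivAt_id q).const_sub x
      have h2 := (((hρ n).differentiable (by simp)) (x - q)).hasFDerivAt.comp q h1
      have h3 : HasFDerivAt ψ _ q := h2
      rw [h3.fderiv]; simp
    have e1 : fderiv ℝ (w n) x e = ∫ q in U, ue q * ψ q := by
      have := hue.2.2 ψ hψ
      simp only [hdψ, mul_neg, integral_neg, neg_inj] at this
      rw [hder', ← this, ← integral_indicator hU.measurableSet]
      congr 1; ext q
      by_cases hq : q ∈ U <;> simp [v, hq]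
    have hi : Integrable (fun q => C * ψ q) :=
      (hψ.smooth.continuous.integrable_of_hasCompactSupport hψ.compact).const_mul _
    have hψ0 : ∀ q, 0 ≤ ψ q := fun q => (β n).nonneg_normed _
    rw [e1]
    calc |∫ q in U, ue q * ψ q| ≤ ∫ q in U, C * ψ q := by
          rw [← Real.norm_eq_abs]
          refine norm_integral_le_of_norm_le hi.integrableOn (hC.mono fun q hq => ?_)
          rw [norm_mul, Real.norm_eq_abs, Real.norm_eq_abs, abs_of_nonneg (hψ0 q)]
          exact mul_le_mul_of_nonneg_right hq (hψ0 q)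
      _ ≤ ∫ q, C * ψ q := setIntegral_le_integral hi
          (Eventually.of_forall fun q => mul_nonneg C.2 (hψ0 q))
      _ = C := by
          rw [integral_const_mul, integral_sub_left_eq_self (ρ n) volume x,
            (β n).integral_normed, mul_one]
  -- The factor `2` comes from the sup norm on `ℝ × ℝ`: each of the two partial derivatives
  -- contributes `C ‖e‖`.
  have hlip : ∀ n, ∀ x ∈ V n, ∀ y ∈ V n, ‖w n y - w n x‖ ≤ 2 * C * ‖y - x‖ := by
    intro n x hx y hy'
    refine (convex_inner hUc (r n)).norm_image_sub_le_of_norm_hasFDerivWithin_le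
      (fun q hq => (hder n q).hasFDerivWithinAt) (fun q hq => ?_) hx hy'
    refine ContinuousLinearMap.opNorm_le_bound _ (by positivity) fun e => ?_
    have e0 : e = e.1 • ((1 : ℝ), (0 : ℝ)) + e.2 • ((0 : ℝ), (1 : ℝ)) := by ext <;> simp
    have h1 := hbd n q hq (1, 0) uy hy hyC
    have h2 := hbd n q hq (0, 1) uz hz hzC
    calc ‖fderiv ℝ (w n) q e‖ = |e.1 * fderiv ℝ (w n) q (1, 0) + e.2 * fderiv ℝ (w n) q (0, 1)| := by
          conv_lhs => rw [e0]
          rw [map_add, map_smul, map_smul, smul_eq_mul, smul_eq_mul, Real.norm_eq_abs]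
      _ ≤ |e.1| * C + |e.2| * C := by
          refine (abs_add_le _ _).trans ?_
          rw [abs_mul, abs_mul]; gcongr
      _ ≤ ‖e‖ * C + ‖e‖ * C := by
          gcongr
          · exact norm_fst_le e
          · exact norm_snd_le e
      _ = 2 * C * ‖e‖ := by ring
  let G : Set (ℝ × ℝ) := {x | x ∈ U ∧ Tendsto (fun n => w n x) atTop (𝓝 (v x))}
  have hVev : ∀ x ∈ U, ∀ᶠ n in atTop, x ∈ V n := fun x hx => by
    obtain ⟨ε, hε, hεU⟩ := Metric.nhds_basis_closedBall.mem_iff.1 (hU.mem_nhds hx)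
    have : Tendsto r atTop (𝓝 0) := tendsto_one_div_add_atTop_nhds_zero_nat
    filter_upwards [this.eventually_lt_const hε] with n hn
    exact (Metric.closedBall_subset_closedBall hn.le).trans hεU
  -- Any two points of `U` eventually lie in the inner sets, so the uniform Lipschitz bound passes
  -- to the limit on the full-measure set of convergence. A Lipschitz function on a subset extends
  -- to the plane.
  have hG : LipschitzOnWith (2 * C) v G := by
    refine LipschitzOnWith.of_dist_le_mul fun x hx y hy' => ?_
    refine le_of_tendsto (hx.2.dist hy'.2) ?_
    filter_upwards [hVev x hx.1, hVev y hy'.1] with n h1 h2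
    rw [dist_eq_norm, dist_eq_norm]
    exact hlip n y h2 x h1
  obtain ⟨P, hP, hPv⟩ := hG.extend_real
  refine ⟨P, hP, ?_⟩
  rw [EventuallyEq, ae_restrict_iff' hU.measurableSet]
  filter_upwards [hw] with x hx hxU
  rw [← hPv ⟨hxU, hx⟩]
  simp [v, hxU]

/-! ### Equi-Lipschitz sequences -/

/-- Arzelà-Ascoli with values on a dense sequence: these lie in a compact product of intervals, so a
subsequence converges there, and the common Lipschitz constant makes it Cauchy at every other point.
-/
lemma exists_subseq_tendsto_of_lipschitz {E : Type*} [PseudoMetricSpace E]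
    [TopologicalSpace.SeparableSpace E] {C : NNReal} {P : ℕ → E → ℝ}
    (hP : ∀ n, LipschitzWith C (P n)) {x0 : E} {B : ℝ} (hB : ∀ n, |P n x0| ≤ B) :
    ∃ (θ : ℕ → ℕ) (Q : E → ℝ), StrictMono θ ∧ LipschitzWith C Q ∧
      ∀ x, Tendsto (fun n => P (θ n) x) atTop (𝓝 (Q x)) := by
  have : Nonempty E := ⟨x0⟩
  let d := TopologicalSpace.denseSeq E
  have hc : IsCompact (Set.pi univ fun k => Icc (-(B + C * dist (d k) x0)) (B + C * dist (d k) x0)) :=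
    isCompact_univ_pi fun k => isCompact_Icc
  obtain ⟨q, -, θ, hθ, hq⟩ := hc.tendsto_subseq (x := fun n k => P n (d k)) fun n k _ => by
    have h1 := (hP n).dist_le_mul (d k) x0
    rw [Real.dist_eq] at h1
    have h2 := abs_sub_abs_le_abs_sub (P n (d k)) (P n x0)
    exact abs_le.1 (by linarith [hB n])
  rw [tendsto_pi_nhds] at hq
  have hcau : ∀ x, ∃ l, Tendsto (fun n => P (θ n) x) atTop (𝓝 l) := fun x => by
    refine cauchySeq_tendsto_of_complete (Metric.cauchySeq_iff'.2 fun ε hε => ?_)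
    obtain ⟨k, hk⟩ := (TopologicalSpace.denseRange_denseSeq E).exists_dist_lt x
      (show 0 < ε / 3 / (C + 1) by positivity)
    obtain ⟨N, hN⟩ := Metric.cauchySeq_iff'.1 (hq k).cauchySeq (ε / 3) (by positivity)
    refine ⟨N, fun n hn => ?_⟩
    have h0 : C * dist x (d k) < ε / 3 := by
      rw [lt_div_iff₀ (by positivity)] at hk
      have : (0 : ℝ) ≤ dist x (d k) := dist_nonneg
      nlinarith
    have h1 := (hP (θ n)).dist_le_mul x (d k)
    have h2 := (hP (θ N)).dist_le_mul x (d k)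
    have h3 := hN n hn
    simp only [Function.comp] at h3
    calc dist (P (θ n) x) (P (θ N) x) ≤ dist (P (θ n) x) (P (θ n) (d k)) +
          dist (P (θ n) (d k)) (P (θ N) (d k)) + dist (P (θ N) (d k)) (P (θ N) x) :=
          dist_triangle4 _ _ _ _
      _ < ε := by rw [dist_comm (P (θ N) (d k))]; linarith
  choose Q hQ using hcau
  refine ⟨θ, Q, hθ, LipschitzWith.of_dist_le_mul fun x y => ?_, hQ⟩
  exact le_of_tendsto ((hQ x).dist (hQ y)) (Eventually.of_forall fun n => (hP _).dist_le_mul x y)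

/-- Derivatives of an equi-Lipschitz pointwise convergent sequence converge weakly. -/
lemma tendsto_integral_fderiv_mul {C : NNReal} {P : ℕ → ℝ × ℝ → ℝ} {Q : ℝ × ℝ → ℝ}
    (hP : ∀ n, LipschitzWith C (P n)) (hQ : LipschitzWith C Q)
    (h : ∀ x, Tendsto (fun n => P n x) atTop (𝓝 (Q x))) {ψ : ℝ × ℝ → ℝ} (hψ : Integrable ψ)
    (e : ℝ × ℝ) :
    Tendsto (fun n => ∫ x, fderiv ℝ (P n) x e * ψ x) atTop (𝓝 (∫ x, fderiv ℝ Q x e * ψ x)) := by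
  obtain ⟨B, hB⟩ := (h 0).norm.bddAbove_range
  have hB' : ∀ n, |P n 0| ≤ B := fun n => hB ⟨n, rfl⟩
  -- For smooth compactly supported `g` the derivative moves onto `g`, where pointwise convergence
  -- of `P n` is enough. Integrable weights follow by `L¹` density, the derivatives being bounded by
  -- `C ‖e‖`.
  have smooth : ∀ g : ℝ × ℝ → ℝ, ContDiff ℝ (⊤ : ℕ∞) g → HasCompactSupport g →
      Tendsto (fun n => ∫ x, fderiv ℝ (P n) x e * g x) atTop (𝓝 (∫ x, fderiv ℝ Q x e * g x)) := by
    intro g hg hgc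
    obtain ⟨K, hK⟩ := ContDiff.lipschitzWith_of_hasCompactSupport hgc hg (by simp)
    simp_rw [fun n => integral_fderiv_mul (hP n) hK hgc e, integral_fderiv_mul hQ hK hgc e]
    refine Tendsto.neg ?_
    have hcg : Continuous fun x => fderiv ℝ g x e :=
      (hg.continuous_fderiv (by simp)).clm_apply continuous_const
    have hcc : HasCompactSupport fun x => fderiv ℝ g x e := hgc.fderiv_apply ℝ e
    refine tendsto_integral_of_dominated_convergence
      (fun x => (B + C * ‖x‖) * ‖fderiv ℝ g x e‖)
      (fun n => ((hP n).continuous.mul hcg).aestronglyMeasurable) ?_ ?_ ?_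
    · refine Continuous.integrable_of_hasCompactSupport (by fun_prop) ?_
      exact hcc.norm.mul_left
    · intro n
      refine Eventually.of_forall fun x => ?_
      rw [norm_mul]
      gcongr
      have h1 := (hP n).dist_le_mul x 0
      rw [Real.dist_eq, dist_zero_right] at h1
      have h2 := abs_sub_abs_le_abs_sub (P n x) (P n 0)
      rw [Real.norm_eq_abs]
      linarith [hB' n]
    · exact Eventually.of_forall fun x => (h x).mul tendsto_const_nhds
  rw [Metric.tendsto_atTop]
  intro ε hε
  set K : ℝ := C * ‖e‖ with hKdef
  have hK0 : 0 ≤ K := by positivity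
  -- The approximation error is later multiplied by `K`, leaving at most `ε / 4`; the `+ 1` covers
  -- `K = 0`.
  obtain ⟨g, hgc, hg, hgψ⟩ := (memLp_one_iff_integrable.2 hψ).exist_eLpNorm_sub_le
    (by simp) le_rfl (show 0 < ε / 4 / (K + 1) by positivity)
  have hgi : Integrable g := hg.continuous.integrable_of_hasCompactSupport hgc
  have hdiff : ∫ x, ‖ψ x - g x‖ ≤ ε / 4 / (K + 1) := by
    change ∫ x, ‖(ψ - g) x‖ ≤ _
    rw [integral_norm_eq_lintegral_enorm (hψ.sub hgi).aestronglyMeasurable]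
    rw [eLpNorm_one_eq_lintegral_enorm] at hgψ
    exact ENNReal.toReal_le_of_le_ofReal (by positivity) hgψ
  have hint : ∀ (R : ℝ × ℝ → ℝ), LipschitzWith C R → ∀ f, Integrable f →
      Integrable fun x => fderiv ℝ R x e * f x := fun R hR f hf =>
    hf.bdd_mul (aestronglyMeasurable_fderiv R e _)
      (Eventually.of_forall fun x => norm_fderiv_apply_le hR x e)
  have hest : ∀ (R : ℝ × ℝ → ℝ), LipschitzWith C R →
      |∫ x, fderiv ℝ R x e * ψ x - fderiv ℝ R x e * g x| ≤ ε / 4 := by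
    intro R hR
    calc |∫ x, fderiv ℝ R x e * ψ x - fderiv ℝ R x e * g x| ≤ ∫ x, K * ‖ψ x - g x‖ := by
          rw [← Real.norm_eq_abs]
          refine norm_integral_le_of_norm_le (g := fun x => K * ‖ψ x - g x‖) ((hψ.sub hgi).norm.const_mul K)
            (Eventually.of_forall fun x => ?_)
          rw [← mul_sub, norm_mul]
          gcongr
          exact norm_fderiv_apply_le hR x e
      _ ≤ K * (ε / 4 / (K + 1)) := by rw [integral_const_mul]; gcongr
      _ ≤ ε / 4 := by
          rw [mul_div_assoc', div_le_iff₀ (by positivity)]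
          nlinarith
  obtain ⟨N, hN⟩ := Metric.tendsto_atTop.1 (smooth g hg hgc) (ε / 4) (by positivity)
  refine ⟨N, fun n hn => ?_⟩
  have h1 := hest (P n) (hP n)
  have h2 := hest Q hQ
  have h3 := hN n hn
  rw [integral_sub (hint _ (hP n) _ hψ) (hint _ (hP n) _ hgi)] at h1
  rw [integral_sub (hint _ hQ _ hψ) (hint _ hQ _ hgi)] at h2
  rw [Real.dist_eq] at h3 ⊢
  rw [abs_le] at h1 h2
  rw [abs_lt] at h3 ⊢
  constructor <;> linarith

end Fingering

namespace Fingering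

/-! ### The permeability -/

/-- The permeability, extended by constants outside `[0,1]`. -/
noncomputable def kExt (k : ℝ → ℝ) (σ : ℝ) : ℝ := k (max 0 (min 1 σ))

section Permeability

variable {k : ℝ → ℝ}

lemma clamp_mem (σ : ℝ) : max 0 (min 1 σ) ∈ Icc (0 : ℝ) 1 :=
  ⟨le_max_left _ _, max_le zero_le_one (min_le_left _ _)⟩

lemma kExt_eq {σ : ℝ} (h : σ ∈ Icc (0 : ℝ) 1) : kExt k σ = k σ := by
  rw [kExt, min_eq_right h.2, max_eq_right h.1]

lemma PermeabilityAssumption.strictMonoOn (hk : PermeabilityAssumption k) :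
    StrictMonoOn k (Icc 0 1) :=
  strictMonoOn_of_deriv_pos (convex_Icc 0 1) hk.diff.continuousOn fun σ hσ =>
    hk.deriv_pos σ (by rwa [interior_Icc] at hσ)

/-- Clamping the argument makes the permeability continuous, monotone and bounded on all of `ℝ`, so
measurability and domination of `k(s)` need no information on the range of `s`. -/
lemma continuous_kExt (hk : PermeabilityAssumption k) : Continuous (kExt k) :=
  hk.diff.continuousOn.comp_continuous (by fun_prop) clamp_mem

lemma monotone_kExt (hk : PermeabilityAssumption k) : Monotone (kExt k) := fun σ σ' h =>
  hk.strictMonoOn.monotoneOn (clamp_mem σ) (clamp_mem σ')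
    (max_le_max le_rfl (min_le_min le_rfl h))

lemma kExt_nonneg (hk : PermeabilityAssumption k) (σ : ℝ) : 0 ≤ kExt k σ :=
  hk.nonneg _ (clamp_mem σ)

lemma kExt_le (hk : PermeabilityAssumption k) (σ : ℝ) : kExt k σ ≤ k 1 :=
  hk.strictMonoOn.monotoneOn (clamp_mem σ) (right_mem_Icc.2 zero_le_one) (clamp_mem σ).2

lemma kExt_pos (hk : PermeabilityAssumption k) {σ : ℝ} (h : 0 < σ) : 0 < kExt k σ :=
  (hk.nonneg 0 (left_mem_Icc.2 zero_le_one)).trans_lt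
    (hk.strictMonoOn (left_mem_Icc.2 zero_le_one) (clamp_mem σ)
      (lt_max_of_lt_right (lt_min one_pos h)))

lemma k_one_nonneg (hk : PermeabilityAssumption k) : 0 ≤ k 1 :=
  hk.nonneg 1 (right_mem_Icc.2 zero_le_one)

lemma abs_kExt_le (hk : PermeabilityAssumption k) (σ : ℝ) : |kExt k σ| ≤ k 1 := by
  rw [abs_of_nonneg (kExt_nonneg hk σ)]; exact kExt_le hk σ

/-- `k` is assumed `C²` only on the open interval, hence the restriction to compact subintervals.
Along a slice below the top the saturation stays in such a subinterval. -/
lemma exists_lipschitzOnWith_kExt (hk : PermeabilityAssumption k) {α β : ℝ} (hα : 0 < α)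
    (hβ : β < 1) : ∃ C, LipschitzOnWith C (kExt k) (Icc α β) := by
  have hsub : Icc α β ⊆ Ioo 0 1 := fun x hx => ⟨hα.trans_le hx.1, hx.2.trans_lt hβ⟩
  obtain ⟨C, hC⟩ := ((hk.smooth.of_le (by norm_num)).mono hsub :
    ContDiffOn ℝ 1 k (Icc α β)).exists_lipschitzOnWith one_ne_zero (convex_Icc α β) isCompact_Icc
  exact ⟨C, fun x hx y hy => by
    rw [kExt_eq (Ioo_subset_Icc_self (hsub hx)), kExt_eq (Ioo_subset_Icc_self (hsub hy))]
    exact hC hx hy⟩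

end Permeability

/-! ### Absolutely continuous functions on intervals -/

/-- This makes `k(s(y,·))` absolutely continuous on a slice, so that `k(s) ∂_z p` can be integrated
by parts. -/
lemma AbsolutelyContinuousOnInterval_comp {f k : ℝ → ℝ} {a b : ℝ} {s : Set ℝ} {C : NNReal}
    (hf : AbsolutelyContinuousOnInterval f a b) (hk : LipschitzOnWith C k s)
    (hs : MapsTo f (uIcc a b) s) : AbsolutelyContinuousOnInterval (fun z => k (f z)) a b := by
  rw [absolutelyContinuousOnInterval_iff] at hf ⊢
  intro ε hε
  obtain ⟨δ, hδ, h⟩ := hf (ε / (C + 1)) (by positivity)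
  refine ⟨δ, hδ, fun E hE hlen => ?_⟩
  have h1 := h E hE hlen
  rw [lt_div_iff₀ (by positivity)] at h1
  calc ∑ i ∈ Finset.range E.1, dist (k (f (E.2 i).1)) (k (f (E.2 i).2))
      ≤ ∑ i ∈ Finset.range E.1, C * dist (f (E.2 i).1) (f (E.2 i).2) := by
        refine Finset.sum_le_sum fun i hi => ?_
        have := hE.1 i hi
        exact hk.dist_le_mul _ (hs this.1) _ (hs this.2)
    _ ≤ (∑ i ∈ Finset.range E.1, dist (f (E.2 i).1) (f (E.2 i).2)) * (C + 1) := by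
        rw [← Finset.mul_sum, mul_comm]
        have : 0 ≤ ∑ i ∈ Finset.range E.1, dist (f (E.2 i).1) (f (E.2 i).2) :=
          Finset.sum_nonneg fun _ _ => dist_nonneg
        nlinarith
    _ < ε := h1

/-- If `K` is nondecreasing and `p ≤ M`, then `K p` grows at most by `∫ K p'` and `M` times the
increase of `K`. -/
lemma mul_le_integral_of_monotone {K P q : ℝ → ℝ} {a b M : ℝ} (hab : a ≤ b)
    (hK : AbsolutelyContinuousOnInterval K a b) (hKm : MonotoneOn K (Icc a b))
    (hP : AbsolutelyContinuousOnInterval P a b) (hPd : ∀ᵐ z, z ∈ uIcc a b → HasDerivAt P (q z) z)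
    (hPM : ∀ z ∈ Icc a b, P z ≤ M) :
    K b * P b ≤ (∫ z in a..b, K z * q z) + K a * P a + M * (K b - K a) := by
  have h1 := hK.integral_mul_deriv_eq_deriv_mul hP
  have h2 : ∫ z in a..b, K z * deriv P z = ∫ z in a..b, K z * q z :=
    intervalIntegral.integral_congr_ae (hPd.mono fun z hz hm => by
      rw [(hz (uIoc_subset_uIcc hm)).deriv])
  -- `K' ≥ 0` and `P ≤ M` replace `P` by `M` in the term that would otherwise need control of `K'`.
  have h3 : ∫ z in a..b, deriv K z * P z ≤ ∫ z in a..b, deriv K z * M := by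
    refine intervalIntegral.integral_mono_on_of_le_Ioo hab
      (hK.intervalIntegrable_deriv.mul_continuousOn hP.continuousOn)
      (hK.intervalIntegrable_deriv.mul_const M) fun z hz => ?_
    have hd : 0 ≤ deriv K z := by
      rw [← derivWithin_of_mem_nhds (Icc_mem_nhds hz.1 hz.2)]
      exact hKm.derivWithin_nonneg
    exact mul_le_mul_of_nonneg_left (hPM z (Ioo_subset_Icc_self hz)) hd
  rw [intervalIntegral.integral_mul_const, hK.integral_deriv_eq_sub] at h3
  linarith

/-- A continuous function on `[a,b]` that is almost everywhere at most `M` is at most `M`. -/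
lemma le_of_ae_le {f : ℝ → ℝ} {a b M : ℝ} (hab : a < b) (hf : ContinuousOn f (Icc a b))
    (h : ∀ᵐ z ∂volume.restrict (Ioo a b), f z ≤ M) : ∀ z ∈ Icc a b, f z ≤ M := by
  have h1 : ∀ z ∈ Ioo a b, max (f z) M = M := by
    refine Measure.eqOn_open_of_ae_eq (μ := volume) (h.mono fun z hz => max_eq_right hz) isOpen_Ioo
      ((hf.mono Ioo_subset_Icc_self).sup continuousOn_const) continuousOn_const
  intro z hz
  have hz' : z ∈ closure (Ioo a b) := by rwa [closure_Ioo hab.ne]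
  have h2 : MapsTo f (Ioo a b) (Iic M) := fun w hw => max_eq_right_iff.1 (h1 w hw)
  simpa using ((hf z hz).mono Ioo_subset_Icc_self).mem_closure hz' h2

end Fingering

namespace Fingering

variable {D : TWData} {sstar H : ℝ} {s sz p py pz : ℝ × ℝ → ℝ} {pstar : ℝ}

/-! ### Slices of truncated solutions -/

namespace IsTWSolutionWith

lemma integrable_s0 (h : IsTWSolutionWith D H s sz p py pz pstar) :
    IntegrableOn D.s0 (Ioo 0 D.L) := h.s_bottom.1.integrable one_le_two

lemma integrable_p0 (h : IsTWSolutionWith D H s sz p py pz pstar) :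
    IntegrableOn D.p0 (Ioo 0 D.L) := h.p_bottom.1.integrable one_le_two

lemma integrable_sz (h : IsTWSolutionWith D H s sz p py pz pstar) :
    IntegrableOn sz (rect D.L 0 H) := h.sz_mem.integrable one_le_two

lemma integrable_pz (h : IsTWSolutionWith D H s sz p py pz pstar) :
    IntegrableOn pz (rect D.L 0 H) := h.p_h1.mem_z.integrable one_le_two

lemma s_ae_eq (h : IsTWSolutionWith D H s sz p py pz pstar) (hH : 0 ≤ H) :
    s =ᵐ[volume.restrict (rect D.L 0 H)] slicePrim 0 D.s0 sz :=
  ae_eq_slicePrim hH h.integrable_s0 (h.s_mem.integrable one_le_two) h.integrable_sz h.s_bottom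

lemma p_ae_eq (h : IsTWSolutionWith D H s sz p py pz pstar) (hH : 0 ≤ H) :
    p =ᵐ[volume.restrict (rect D.L 0 H)] slicePrim 0 D.p0 pz :=
  ae_eq_slicePrim hH h.integrable_p0 (h.p_h1.mem.integrable one_le_two) h.integrable_pz h.p_bottom

end IsTWSolutionWith

/-- The properties of `s(y,·)`, `p(y,·)` on a generic vertical line. -/
structure IsGoodSlice (D : TWData) (sstar H : ℝ) (sz pz : ℝ × ℝ → ℝ) (y : ℝ) : Prop where
  int_s : IntervalIntegrable (fun z => sz (y, z)) volume 0 H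
  int_p : IntervalIntegrable (fun z => pz (y, z)) volume 0 H
  eq : ∀ᵐ z ∂volume.restrict (Ioo 0 H), D.c * D.τ * sz (y, z) =
    max 0 (slicePrim 0 D.p0 pz (y, z) - D.pc (slicePrim 0 D.s0 sz (y, z)))
  mono : MonotoneOn (fun z => slicePrim 0 D.s0 sz (y, z)) (Icc 0 H)
  lower : ∀ z ∈ Icc 0 H, sstar ≤ slicePrim 0 D.s0 sz (y, z)
  upper : ∀ z ∈ Ico 0 H, slicePrim 0 D.s0 sz (y, z) < 1

lemma intervalIntegrable_sub {f : ℝ → ℝ} {a b a' b' : ℝ} (h : IntervalIntegrable f volume a b)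
    (ha : a' ∈ Icc a b) (hb : b' ∈ Icc a b) : IntervalIntegrable f volume a' b' :=
  h.mono_set (uIcc_subset_uIcc (by rw [uIcc_of_le (ha.1.trans ha.2)]; exact ha)
    (by rw [uIcc_of_le (ha.1.trans ha.2)]; exact hb))

lemma slicePrim_sub {a : ℝ} {t : ℝ → ℝ} {v : ℝ × ℝ → ℝ} {y z z' H : ℝ}
    (hv : IntervalIntegrable (fun z => v (y, z)) volume a H) (hz : z ∈ Icc a H)
    (hz' : z' ∈ Icc a H) :
    slicePrim a t v (y, z') - slicePrim a t v (y, z) = ∫ ζ in z..z', v (y, ζ) := by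
  have ha : a ∈ Icc a H := left_mem_Icc.2 (hz.1.trans hz.2)
  rw [← intervalIntegral.integral_interval_sub_left (intervalIntegrable_sub hv ha hz')
    (intervalIntegrable_sub hv ha hz)]
  simp [slicePrim]

lemma integral_nonneg_of_ae_Ioo {f : ℝ → ℝ} {z z' H : ℝ}
    (h : ∀ᵐ z ∂volume.restrict (Ioo 0 H), 0 ≤ f z) (hz : 0 ≤ z) (hzz : z ≤ z') (hz' : z' ≤ H) :
    0 ≤ ∫ ζ in z..z', f ζ := by
  rw [intervalIntegral_eq_Ioo hzz]
  refine integral_nonneg_of_ae ?_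
  exact ae_mono (Measure.restrict_mono (Ioo_subset_Ioo hz hz') le_rfl) h

/-- The positive part in the saturation equation gives `∂_z s ≥ 0`, so the continuous representative
of `s` increases along almost every vertical line, from a value at least `s_*`. -/
lemma IsTWSolutionWith.ae_isGoodSlice (h : IsTWSolutionWith D H s sz p py pz pstar) (hH : 0 < H)
    (hc : 0 < D.c) (hτ : 0 < D.τ) (hs0 : ∀ y ∈ Ioo 0 D.L, sstar ≤ D.s0 y ∧ D.s0 y ≤ 1) :
    ∀ᵐ y ∂volume.restrict (Ioo 0 D.L), IsGoodSlice D sstar H sz pz y := by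
  have h0 : ∀ᵐ x ∂volume.restrict (rect D.L 0 H), 0 ≤ sz x ∧
      D.c * D.τ * sz x = max 0 (slicePrim 0 D.p0 pz x - D.pc (slicePrim 0 D.s0 sz x)) ∧
      slicePrim 0 D.s0 sz x < 1 := by
    filter_upwards [h.s_ae_eq hH.le, h.p_ae_eq hH.le, h.closure_eq, h.s_range] with x h1 h2 h3 h4
    rw [← h1, ← h2]
    refine ⟨?_, h3, h4.2⟩
    have : 0 ≤ D.c * D.τ * sz x := h3 ▸ le_max_left _ _
    exact nonneg_of_mul_nonneg_right this (mul_pos hc hτ)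
  filter_upwards [ae_ae_of_ae_rect h0, ae_intervalIntegrable hH.le h.integrable_sz,
    ae_intervalIntegrable hH.le h.integrable_pz, ae_restrict_mem measurableSet_Ioo]
    with y hy hys hyp hyL
  have hnn : ∀ᵐ z ∂volume.restrict (Ioo 0 H), 0 ≤ sz (y, z) := hy.mono fun z hz => hz.1
  have hmono : MonotoneOn (fun z => slicePrim 0 D.s0 sz (y, z)) (Icc 0 H) := by
    intro z hz z' hz' hzz
    have h1 := slicePrim_sub (t := D.s0) hys hz hz'
    have h2 := integral_nonneg_of_ae_Ioo hnn hz.1 hzz hz'.2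
    simp only
    linarith
  refine ⟨hys, hyp, hy.mono fun z hz => hz.2.1, hmono, fun z hz => ?_, fun z hz => ?_⟩
  · have h1 := hmono (left_mem_Icc.2 hH.le) hz hz.1
    simp only [slicePrim_base] at h1
    exact (hs0 y hyL).1.trans h1
  -- If the slice reached `1` at some `z < H`, monotonicity would keep it at least `1` on all of
  -- `(z,H)`, against `s < 1` almost everywhere. At `z = H` itself the value `1` is not excluded.
  · by_contra! hge
    have h1 : ∀ᵐ w ∂volume.restrict (Ioo z H), slicePrim 0 D.s0 sz (y, w) < 1 :=
      ae_mono (Measure.restrict_mono (Ioo_subset_Ioo hz.1 le_rfl) le_rfl)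
        (hy.mono fun w hw => hw.2.2)
    have h2 : ∀ᵐ w ∂volume.restrict (Ioo z H), False := by
      filter_upwards [h1, ae_restrict_mem measurableSet_Ioo] with w hw hwm
      have := hmono ⟨hz.1, hz.2.le⟩ ⟨hz.1.trans hwm.1.le, hwm.2.le⟩ hwm.1.le
      simp only at this
      linarith
    rw [ae_iff] at h2
    simp at h2
    linarith [hz.2]

/-! ### The flux -/

/-- The piecewise linear function which is `0` below `z1` and `1` above `z2`. -/
noncomputable def ramp (z1 z2 : ℝ) (x : ℝ × ℝ) : ℝ := max 0 (min 1 ((x.2 - z1) / (z2 - z1)))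

section Ramp

variable {z1 z2 : ℝ}

lemma ramp_nonneg (x : ℝ × ℝ) : 0 ≤ ramp z1 z2 x := le_max_left _ _

lemma ramp_of_le (h : z1 < z2) {x : ℝ × ℝ} (hx : x.2 ≤ z1) : ramp z1 z2 x = 0 :=
  max_eq_left ((min_le_right _ _).trans (div_nonpos_of_nonpos_of_nonneg (by linarith) (by linarith)))

lemma ramp_of_ge (h : z1 < z2) {x : ℝ × ℝ} (hx : z2 ≤ x.2) : ramp z1 z2 x = 1 := by
  have : 1 ≤ (x.2 - z1) / (z2 - z1) := by rw [le_div_iff₀ (by linarith)]; linarith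
  rw [ramp, min_eq_left this, max_eq_right zero_le_one]

lemma lipschitzWith_ramp (h : z1 < z2) : ∃ C, LipschitzWith C (ramp z1 z2) := by
  have h1 : LipschitzWith (Real.toNNReal (1 / (z2 - z1))) (fun x : ℝ × ℝ => (x.2 - z1) / (z2 - z1)) := by
    refine LipschitzWith.of_dist_le_mul fun x y => ?_
    have hp : 0 < z2 - z1 := by linarith
    rw [Real.coe_toNNReal _ (by positivity), Real.dist_eq]
    have : (x.2 - z1) / (z2 - z1) - (y.2 - z1) / (z2 - z1) = 1 / (z2 - z1) * (x.2 - y.2) := by ring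
    rw [this, abs_mul, abs_of_pos (by positivity)]
    gcongr
    rw [← Real.dist_eq, Prod.dist_eq]
    exact le_max_right _ _
  exact ⟨_, (h1.const_min 1).const_max 0⟩

lemma dy_ramp (x : ℝ × ℝ) : dy (ramp z1 z2) x = 0 := by
  by_cases hd : DifferentiableAt ℝ (ramp z1 z2) x
  · have h1 := hd.hasFDerivAt.hasLineDerivAt (1, 0)
    have h2 : HasLineDerivAt ℝ (ramp z1 z2) 0 x (1, 0) := by
      have : (fun t : ℝ => ramp z1 z2 (x + t • (1, 0))) = fun _ => ramp z1 z2 x := by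
        ext t; simp [ramp]
      rw [HasLineDerivAt, this]
      exact hasDerivAt_const _ _
    exact h1.unique h2
  · simp [dy, fderiv_zero_of_not_differentiableAt hd]

lemma dz_ramp (h : z1 < z2) {x : ℝ × ℝ} (h1 : x.2 ≠ z1) (h2 : x.2 ≠ z2) :
    dz (ramp z1 z2) x = (Ioo z1 z2).indicator (fun _ => 1 / (z2 - z1)) x.2 := by
  obtain ⟨y, z⟩ := x
  simp only at h1 h2
  have hpos : 0 < z2 - z1 := by linarith
  rcases lt_or_gt_of_ne h1 with h1 | h1
  · rw [indicator_of_notMem (by simp; intro; linarith)]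
    have : ramp z1 z2 =ᶠ[𝓝 (y, z)] fun _ => 0 := by
      filter_upwards [(continuous_snd.tendsto (y, z)).eventually (Iio_mem_nhds h1)] with w hw
      exact ramp_of_le h (le_of_lt hw)
    simp [dz, this.fderiv_eq]
  · rcases lt_or_gt_of_ne h2 with h2 | h2
    · rw [indicator_of_mem (show z ∈ Ioo z1 z2 from ⟨h1, h2⟩)]
      have : ramp z1 z2 =ᶠ[𝓝 (y, z)] fun x => (x.2 - z1) / (z2 - z1) := by
        filter_upwards [(continuous_snd.tendsto (y, z)).eventually (Ioo_mem_nhds h1 h2)] with w hw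
        have a1 : 0 ≤ (w.2 - z1) / (z2 - z1) := div_nonneg (by linarith [hw.1]) hpos.le
        have a2 : (w.2 - z1) / (z2 - z1) ≤ 1 := by
          rw [div_le_one hpos]; linarith [hw.2]
        rw [ramp, min_eq_right a2, max_eq_right a1]
      rw [dz, this.fderiv_eq]
      refine dz_eq_of_hasDerivAt (by fun_prop) ?_
      exact ((hasDerivAt_id z).sub_const z1).div_const (z2 - z1)
    · rw [indicator_of_notMem (by simp; intro; linarith)]
      have : ramp z1 z2 =ᶠ[𝓝 (y, z)] fun _ => 1 := by
        filter_upwards [(continuous_snd.tendsto (y, z)).eventually (Ioi_mem_nhds h2)] with w hw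
        exact ramp_of_ge h (le_of_lt hw)
      simp [dz, this.fderiv_eq]

end Ramp

lemma ae_snd_ne (c : ℝ) : ∀ᵐ x : ℝ × ℝ, x.2 ≠ c := by
  rw [Measure.volume_eq_prod]
  exact Measure.quasiMeasurePreserving_snd.ae (Measure.ae_ne volume c)

/-- A Lipschitz function that vanishes on the bottom and is constant on the top is admissible. -/
lemma isH1Sharp_of_lipschitz {L : ℝ} (hH : 0 ≤ H) {φ : ℝ × ℝ → ℝ} {C : NNReal}
    (hφ : LipschitzWith C φ) {φtop : ℝ} (h0 : ∀ y, φ (y, 0) = 0) (h1 : ∀ y ∈ Ioo 0 L, φ (y, H) = φtop) :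
    IsH1Sharp L H φ (dy φ) (dz φ) φtop where
  h1 := isH1_of_lipschitz hφ _ _ _
  bottom := by
    have := isBottomTrace_lipschitz (L := L) hH hφ
    simpa only [h0] using this
  top := by
    have := isTopTrace_lipschitz (L := L) hH hφ
    refine ⟨memLp_const _, fun ψ hψ => (this.2 ψ hψ).trans ?_⟩
    exact setIntegral_congr_fun measurableSet_Ioo fun y hy => by simp only [h1 y hy]

lemma IsTWSolutionWith.memLp_kExt (hk : PermeabilityAssumption D.k)
    (h : IsTWSolutionWith D H s sz p py pz pstar) :
    MemLp (fun x => kExt D.k (s x)) ⊤ (volume.restrict (rect D.L 0 H)) :=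
  memLp_top_of_bound ((continuous_kExt hk).comp_aestronglyMeasurable h.s_mem.aestronglyMeasurable)
    (D.k 1) (Eventually.of_forall fun _ => abs_kExt_le hk _)

lemma IsTWSolutionWith.kExt_ae_eq (h : IsTWSolutionWith D H s sz p py pz pstar) :
    ∀ᵐ x ∂volume.restrict (rect D.L 0 H), kExt D.k (s x) = D.k (s x) :=
  h.s_range.mono fun _ hx => kExt_eq (Ioo_subset_Icc_self hx)

/-- The total flux between two heights. -/
lemma IsTWSolutionWith.flux_eq (hk : PermeabilityAssumption D.k)
    (h : IsTWSolutionWith D H s sz p py pz pstar) {z1 z2 : ℝ} (h1 : 0 ≤ z1) (h12 : z1 < z2)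
    (h2 : z2 ≤ H) :
    ∫ x in rect D.L z1 z2, kExt D.k (s x) * (pz x + D.g) =
      (z2 - z1) * (D.Finf - D.c * ∫ x in rect D.L 0 H, sz x * ramp z1 z2 x) := by
  obtain ⟨C, hC⟩ := lipschitzWith_ramp h12
  have hH : 0 < H := h1.trans_lt (h12.trans_le h2)
  -- The ramp has trace `0` at the bottom and `1` at the top, so the right-hand side is `F_∞`. Its
  -- gradient is vertical, equal to `1 / (z2 - z1)` between the two heights and zero elsewhere.
  have hw := h.weak _ _ _ _ (isH1Sharp_of_lipschitz (L := D.L) hH.le hC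
    (fun y => ramp_of_le h12 h1) (fun y _ => ramp_of_ge h12 h2))
  have hpos : 0 < z2 - z1 := by linarith
  have i1 : IntegrableOn (fun x => sz x * ramp z1 z2 x) (rect D.L 0 H) :=
    integrableOn_rect_mul h.integrable_sz (memLp_rect_of_continuous hC.continuous _ _ _ _)
  have i2 : IntegrableOn (fun x => (pz x + D.g) * kExt D.k (s x)) (rect D.L 0 H) :=
    integrableOn_rect_mul (h.integrable_pz.add (integrable_const _)) (h.memLp_kExt hk)
  have hsub : rect D.L z1 z2 ⊆ rect D.L 0 H := rect_mono h1 h2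
  have e1 : ∫ x in rect D.L 0 H, (D.c * sz x * ramp z1 z2 x + D.k (s x) *
      (py x * dy (ramp z1 z2) x + (pz x + D.g) * dz (ramp z1 z2) x)) =
      ∫ x in rect D.L 0 H, (D.c * (sz x * ramp z1 z2 x) + 1 / (z2 - z1) *
        (rect D.L z1 z2).indicator (fun x => (pz x + D.g) * kExt D.k (s x)) x) := by
    refine integral_congr_ae ?_
    filter_upwards [h.kExt_ae_eq, ae_restrict_of_ae (ae_snd_ne z1), ae_restrict_of_ae (ae_snd_ne z2),
      ae_restrict_mem (measurableSet_rect D.L 0 H)] with x hx n1 n2 hm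
    rw [dy_ramp, dz_ramp h12 n1 n2, ← hx]
    by_cases hxm : x.2 ∈ Ioo z1 z2
    · rw [indicator_of_mem hxm, indicator_of_mem (show x ∈ rect D.L z1 z2 from ⟨hm.1, hxm⟩)]
      ring
    · rw [indicator_of_notMem hxm,
        indicator_of_notMem (show x ∉ rect D.L z1 z2 from fun h' => hxm h'.2)]
      ring
  rw [e1, integral_add (i1.const_mul _) ((i2.indicator (measurableSet_rect _ _ _)).const_mul _),
    integral_const_mul, integral_const_mul, setIntegral_indicator (measurableSet_rect _ _ _),
    inter_eq_self_of_subset_right hsub] at hw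
  have e2 : ∫ x in rect D.L z1 z2, kExt D.k (s x) * (pz x + D.g) =
      ∫ x in rect D.L z1 z2, (pz x + D.g) * kExt D.k (s x) := by simp_rw [mul_comm]
  rw [e2]
  field_simp at hw
  linarith

lemma IsTWSolutionWith.sz_nonneg (hc : 0 < D.c) (hτ : 0 < D.τ)
    (h : IsTWSolutionWith D H s sz p py pz pstar) :
    ∀ᵐ x ∂volume.restrict (rect D.L 0 H), 0 ≤ sz x := by
  filter_upwards [h.closure_eq] with x hx
  exact nonneg_of_mul_nonneg_right (hx ▸ le_max_left _ _) (mul_pos hc hτ)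

/-- The source term dropped from `flux_eq` has a sign, since `∂_z s` and the ramp are both
nonnegative. -/
lemma IsTWSolutionWith.flux_le (hk : PermeabilityAssumption D.k) (hc : 0 < D.c) (hτ : 0 < D.τ)
    (h : IsTWSolutionWith D H s sz p py pz pstar) {z1 z2 : ℝ} (h1 : 0 ≤ z1) (h12 : z1 < z2)
    (h2 : z2 ≤ H) :
    ∫ x in rect D.L z1 z2, kExt D.k (s x) * (pz x + D.g) ≤ (z2 - z1) * D.Finf := by
  rw [h.flux_eq hk h1 h12 h2]
  have : 0 ≤ ∫ x in rect D.L 0 H, sz x * ramp z1 z2 x :=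
    integral_nonneg_of_ae ((h.sz_nonneg hc hτ).mono fun x hx => mul_nonneg hx (ramp_nonneg x))
  have h3 := mul_nonneg hc.le this
  nlinarith

end Fingering

namespace Fingering

variable {D : TWData} {sstar H : ℝ} {s sz p py pz : ℝ × ℝ → ℝ} {pstar : ℝ}

/-! ### Decay of the pressure -/

lemma IsGoodSlice.ac_s {y : ℝ} (h : IsGoodSlice D sstar H sz pz y) {z1 z2 : ℝ} (h1 : 0 ≤ z1)
    (h12 : z1 ≤ z2) (h2 : z2 ≤ H) :
    AbsolutelyContinuousOnInterval (fun z => slicePrim 0 D.s0 sz (y, z)) z1 z2 :=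
  (absolutelyContinuous_slicePrim h.int_s).mono (by
    rw [uIcc_of_le h12, uIcc_of_le (h1.trans (h12.trans h2))]
    exact Icc_subset_Icc h1 h2)

lemma IsGoodSlice.ac_p {y : ℝ} (h : IsGoodSlice D sstar H sz pz y) {z1 z2 : ℝ} (h1 : 0 ≤ z1)
    (h12 : z1 ≤ z2) (h2 : z2 ≤ H) :
    AbsolutelyContinuousOnInterval (fun z => slicePrim 0 D.p0 pz (y, z)) z1 z2 :=
  (absolutelyContinuous_slicePrim h.int_p).mono (by
    rw [uIcc_of_le h12, uIcc_of_le (h1.trans (h12.trans h2))]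
    exact Icc_subset_Icc h1 h2)

/-- Integration by parts on one vertical line. Monotonicity of `k(s)` bounds every term other than
the flux integral by `M k(1)`, independently of `z1` and `z2`. The condition `z2 < H` keeps the
saturation below `1`, where `k` is Lipschitz. -/
lemma IsGoodSlice.mul_le (hk : PermeabilityAssumption D.k) (hss : 0 < sstar) {y : ℝ}
    (h : IsGoodSlice D sstar H sz pz y) {z1 z2 M : ℝ} (h1 : 0 ≤ z1) (h12 : z1 ≤ z2) (h2 : z2 < H)
    (hM : 0 ≤ M) (hp : ∀ z ∈ Icc 0 H, slicePrim 0 D.p0 pz (y, z) ≤ M) :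
    kExt D.k (slicePrim 0 D.s0 sz (y, z2)) * slicePrim 0 D.p0 pz (y, z2) ≤
      (∫ z in z1..z2, kExt D.k (slicePrim 0 D.s0 sz (y, z)) * pz (y, z)) + M * D.k 1 := by
  have hsub : Icc z1 z2 ⊆ Icc 0 H := Icc_subset_Icc h1 h2.le
  obtain ⟨C, hC⟩ := exists_lipschitzOnWith_kExt hk hss (h.upper z2 ⟨h1.trans h12, h2⟩)
  have hK : AbsolutelyContinuousOnInterval
      (fun z => kExt D.k (slicePrim 0 D.s0 sz (y, z))) z1 z2 := by
    refine AbsolutelyContinuousOnInterval_comp (h.ac_s h1 h12 h2.le) hC fun z hz => ?_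
    rw [uIcc_of_le h12] at hz
    exact ⟨h.lower z (hsub hz), h.mono (hsub hz) (hsub (right_mem_Icc.2 h12)) hz.2⟩
  have hKm : MonotoneOn (fun z => kExt D.k (slicePrim 0 D.s0 sz (y, z))) (Icc z1 z2) :=
    (monotone_kExt hk).comp_monotoneOn (h.mono.mono hsub)
  have hd : ∀ᵐ z, z ∈ uIcc z1 z2 →
      HasDerivAt (fun z => slicePrim 0 D.p0 pz (y, z)) (pz (y, z)) z := by
    filter_upwards [ae_hasDerivAt_slicePrim (t := D.p0) h.int_p] with z hz hzm
    rw [uIcc_of_le h12] at hzm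
    rw [uIcc_of_le (h1.trans (h12.trans h2.le))] at hz
    exact hz (hsub hzm)
  have key := mul_le_integral_of_monotone h12 hK hKm (h.ac_p h1 h12 h2.le) hd
    fun z hz => hp z (hsub hz)
  -- The boundary term at `z1` is at most `M k(s(z1))`, which cancels the subtracted part of `M
  -- (k(s(z2)) - k(s(z1)))`.
  have e1 := mul_le_mul_of_nonneg_left (hp z1 (hsub (left_mem_Icc.2 h12)))
    (kExt_nonneg hk (slicePrim 0 D.s0 sz (y, z1)))
  have e2 := mul_le_mul_of_nonneg_left (kExt_le hk (slicePrim 0 D.s0 sz (y, z2))) hM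
  linarith

/-- `IsValueAtHeight` comes with its own `z`-derivative, but weak derivatives and traces are unique,
so the value is that of the primitive of `sz`. -/
lemma IsTWSolutionWith.value_ae_eq (h : IsTWSolutionWith D H s sz p py pz pstar) {z : ℝ}
    (hz : 0 < z) (hzH : z ≤ H) {t : ℝ → ℝ} (ht : IsValueAtHeight D.L z s t) :
    ∀ᵐ y ∂volume.restrict (Ioo 0 D.L), t y = slicePrim 0 D.s0 sz (y, z) := by
  obtain ⟨sz', -, hw, htr⟩ := ht
  have hsub : rect D.L 0 z ⊆ rect D.L 0 H := rect_mono le_rfl hzH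
  have h1 : sz' =ᵐ[volume.restrict (rect D.L 0 z)] sz :=
    IsWeakD.ae_eq (isOpen_rect _ _ _) hw (IsWeakD.mono h.s_weak hsub)
  have h2 : s =ᵐ[volume.restrict (rect D.L 0 z)] slicePrim 0 D.s0 sz :=
    ae_mono (Measure.restrict_mono hsub le_rfl) (h.s_ae_eq (hz.le.trans hzH))
  exact (htr.congr h2 h1).ae_eq_slicePrim hz h.integrable_s0 (h.integrable_sz.mono_set hsub)

lemma integrableOn_slice_lines {f : ℝ × ℝ → ℝ} {L a b : ℝ} (hf : IntegrableOn f (rect L a b)) :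
    IntegrableOn (fun y => ∫ z in Ioo a b, f (y, z)) (Ioo 0 L) := by
  rw [IntegrableOn, volume_restrict_rect] at hf
  exact hf.integral_prod_left

/-- If the flux due to gravity exceeds `F_∞` at some height, the pressure decays linearly. -/
lemma IsTWSolutionWith.pressure_decay (hk : PermeabilityAssumption D.k) (hL : 0 < D.L)
    (hg : 0 < D.g) (hc : 0 < D.c) (hτ : 0 < D.τ) (hss : sstar ∈ Ioo (0 : ℝ) 1)
    (hs0 : ∀ y ∈ Ioo 0 D.L, sstar ≤ D.s0 y ∧ D.s0 y ≤ 1)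
    (h : IsTWSolutionWith D H s sz p py pz pstar) {z0 z2 M Ck : ℝ} (hz0 : 0 < z0) (hz02 : z0 < z2)
    (hz2 : z2 < H) (hM : 0 ≤ M) (hp : ∀ᵐ x ∂volume.restrict (rect D.L 0 H), p x ≤ M) {t : ℝ → ℝ}
    (ht : IsValueAtHeight D.L z0 s t) (hCk : Ck ≤ ∫ y in Ioo 0 D.L, D.g * D.k (t y)) :
    ∫ y in Ioo 0 D.L, kExt D.k (slicePrim 0 D.s0 sz (y, z2)) * slicePrim 0 D.p0 pz (y, z2) ≤
      M * D.k 1 * D.L - (Ck - D.Finf) * (z2 - z0) := by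
  have hH : 0 < H := hz0.trans (hz02.trans hz2)
  have hsub : rect D.L z0 z2 ⊆ rect D.L 0 H := rect_mono hz0.le hz2.le
  have hgood := h.ae_isGoodSlice hH hc hτ hs0
  have hS := integrableOn_slicePrim hH.le h.integrable_s0 h.integrable_sz
  have hKm : MemLp (fun x => kExt D.k (slicePrim 0 D.s0 sz x)) ⊤
      (volume.restrict (rect D.L 0 H)) :=
    memLp_top_of_bound ((continuous_kExt hk).comp_aestronglyMeasurable hS.aestronglyMeasurable)
      (D.k 1) (Eventually.of_forall fun _ => abs_kExt_le hk _)
  have hKi : IntegrableOn (fun x => kExt D.k (slicePrim 0 D.s0 sz x)) (rect D.L z0 z2) :=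
    IntegrableOn.mono_set (hKm.integrable le_top) hsub
  have hKp : IntegrableOn (fun x => pz x * kExt D.k (slicePrim 0 D.s0 sz x)) (rect D.L z0 z2) :=
    (integrableOn_rect_mul h.integrable_pz hKm).mono_set hsub
  have hKz : ∀ z ∈ Icc 0 H, IntegrableOn (fun y => kExt D.k (slicePrim 0 D.s0 sz (y, z)))
      (Ioo 0 D.L) := fun z hz => by
    refine Integrable.of_bound ((continuous_kExt hk).comp_aestronglyMeasurable
      (integrableOn_slicePrim_slice h.integrable_s0 h.integrable_sz hz).aestronglyMeasurable)
      (D.k 1) (Eventually.of_forall fun _ => abs_kExt_le hk _)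
  have hpM : ∀ᵐ y ∂volume.restrict (Ioo 0 D.L), ∀ z ∈ Icc 0 H,
      slicePrim 0 D.p0 pz (y, z) ≤ M := by
    have : ∀ᵐ x ∂volume.restrict (rect D.L 0 H), slicePrim 0 D.p0 pz x ≤ M := by
      filter_upwards [hp, h.p_ae_eq hH.le] with x h1 h2
      rwa [← h2]
    filter_upwards [ae_ae_of_ae_rect this, hgood] with y hy hgy
    refine le_of_ae_le hH ?_ hy
    have := (hgy.ac_p le_rfl hH.le le_rfl).continuousOn
    rwa [uIcc_of_le hH.le] at this
  -- the gravity part of the flux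
  have hgrav : Ck * (z2 - z0) ≤
      D.g * ∫ x in rect D.L z0 z2, kExt D.k (slicePrim 0 D.s0 sz x) := by
    have e1 : ∫ y in Ioo 0 D.L, D.g * D.k (t y) =
        D.g * ∫ y in Ioo 0 D.L, kExt D.k (slicePrim 0 D.s0 sz (y, z0)) := by
      rw [← integral_const_mul]
      refine integral_congr_ae ?_
      filter_upwards [h.value_ae_eq hz0 (hz02.trans hz2).le ht, hgood] with y hy hgy
      rw [hy, kExt_eq]
      exact ⟨hss.1.le.trans (hgy.lower z0 ⟨hz0.le, (hz02.trans hz2).le⟩),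
        (hgy.upper z0 ⟨hz0.le, hz02.trans hz2⟩).le⟩
    have e2 : (∫ y in Ioo 0 D.L, kExt D.k (slicePrim 0 D.s0 sz (y, z0))) * (z2 - z0) ≤
        ∫ x in rect D.L z0 z2, kExt D.k (slicePrim 0 D.s0 sz x) := by
      rw [setIntegral_rect hKi, ← integral_mul_const]
      refine integral_mono_ae ((hKz z0 ⟨hz0.le, (hz02.trans hz2).le⟩).mul_const _)
        (integrableOn_slice_lines hKi) ?_
      have hKi' := hKi
      rw [IntegrableOn, volume_restrict_rect] at hKi'
      filter_upwards [hgood, hKi'.prod_right_ae] with y hgy hiy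
      have : kExt D.k (slicePrim 0 D.s0 sz (y, z0)) * (z2 - z0) =
          ∫ z in Ioo z0 z2, kExt D.k (slicePrim 0 D.s0 sz (y, z0)) := by
        simp [hz02.le, mul_comm]
      simp only [this]
      refine setIntegral_mono_on (integrable_const _) hiy measurableSet_Ioo fun z hz => ?_
      exact monotone_kExt hk (hgy.mono ⟨hz0.le, (hz02.trans hz2).le⟩
        ⟨hz0.le.trans hz.1.le, (hz.2.trans hz2).le⟩ hz.1.le)
    rw [e1] at hCk
    have e3 := mul_le_mul_of_nonneg_right hCk (by linarith : 0 ≤ z2 - z0)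
    have e4 := mul_le_mul_of_nonneg_left e2 hg.le
    linarith
  -- The total flux integral over `z0 < z < z2` is at most `(z2 - z0) F_∞`, and gravity alone
  -- accounts for `(z2 - z0) Ck`. The pressure part is therefore at most `-(Ck - F_∞)(z2 - z0)`.
  have hflux := h.flux_le hk hc hτ hz0.le hz02 hz2.le
  have e5 : ∫ x in rect D.L z0 z2, kExt D.k (s x) * (pz x + D.g) =
      (∫ x in rect D.L z0 z2, pz x * kExt D.k (slicePrim 0 D.s0 sz x)) +
        D.g * ∫ x in rect D.L z0 z2, kExt D.k (slicePrim 0 D.s0 sz x) := by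
    rw [← integral_const_mul, ← integral_add hKp (hKi.const_mul _)]
    refine integral_congr_ae ?_
    filter_upwards [ae_mono (Measure.restrict_mono hsub le_rfl) (h.s_ae_eq hH.le)] with x hx
    rw [hx]; ring
  have e6 : ∫ y in Ioo 0 D.L, kExt D.k (slicePrim 0 D.s0 sz (y, z2)) *
      slicePrim 0 D.p0 pz (y, z2) ≤
      (∫ x in rect D.L z0 z2, pz x * kExt D.k (slicePrim 0 D.s0 sz x)) + M * D.k 1 * D.L := by
    have e7 : M * D.k 1 * D.L = ∫ y in Ioo 0 D.L, M * D.k 1 := by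
      simp [hL.le, mul_comm]
    rw [setIntegral_rect hKp, e7, ← integral_add (integrableOn_slice_lines hKp)
      (integrable_const _)]
    refine integral_mono_ae ?_ ((integrableOn_slice_lines hKp).add (integrable_const _)) ?_
    · have := (integrableOn_slicePrim_slice h.integrable_p0 h.integrable_pz
        (z := z2) ⟨(hz0.trans hz02).le, hz2.le⟩)
      exact this.bdd_mul (hKz z2 ⟨(hz0.trans hz02).le, hz2.le⟩).aestronglyMeasurable
        (Eventually.of_forall fun _ => abs_kExt_le hk _)
    · filter_upwards [hgood, hpM] with y hgy hpy
      have := hgy.mul_le hk hss.1 hz0.le hz02.le hz2 hM hpy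
      rw [intervalIntegral_eq_Ioo hz02.le] at this
      simpa only [mul_comm (pz _)] using this
  linarith

/-- The maximum norms of the pressures are unbounded. -/
lemma tendsto_norm_pressure (sstar : ℝ)
    (hL : 0 < D.L) (hg : 0 < D.g) (hc : 0 < D.c) (hτ : 0 < D.τ)
    (hsstar : sstar ∈ Ioo (0 : ℝ) 1) (hk : PermeabilityAssumption D.k)
    (hs0 : ∀ y ∈ Ioo 0 D.L, sstar ≤ D.s0 y ∧ D.s0 y ≤ 1)
    {H : ℕ → ℝ} (hH : Tendsto H atTop atTop) {s p : ℕ → ℝ × ℝ → ℝ}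
    (hsol : ∀ n, IsTWSolution D (H n) (s n) (p n))
    {z0 Ck : ℝ} (hz0 : 0 < z0) (hCk : D.Finf < Ck)
    (hlarge : ∀ n, z0 < H n → ∃ t : ℝ → ℝ, IsValueAtHeight D.L z0 (s n) t ∧
      Ck ≤ ∫ y in Ioo 0 D.L, D.g * D.k (t y)) :
    Tendsto (fun n => eLpNorm (p n) ⊤ (volume.restrict (rect D.L 0 (H n)))) atTop (𝓝 ⊤) := by
  refine ENNReal.tendsto_nhds_top fun m => ?_
  set δ := Ck - D.Finf with hδ
  have hδ0 : 0 < δ := by linarith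
  -- If the norm were at most `m`, the decay estimate at height `H n - 1` and the lower bound `-m
  -- k(1) L` would give `δ (H n - 1 - z0) ≤ 2 m k(1) L`. The summand `2` pays for that unit step and
  -- makes `z0 < H n - 1` strict.
  filter_upwards [hH.eventually_gt_atTop (z0 + 2 * (m * D.k 1 * D.L) / δ + 2)] with n hn
  by_contra! hle
  obtain ⟨sz, py, pz, pstar, h⟩ := hsol n
  have hk1 := k_one_nonneg hk
  have hpos : 0 ≤ 2 * (m * D.k 1 * D.L) / δ := by positivity
  have hzH : z0 < H n := by linarith
  obtain ⟨t, ht, htC⟩ := hlarge n hzH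
  have hpm : ∀ᵐ x ∂volume.restrict (rect D.L 0 (H n)), |p n x| ≤ m := by
    rw [eLpNorm_exponent_top] at hle
    filter_upwards [ae_le_eLpNormEssSup (f := p n) (μ := volume.restrict (rect D.L 0 (H n)))]
      with x hx
    have := hx.trans hle
    rw [Real.enorm_eq_ofReal_abs] at this
    have h2 := ENNReal.toReal_mono (by simp) this
    rwa [ENNReal.toReal_ofReal (abs_nonneg _), ENNReal.toReal_natCast] at h2
  have hH0 : 0 < H n := hz0.trans hzH
  have hz2 : H n - 1 < H n := by linarith
  have hz02 : z0 < H n - 1 := by linarith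
  have hdec := h.pressure_decay hk hL hg hc hτ hsstar hs0 hz0 hz02 hz2
    (Nat.cast_nonneg m) (hpm.mono fun x hx => (le_abs_self _).trans hx) ht htC
  have hlow : -(m * D.k 1 * D.L) ≤ ∫ y in Ioo 0 D.L,
      kExt D.k (slicePrim 0 D.s0 sz (y, H n - 1)) * slicePrim 0 D.p0 pz (y, H n - 1) := by
    have hpm' : ∀ᵐ x ∂volume.restrict (rect D.L 0 (H n)), -slicePrim 0 D.p0 pz x ≤ m := by
      filter_upwards [hpm, h.p_ae_eq hH0.le] with x h1 h2
      rw [← h2]; exact (neg_le_abs _).trans h1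
    have hb : ∀ᵐ y ∂volume.restrict (Ioo 0 D.L), -(m * D.k 1) ≤
        kExt D.k (slicePrim 0 D.s0 sz (y, H n - 1)) * slicePrim 0 D.p0 pz (y, H n - 1) := by
      filter_upwards [ae_ae_of_ae_rect hpm', h.ae_isGoodSlice hH0 hc hτ hs0] with y hy hgy
      have hcont := (hgy.ac_p le_rfl hH0.le le_rfl).continuousOn
      rw [uIcc_of_le hH0.le] at hcont
      have h1 : -slicePrim 0 D.p0 pz (y, H n - 1) ≤ m :=
        le_of_ae_le hH0 hcont.neg hy (H n - 1) ⟨by linarith, by linarith⟩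
      have h2 := kExt_nonneg hk (slicePrim 0 D.s0 sz (y, H n - 1))
      have h3 := kExt_le hk (slicePrim 0 D.s0 sz (y, H n - 1))
      have h4 : (0 : ℝ) ≤ m := Nat.cast_nonneg m
      nlinarith
    have e7 : -(m * D.k 1 * D.L) = ∫ y in Ioo 0 D.L, -(m * D.k 1) := by
      simp [hL.le, mul_comm]
    rw [e7]
    refine integral_mono_ae (integrable_const _) ?_ hb
    have := (integrableOn_slicePrim_slice h.integrable_p0 h.integrable_pz
      (z := H n - 1) ⟨by linarith, by linarith⟩)
    exact this.bdd_mul ((continuous_kExt hk).comp_aestronglyMeasurable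
      (integrableOn_slicePrim_slice h.integrable_s0 h.integrable_sz
        (z := H n - 1) ⟨by linarith, by linarith⟩).aestronglyMeasurable)
      (Eventually.of_forall fun _ => abs_kExt_le hk _)
  have hfin : δ * (H n - 1 - z0) ≤ 2 * (m * D.k 1 * D.L) := by linarith
  have h5 : 2 * (m * D.k 1 * D.L) / δ < H n - 1 - z0 := by linarith
  rw [div_lt_iff₀ hδ0] at h5
  linarith

end Fingering

namespace Fingering

/-! ### The capillary pressure -/

section Capillary

variable {pc : ℝ → ℝ} {sstar : ℝ}

lemma CapillaryAssumption.strictMonoOn (hpc : CapillaryAssumption pc sstar) :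
    StrictMonoOn pc (Ioo 0 1) := by
  obtain ⟨ρ, hρ, h⟩ := hpc.slope
  exact strictMonoOn_of_deriv_pos (convex_Ioo 0 1) hpc.diff.continuousOn fun σ hσ =>
    hρ.trans_le (h σ (by rwa [interior_Ioo] at hσ))

/-- `hi` is an upper barrier for the saturation: a pressure at most `M` cannot drive imbibition
above the level where `p_c ≥ M`. Solutions thus stay uniformly away from `1`. -/
lemma CapillaryAssumption.exists_ge (hpc : CapillaryAssumption pc sstar)
    (hs : sstar ∈ Ioo (0 : ℝ) 1) (M : ℝ) : ∃ hi ∈ Ioo (0 : ℝ) 1, sstar ≤ hi ∧ M ≤ pc hi := by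
  have h1 : ∀ᶠ σ in 𝓝[<] (1 : ℝ), M ≤ pc σ := hpc.at_one.eventually_ge_atTop M
  have h2 : ∀ᶠ σ in 𝓝[<] (1 : ℝ), σ ∈ Ioo sstar 1 := Ioo_mem_nhdsLT hs.2
  obtain ⟨σ, h3, h4⟩ := (h1.and h2).exists
  exact ⟨σ, ⟨hs.1.trans h4.1, h4.2⟩, h4.1.le, h3⟩

end Capillary

/-! ### The saturation equation on a vertical line -/

/-- The rate of imbibition. -/
noncomputable def rate (κ : ℝ) (pc : ℝ → ℝ) (p σ : ℝ) : ℝ := max 0 (p - pc σ) / κ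

/-- `σ` solves `κ σ' = [P - p_c(σ)]_+`, `σ(0) = a`, on `[0,R]`, with values in `[lo,hi]`. -/
structure IsImbibition (κ : ℝ) (pc P : ℝ → ℝ) (lo hi R a : ℝ) (σ : ℝ → ℝ) : Prop where
  cont : ContinuousOn σ (Icc 0 R)
  mem : ∀ z ∈ Icc 0 R, σ z ∈ Icc lo hi
  eq : ∀ z ∈ Icc 0 R, σ z = a + ∫ ζ in 0..z, rate κ pc (P ζ) (σ ζ)

/-- A primitive starting below zero and nonincreasing where it is positive stays below zero. -/
lemma nonpos_of_primitive {F f : ℝ → ℝ} {F0 R : ℝ} (hf : IntervalIntegrable f volume 0 R)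
    (hF : ∀ z ∈ Icc 0 R, F z = F0 + ∫ ζ in 0..z, f ζ) (h0 : F0 ≤ 0)
    (h : ∀ᵐ z ∂volume.restrict (Ioo 0 R), 0 < F z → f z ≤ 0) : ∀ z ∈ Icc 0 R, F z ≤ 0 := by
  intro z1 hz1
  by_contra! hpos
  have hR : 0 ≤ R := hz1.1.trans hz1.2
  have hc : ContinuousOn F (Icc 0 R) := by
    have := (intervalIntegral.continuousOn_primitive_interval'
      (hf : IntervalIntegrable f volume 0 R) left_mem_uIcc).const_add F0
    rw [uIcc_of_le hR] at this
    exact this.congr hF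
  -- After the last point `a` of `A` the function is positive, hence does not increase, so `F z1 ≤ F
  -- a ≤ 0`.
  let A := {z | z ∈ Icc 0 z1 ∧ F z ≤ 0}
  have hAc : IsCompact A := by
    have h1 : IsClosed (Icc 0 z1 ∩ F ⁻¹' Iic 0) :=
      (hc.mono (Icc_subset_Icc_right hz1.2)).preimage_isClosed_of_isClosed isClosed_Icc isClosed_Iic
    exact isCompact_Icc.of_isClosed_subset h1 inter_subset_left
  have hA0 : (0 : ℝ) ∈ A := ⟨left_mem_Icc.2 hz1.1, by
    rw [hF 0 (left_mem_Icc.2 hR)]; simpa using h0⟩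
  have ha := hAc.sSup_mem ⟨0, hA0⟩
  set a := sSup A
  have hae : ∀ z ∈ Ioc a z1, 0 < F z := fun z hz => by
    by_contra! hle
    exact absurd (le_csSup hAc.bddAbove (show z ∈ A from ⟨⟨ha.1.1.trans hz.1.le, hz.2⟩, hle⟩))
      (not_le.2 hz.1)
  have haz : a ≤ z1 := ha.1.2
  have hi1 := intervalIntegrable_sub hf (left_mem_Icc.2 hR) hz1
  have hi2 := intervalIntegrable_sub hf (left_mem_Icc.2 hR)
    (show a ∈ Icc 0 R from ⟨ha.1.1, haz.trans hz1.2⟩)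
  have e : F z1 - F a = ∫ ζ in a..z1, f ζ := by
    rw [hF z1 hz1, hF a ⟨ha.1.1, haz.trans hz1.2⟩,
      ← intervalIntegral.integral_interval_sub_left hi1 hi2]
    ring
  have hneg : ∫ ζ in a..z1, f ζ ≤ 0 := by
    rw [intervalIntegral_eq_Ioo haz]
    refine integral_nonpos_of_ae ?_
    filter_upwards [ae_mono (Measure.restrict_mono (Ioo_subset_Ioo ha.1.1 hz1.2) le_rfl) h,
      ae_restrict_mem measurableSet_Ioo] with z hz hm
    exact hz (hae z ⟨hm.1, hm.2.le⟩)
  linarith [ha.2]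

section Imbibition

variable {κ lo hi R a : ℝ} {pc P : ℝ → ℝ} {sstar : ℝ} {σ : ℝ → ℝ}

lemma rate_nonneg (hκ : 0 < κ) (p s : ℝ) : 0 ≤ rate κ pc p s :=
  div_nonneg (le_max_left _ _) hκ.le

lemma rate_le (hpc : CapillaryAssumption pc sstar) (hκ : 0 < κ) (hlo : 0 < lo) (hhi : hi < 1)
    {p s B : ℝ} (hs : s ∈ Icc lo hi) (hp : p ≤ B) : rate κ pc p s ≤ max 0 (B - pc lo) / κ := by
  have : pc lo ≤ pc s := hpc.strictMonoOn.monotoneOn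
    ⟨hlo, (hs.1.trans hs.2).trans_lt hhi⟩ ⟨hlo.trans_le hs.1, hs.2.trans_lt hhi⟩ hs.1
  unfold rate
  gcongr

lemma continuousOn_rate (hpc : CapillaryAssumption pc sstar) {X : Type*} [TopologicalSpace X]
    {p s : X → ℝ} {U : Set X} (hp : ContinuousOn p U) (hs : ContinuousOn s U)
    (h : ∀ x ∈ U, s x ∈ Ioo (0 : ℝ) 1) : ContinuousOn (fun x => rate κ pc (p x) (s x)) U :=
  (continuousOn_const.sup (hp.sub (hpc.diff.continuousOn.comp hs h))).div_const κ

lemma Icc_sub_Ioo (hlo : 0 < lo) (hhi : hi < 1) : Icc lo hi ⊆ Ioo 0 1 :=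
  fun _ h => ⟨hlo.trans_le h.1, h.2.trans_lt hhi⟩

lemma IsImbibition.continuousOn_rate (hpc : CapillaryAssumption pc sstar) (hlo : 0 < lo)
    (hhi : hi < 1) (hP : ContinuousOn P (Icc 0 R)) (h : IsImbibition κ pc P lo hi R a σ) :
    ContinuousOn (fun ζ => rate κ pc (P ζ) (σ ζ)) (Icc 0 R) :=
  Fingering.continuousOn_rate hpc hP h.cont fun z hz => Icc_sub_Ioo hlo hhi (h.mem z hz)

/-- Since `p_c` is increasing, the rate is nonincreasing in the saturation. Where `σ` exceeds `σ'`
the difference of the rates is therefore at most `|P - P'| / κ`, so no Grönwall factor and no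
Lipschitz bound on `p_c` enters. -/
lemma IsImbibition.sub_le (hpc : CapillaryAssumption pc sstar) (hκ : 0 < κ) (hlo : 0 < lo)
    (hhi : hi < 1) {P' : ℝ → ℝ} {a' : ℝ} {σ' : ℝ → ℝ} (hP : ContinuousOn P (Icc 0 R))
    (hP' : ContinuousOn P' (Icc 0 R)) (h : IsImbibition κ pc P lo hi R a σ)
    (h' : IsImbibition κ pc P' lo hi R a' σ') : ∀ z ∈ Icc 0 R,
      σ z - σ' z ≤ |a - a'| + ∫ ζ in 0..z, |P ζ - P' ζ| / κ := by
  by_cases hR : 0 ≤ R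
  swap
  · intro z hz; exact absurd (hz.1.trans hz.2) hR
  have cd : ContinuousOn (fun ζ => |P ζ - P' ζ| / κ) (Icc 0 R) := ((hP.sub hP').abs).div_const κ
  have ii : ∀ {g : ℝ → ℝ}, ContinuousOn g (Icc 0 R) → ∀ z ∈ Icc 0 R,
      IntervalIntegrable g volume 0 z := fun hg z hz =>
    (hg.mono (Icc_subset_Icc_right hz.2)).intervalIntegrable_of_Icc hz.1
  have c1 := h.continuousOn_rate hpc hlo hhi hP
  have c2 := h'.continuousOn_rate hpc hlo hhi hP'
  have key := nonpos_of_primitive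
    (F := fun z => σ z - σ' z - (|a - a'| + ∫ ζ in 0..z, |P ζ - P' ζ| / κ))
    (f := fun ζ => rate κ pc (P ζ) (σ ζ) - rate κ pc (P' ζ) (σ' ζ) - |P ζ - P' ζ| / κ)
    (F0 := a - a' - |a - a'|) (ii ((c1.sub c2).sub cd) R (right_mem_Icc.2 hR))
    (fun z hz => by
      rw [intervalIntegral.integral_sub ((ii c1 z hz).sub (ii c2 z hz)) (ii cd z hz),
        intervalIntegral.integral_sub (ii c1 z hz) (ii c2 z hz), h.eq z hz, h'.eq z hz]
      ring)
    (by linarith [le_abs_self (a - a')])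
    (by
      filter_upwards [ae_restrict_mem measurableSet_Ioo] with z hz hpos
      have hzI := Ioo_subset_Icc_self hz
      have hi0 : 0 ≤ ∫ ζ in 0..z, |P ζ - P' ζ| / κ :=
        intervalIntegral.integral_nonneg hz.1.le fun ζ _ => by positivity
      have hlt : σ' z ≤ σ z := by
        have := abs_nonneg (a - a')
        linarith
      have hpc' : pc (σ' z) ≤ pc (σ z) := hpc.strictMonoOn.monotoneOn
        (Icc_sub_Ioo hlo hhi (h'.mem z hzI)) (Icc_sub_Ioo hlo hhi (h.mem z hzI)) hlt
      unfold rate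
      rw [← sub_div, ← sub_div]
      refine div_nonpos_of_nonpos_of_nonneg ?_ hκ.le
      have h1 := le_abs_self (P z - P' z)
      have h2 := abs_nonneg (P z - P' z)
      have h3 := le_max_left 0 (P' z - pc (σ' z))
      have h4 := le_max_right 0 (P' z - pc (σ' z))
      rcases max_cases 0 (P z - pc (σ z)) with ⟨h5, _⟩ | ⟨h5, _⟩ <;> rw [h5] <;> linarith)
  intro z hz
  have := key z hz
  linarith

lemma IsImbibition.abs_sub_le (hpc : CapillaryAssumption pc sstar) (hκ : 0 < κ) (hlo : 0 < lo)
    (hhi : hi < 1) {P' : ℝ → ℝ} {a' : ℝ} {σ' : ℝ → ℝ} (hP : ContinuousOn P (Icc 0 R))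
    (hP' : ContinuousOn P' (Icc 0 R)) (h : IsImbibition κ pc P lo hi R a σ)
    (h' : IsImbibition κ pc P' lo hi R a' σ') {z : ℝ} (hz : z ∈ Icc 0 R) :
      |σ z - σ' z| ≤ |a - a'| + ∫ ζ in 0..z, |P ζ - P' ζ| / κ := by
  have h1 := h.sub_le hpc hκ hlo hhi hP hP' h' z hz
  have h2 := h'.sub_le hpc hκ hlo hhi hP' hP h z hz
  rw [abs_sub_comm a' a] at h2
  simp_rw [abs_sub_comm (P' _) (P _)] at h2
  exact abs_le.2 ⟨by linarith, h1⟩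

lemma IsImbibition.sub_eq (hpc : CapillaryAssumption pc sstar) (hlo : 0 < lo)
    (hhi : hi < 1) (hP : ContinuousOn P (Icc 0 R)) (h : IsImbibition κ pc P lo hi R a σ) {z z' : ℝ}
    (hz : z ∈ Icc 0 R) (hz' : z' ∈ Icc 0 R) :
    σ z' - σ z = ∫ ζ in z..z', rate κ pc (P ζ) (σ ζ) := by
  have c1 := h.continuousOn_rate hpc hlo hhi hP
  have ii : ∀ z ∈ Icc 0 R, IntervalIntegrable (fun ζ => rate κ pc (P ζ) (σ ζ)) volume 0 z :=
    fun z hz => (c1.mono (Icc_subset_Icc_right hz.2)).intervalIntegrable_of_Icc hz.1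
  rw [h.eq z hz, h.eq z' hz', ← intervalIntegral.integral_interval_sub_left (ii z' hz') (ii z hz)]
  ring

lemma IsImbibition.abs_sub_le_mul (hpc : CapillaryAssumption pc sstar) (hκ : 0 < κ) (hlo : 0 < lo)
    (hhi : hi < 1) (hP : ContinuousOn P (Icc 0 R)) (h : IsImbibition κ pc P lo hi R a σ) {B : ℝ}
    (hB : ∀ z ∈ Icc 0 R, P z ≤ B) {z z' : ℝ} (hz : z ∈ Icc 0 R) (hz' : z' ∈ Icc 0 R) :
    |σ z' - σ z| ≤ max 0 (B - pc lo) / κ * |z' - z| := by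
  rw [h.sub_eq hpc hlo hhi hP hz hz', ← Real.norm_eq_abs]
  refine intervalIntegral.norm_integral_le_of_norm_le_const fun ζ hζ => ?_
  have hm : ζ ∈ Icc 0 R := (uIoc_subset_uIcc.trans (ordConnected_Icc.uIcc_subset hz hz')) hζ
  rw [Real.norm_eq_abs, abs_of_nonneg (rate_nonneg hκ _ _)]
  exact rate_le hpc hκ hlo hhi (h.mem ζ hm) (hB ζ hm)

/-- Solutions of the saturation equation are stable under pointwise convergence of the pressure. -/
lemma exists_imbibition_of_tendsto (hpc : CapillaryAssumption pc sstar) (hκ : 0 < κ) (hlo : 0 < lo)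
    (hhi : hi < 1) {Pn σn : ℕ → ℝ → ℝ} {an Rn : ℕ → ℝ} (hP : Continuous P)
    (hPn : ∀ n, Continuous (Pn n)) (hlim : ∀ z, Tendsto (fun n => Pn n z) atTop (𝓝 (P z)))
    (han : Tendsto an atTop (𝓝 a)) (hR : Tendsto Rn atTop atTop)
    (hB : ∀ R, ∃ B, ∀ n, ∀ z ∈ Icc 0 R, |Pn n z| ≤ B)
    (h : ∀ n, IsImbibition κ pc (Pn n) lo hi (Rn n) (an n) (σn n)) :
    ∃ σ, ∀ R, IsImbibition κ pc P lo hi R a σ := by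
  have hB' : ∀ R, ∃ B, ∀ z ∈ Icc 0 R, (∀ n, |Pn n z| ≤ B) ∧ |P z| ≤ B := fun R => by
    obtain ⟨B, hB⟩ := hB R
    exact ⟨B, fun z hz => ⟨fun n => hB n z hz,
      le_of_tendsto (hlim z).abs (Eventually.of_forall fun n => hB n z hz)⟩⟩
  have hres : ∀ n R, R ≤ Rn n → IsImbibition κ pc (Pn n) lo hi R (an n) (σn n) := fun n R hle =>
    have hs : Icc 0 R ⊆ Icc 0 (Rn n) := Icc_subset_Icc_right hle
    ⟨(h n).cont.mono hs, fun z hz => (h n).mem z (hs hz), fun z hz => (h n).eq z (hs hz)⟩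
  have hd : ∀ z, 0 ≤ z → Tendsto (fun n => |an n - a| + ∫ ζ in 0..z, |Pn n ζ - P ζ| / κ)
      atTop (𝓝 0) := fun z hz => by
    obtain ⟨B, hB⟩ := hB' z
    have h1 : Tendsto (fun n => |an n - a|) atTop (𝓝 0) := by
      simpa using (han.sub_const a).abs
    have h2 : Tendsto (fun n => ∫ ζ in 0..z, |Pn n ζ - P ζ| / κ) atTop (𝓝 (∫ ζ in 0..z, 0)) := by
      refine intervalIntegral.tendsto_integral_filter_of_dominated_convergence
        (fun _ => (B + B) / κ) (Eventually.of_forall fun n => ?_)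
        (Eventually.of_forall fun n => Eventually.of_forall fun ζ hζ => ?_)
        intervalIntegrable_const (Eventually.of_forall fun ζ hζ => ?_)
      · exact (((hPn n).sub hP).abs.div_const κ).aestronglyMeasurable
      · rw [uIoc_of_le hz] at hζ
        obtain ⟨b1, b2⟩ := hB ζ ⟨hζ.1.le, hζ.2⟩
        rw [Real.norm_eq_abs, abs_of_nonneg (by positivity)]
        gcongr
        exact (abs_sub _ _).trans (add_le_add (b1 n) b2)
      · have := (((hlim ζ).sub_const (P ζ)).abs).div_const κ
        simpa using this
    simpa using h1.add h2
  -- Stability bounds `|σn m z - σn n z|` by the distances of both sets of data to the limit data.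
  -- The sequence is thus Cauchy at each height, without passing to a subsequence.
  have hlimσ : ∀ z, ∃ l, 0 ≤ z → Tendsto (fun n => σn n z) atTop (𝓝 l) := fun z => by
    by_cases hz : 0 ≤ z
    swap
    · exact ⟨0, fun h => absurd h hz⟩
    have : CauchySeq fun n => σn n z := by
      refine Metric.cauchySeq_iff.2 fun ε hε => ?_
      have hev := ((hd z hz).eventually_lt_const (show (0 : ℝ) < ε / 2 by positivity)).and
        (hR.eventually_ge_atTop z)
      obtain ⟨N, hN⟩ := eventually_atTop.1 hev
      refine ⟨N, fun m hm n hn => ?_⟩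
      obtain ⟨m1, m2⟩ := hN m hm
      obtain ⟨n1, n2⟩ := hN n hn
      have key := (hres m z m2).abs_sub_le hpc hκ hlo hhi (hPn m).continuousOn
        (hPn n).continuousOn (hres n z n2) (right_mem_Icc.2 hz)
      have ii : ∀ {g : ℝ → ℝ}, Continuous g → IntervalIntegrable g volume 0 z := fun hg =>
        hg.intervalIntegrable _ _
      have cc : ∀ {f g : ℝ → ℝ}, Continuous f → Continuous g →
          IntervalIntegrable (fun ζ => |f ζ - g ζ| / κ) volume 0 z := fun hf hg =>
        ii (((hf.sub hg).abs).div_const κ)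
      have e1 : ∫ ζ in 0..z, |Pn m ζ - Pn n ζ| / κ ≤
          (∫ ζ in 0..z, |Pn m ζ - P ζ| / κ) + ∫ ζ in 0..z, |Pn n ζ - P ζ| / κ := by
        rw [← intervalIntegral.integral_add (cc (hPn m) hP) (cc (hPn n) hP)]
        refine intervalIntegral.integral_mono hz (cc (hPn m) (hPn n))
          ((cc (hPn m) hP).add (cc (hPn n) hP)) fun ζ => ?_
        simp only
        rw [← add_div]
        gcongr
        rw [abs_sub_comm (Pn n ζ)]
        exact abs_sub_le _ _ _
      have e2 : |an m - an n| ≤ |an m - a| + |an n - a| := by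
        rw [abs_sub_comm (an n) a]; exact abs_sub_le _ _ _
      rw [Real.dist_eq]
      linarith
    obtain ⟨l, hl⟩ := cauchySeq_tendsto_of_complete this
    exact ⟨l, fun _ => hl⟩
  choose σ hσ using hlimσ
  have hmem : ∀ z, 0 ≤ z → σ z ∈ Icc lo hi := fun z hz =>
    isClosed_Icc.mem_of_tendsto (hσ z hz) ((hR.eventually_ge_atTop z).mono fun n hn =>
      (h n).mem z ⟨hz, hn⟩)
  refine ⟨σ, fun R => ⟨?_, fun z hz => hmem z hz.1, fun z hz => ?_⟩⟩
  -- Bounded pressures give a common bound on the rates, so the Lipschitz estimate in `z` survives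
  -- in the limit.
  · obtain ⟨B, hB⟩ := hB' R
    have hlip : LipschitzOnWith (Real.toNNReal (max 0 (B - pc lo) / κ)) σ (Icc 0 R) := by
      refine LipschitzOnWith.of_dist_le_mul fun z hz z' hz' => ?_
      rw [Real.coe_toNNReal _ (div_nonneg (le_max_left _ _) hκ.le)]
      refine le_of_tendsto ((hσ z hz.1).dist (hσ z' hz'.1)) ?_
      filter_upwards [hR.eventually_ge_atTop R] with n hn
      exact (hres n R hn).abs_sub_le_mul hpc hκ hlo hhi (hPn n).continuousOn
        (fun w hw => (le_abs_self _).trans ((hB w hw).1 n)) hz' hz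
    exact hlip.continuousOn
  · refine tendsto_nhds_unique (hσ z hz.1) ?_
    have hev : (fun n => σn n z) =ᶠ[atTop] fun n => an n + ∫ ζ in 0..z, rate κ pc (Pn n ζ) (σn n ζ) :=
      (hR.eventually_ge_atTop z).mono fun n hn => (h n).eq z ⟨hz.1, hn⟩
    refine Tendsto.congr' hev.symm (han.add ?_)
    obtain ⟨B, hB⟩ := hB' z
    refine intervalIntegral.tendsto_integral_filter_of_dominated_convergence
        (fun _ => max 0 (B - pc lo) / κ) ?_ ?_
        intervalIntegrable_const (Eventually.of_forall fun ζ hζ => ?_)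
    · filter_upwards [hR.eventually_ge_atTop z] with n hn
      have := (hres n z hn).continuousOn_rate hpc hlo hhi (hPn n).continuousOn
      rw [uIoc_of_le hz.1]
      exact (this.mono Ioc_subset_Icc_self).aestronglyMeasurable measurableSet_Ioc
    · filter_upwards [hR.eventually_ge_atTop z] with n hn
      refine Eventually.of_forall fun ζ hζ => ?_
      rw [uIoc_of_le hz.1] at hζ
      have hm : ζ ∈ Icc 0 z := ⟨hζ.1.le, hζ.2⟩
      rw [Real.norm_eq_abs, abs_of_nonneg (rate_nonneg hκ _ _)]
      exact rate_le hpc hκ hlo hhi ((hres n z hn).mem ζ hm)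
        ((le_abs_self _).trans ((hB ζ hm).1 n))
    · rw [uIoc_of_le hz.1] at hζ
      have hc : ContinuousAt pc (σ ζ) := hpc.diff.continuousOn.continuousAt
        (isOpen_Ioo.mem_nhds (Icc_sub_Ioo hlo hhi (hmem ζ hζ.1.le)))
      exact ((tendsto_const_nhds.max ((hlim ζ).sub (hc.tendsto.comp (hσ ζ hζ.1.le)))).div_const κ)

end Imbibition

end Fingering

namespace Fingering

/-! ### Weak derivatives from bounds on difference quotients -/

/-- A linear functional bounded by the norm of a linear map into a Hilbert space is represented
by a vector of that space. -/
lemma exists_inner_eq {M E : Type*} [AddCommGroup M] [Module ℝ M] [NormedAddCommGroup E]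
    [InnerProductSpace ℝ E] [CompleteSpace E] (j : M →ₗ[ℝ] E) (ℓ : M →ₗ[ℝ] ℝ) (A : ℝ)
    (h : ∀ m, |ℓ m| ≤ A * ‖j m‖) : ∃ v : E, ∀ m, ℓ m = inner ℝ v (j m) := by
  -- The bound makes `ℓ` factor through the range of `j` as a bounded functional. Hahn-Banach
  -- extends it to `E`, and Riesz represents the extension.
  have hker : LinearMap.ker j ≤ LinearMap.ker ℓ := fun m hm => by
    have := h m
    rw [LinearMap.mem_ker.1 hm, norm_zero, mul_zero] at this
    exact abs_nonpos_iff.1 this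
  let g : LinearMap.range j →ₗ[ℝ] ℝ :=
    ((LinearMap.ker j).liftQ ℓ hker).comp j.quotKerEquivRange.symm.toLinearMap
  have hg : ∀ m, g ⟨j m, LinearMap.mem_range_self j m⟩ = ℓ m := fun m => by
    have : j.quotKerEquivRange.symm ⟨j m, LinearMap.mem_range_self j m⟩ =
        (LinearMap.ker j).mkQ m := by
      rw [LinearEquiv.symm_apply_eq]; rfl
    simp only [g, LinearMap.comp_apply, LinearEquiv.coe_coe, this]
    rfl
  let G : LinearMap.range j →L[ℝ] ℝ := g.mkContinuous A (by
    rintro ⟨_, m, rfl⟩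
    rw [hg]; exact h m)
  obtain ⟨F, hF, -⟩ := exists_extension_norm_eq _ G
  refine ⟨(InnerProductSpace.toDual ℝ E).symm F, fun m => ?_⟩
  rw [InnerProductSpace.toDual_symm_apply, ← hg m]
  exact (hF ⟨j m, LinearMap.mem_range_self j m⟩).symm

/-- The vector space of test functions. -/
def testSpace (V : Set (ℝ × ℝ)) : Submodule ℝ (ℝ × ℝ → ℝ) where
  carrier := {φ | IsTestOn V φ}
  zero_mem' := ⟨contDiff_const, HasCompactSupport.zero, by simp [tsupport_zero]⟩
  add_mem' := fun {φ ψ} h h' => ⟨h.smooth.add h'.smooth, h.compact.add h'.compact,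
    (tsupport_add φ ψ).trans (union_subset h.supp h'.supp)⟩
  smul_mem' := fun r φ h => ⟨contDiff_const.smul h.smooth, h.compact.smul_left,
    (closure_mono (Function.support_const_smul_subset r φ)).trans h.supp⟩

lemma IsTestOn.memLp {V : Set (ℝ × ℝ)} {φ : ℝ × ℝ → ℝ} (h : IsTestOn V φ) (q : ENNReal)
    (μ : Measure (ℝ × ℝ)) [IsFiniteMeasureOnCompacts μ] : MemLp φ q μ :=
  h.smooth.continuous.memLp_of_hasCompactSupport h.compact

lemma IsTestOn.integrable_mul_fderiv {U : Set (ℝ × ℝ)} {φ u : ℝ × ℝ → ℝ} (h : IsTestOn U φ)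
    (hu : LocallyIntegrableOn u U) (e : ℝ × ℝ) : Integrable (fun x => u x * fderiv ℝ φ x e) :=
  integrable_mul_of_locallyIntegrableOn hu
    ((h.smooth.continuous_fderiv (by simp)).clm_apply continuous_const) (h.compact.fderiv_apply ℝ e)
    ((tsupport_fderiv_apply_subset ℝ e).trans h.supp)

/-- The functional `φ ↦ ∫ f ∂_e φ` is bounded in the `L²` norm of `φ`, so it is represented by some
`v` in `L²`; the weak derivative is `-v`. -/
lemma exists_weakD_of_bound {V : Set (ℝ × ℝ)} {f : ℝ × ℝ → ℝ} {e : ℝ × ℝ}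
    (hf : LocallyIntegrableOn f V) {A : ℝ}
    (h : ∀ φ, IsTestOn V φ → |∫ x in V, f x * fderiv ℝ φ x e| ≤
      A * (eLpNorm φ 2 (volume.restrict V)).toReal) :
    ∃ v, InL2 V v ∧ IsWeakD e V f v := by
  let j : testSpace V →ₗ[ℝ] Lp ℝ 2 (volume.restrict V) :=
    { toFun := fun φ => (IsTestOn.memLp φ.2 2 _).toLp φ.1
      map_add' := fun φ ψ => MemLp.toLp_add _ _
      map_smul' := fun r φ => MemLp.toLp_const_smul r _ }
  let ℓ : testSpace V →ₗ[ℝ] ℝ :=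
    { toFun := fun φ => ∫ x in V, f x * fderiv ℝ φ.1 x e
      map_add' := fun φ ψ => by
        rw [← integral_add (φ.2.integrable_mul_fderiv hf e).integrableOn
          (ψ.2.integrable_mul_fderiv hf e).integrableOn]
        congr 1; ext x
        have h1 := (φ.2.smooth.differentiable (by simp)) x
        have h2 := (ψ.2.smooth.differentiable (by simp)) x
        change f x * fderiv ℝ (φ.1 + ψ.1) x e = _
        rw [fderiv_add h1 h2, add_apply]; ring
      map_smul' := fun r φ => by
        rw [RingHom.id_apply, smul_eq_mul, ← integral_const_mul]
        congr 1; ext x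
        have h1 := (φ.2.smooth.differentiable (by simp)) x
        change f x * fderiv ℝ (r • φ.1) x e = _
        rw [fderiv_const_smul h1, smul_apply, smul_eq_mul]; ring }
  obtain ⟨v, hv⟩ := exists_inner_eq j ℓ A fun φ => by
    have : ‖j φ‖ = (eLpNorm φ.1 2 (volume.restrict V)).toReal :=
      Lp.norm_toLp _ (IsTestOn.memLp φ.2 2 _)
    rw [this]; exact h φ.1 φ.2
  have hvm : MemLp v 2 (volume.restrict V) := Lp.memLp v
  refine ⟨fun x => -v x, hvm.neg, hf, ?_, fun φ hφ => ?_⟩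
  · have := (hvm.neg.locallyIntegrable one_le_two)
    intro x hx
    obtain ⟨t, ht, hi⟩ := this x
    refine ⟨t ∩ V, inter_mem (mem_nhdsWithin_of_mem_nhds ht) self_mem_nhdsWithin, ?_⟩
    rw [IntegrableOn, Measure.restrict_restrict_of_subset inter_subset_right |>.symm]
    exact hi.mono_set inter_subset_left
  · have h1 := hv ⟨φ, hφ⟩
    rw [L2.inner_def] at h1
    have h2 : ∫ x in V, f x * fderiv ℝ φ x e =
        ∫ x in V, inner ℝ (v x) (j ⟨φ, hφ⟩ x) := h1
    rw [h2, ← integral_neg]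
    refine integral_congr_ae ?_
    have h3 : j ⟨φ, hφ⟩ =ᵐ[volume.restrict V] φ := MemLp.coeFn_toLp (hφ.memLp 2 _)
    filter_upwards [h3] with x hx
    rw [hx]; simp [mul_comm]

/-- Weak derivatives glue along an exhaustion. -/
lemma exists_weakD_of_exhaustion {U : Set (ℝ × ℝ)} {V : ℕ → Set (ℝ × ℝ)} {f : ℝ × ℝ → ℝ}
    {e : ℝ × ℝ} (hV : ∀ j, IsOpen (V j)) (hmono : Monotone V)
    (hcpt : ∀ K, IsCompact K → K ⊆ U → ∃ j, K ⊆ V j) (hf : LocallyIntegrableOn f U)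
    (h : ∀ j, ∃ v, InL2 (V j) v ∧ IsWeakD e (V j) f v) :
    ∃ v, InL2loc U v ∧ IsWeakD e U f v := by
  classical
  choose v hv hvw using h
  -- Each point uses the first set of the exhaustion that contains it. By uniqueness of weak
  -- derivatives the result agrees with `v j` almost everywhere on `V j`.
  let w : ℝ × ℝ → ℝ := fun x => if hx : ∃ j, x ∈ V j then v (Nat.find hx) x else 0
  have hw : ∀ j, v j =ᵐ[volume.restrict (V j)] w := fun j => by
    have h1 : ∀ᵐ x, ∀ i, i ≤ j → x ∈ V i → v i x = v j x := by
      rw [ae_all_iff]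
      intro i
      by_cases hij : i ≤ j
      · have := IsWeakD.ae_eq (hV i) (hvw i) ((hvw j).mono (hmono hij))
        rw [EventuallyEq, ae_restrict_iff' (hV i).measurableSet] at this
        exact this.mono fun x hx _ => hx
      · exact Eventually.of_forall fun x hx => absurd hx hij
    rw [EventuallyEq, ae_restrict_iff' (hV j).measurableSet]
    filter_upwards [h1] with x hx hxj
    have hex : ∃ j, x ∈ V j := ⟨j, hxj⟩
    simp only [w, dif_pos hex]
    exact (hx _ (Nat.find_min' hex hxj) (Nat.find_spec hex)).symm
  refine ⟨w, fun K hK hKU => ?_, hf, ?_, fun φ hφ => ?_⟩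
  · obtain ⟨j, hj⟩ := hcpt K hK hKU
    have := (memLp_congr_ae (hw j)).1 (hv j)
    exact this.mono_measure (Measure.restrict_mono hj le_rfl)
  · intro x hx
    obtain ⟨j, hj⟩ := hcpt {x} isCompact_singleton (singleton_subset_iff.2 hx)
    have hxj : x ∈ V j := hj rfl
    obtain ⟨t, ht, hi⟩ := (locallyIntegrableOn_congr (hw j) (hvw j).2.1) x hxj
    rw [(hV j).nhdsWithin_eq hxj] at ht
    exact ⟨t, mem_nhdsWithin_of_mem_nhds ht, hi⟩
  · obtain ⟨j, hj⟩ := hcpt _ hφ.compact hφ.supp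
    have hφj : IsTestOn (V j) φ := ⟨hφ.smooth, hφ.compact, hj⟩
    have := ((hvw j).congr (ae_eq_refl _) (hw j)).2.2 φ hφj
    rwa [hφj.setIntegral_mul_fderiv, hφj.setIntegral_mul,
      ← hφ.setIntegral_mul_fderiv, ← hφ.setIntegral_mul] at this

/-- The sets are balls intersected with inner parallel sets of `U`. The complement must be nonempty
because `Metric.infDist` to the empty set is `0`, which would make all of them empty. -/
lemma exists_exhaustion {U : Set (ℝ × ℝ)} (hU : IsOpen U) (hne : (Uᶜ).Nonempty) :
    ∃ V : ℕ → Set (ℝ × ℝ), (∀ j, IsOpen (V j)) ∧ Monotone V ∧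
      (∀ K, IsCompact K → K ⊆ U → ∃ j, K ⊆ V j) ∧ ∀ j, ∃ K, IsCompact K ∧ K ⊆ U ∧ V j ⊆ K := by
  have hc : Continuous fun x => Metric.infDist x Uᶜ := Metric.continuous_infDist_pt _
  let V : ℕ → Set (ℝ × ℝ) := fun j => Metric.ball 0 j ∩ {x | 1 / ((j : ℝ) + 1) < Metric.infDist x Uᶜ}
  have hV : ∀ j, IsOpen (V j) := fun j => Metric.isOpen_ball.inter (isOpen_lt continuous_const hc)
  have hm : Monotone V := fun i j hij => inter_subset_inter
    (Metric.ball_subset_ball (Nat.cast_le.2 hij)) fun x hx => by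
      refine lt_of_le_of_lt ?_ (show 1 / ((i : ℝ) + 1) < Metric.infDist x Uᶜ from hx)
      gcongr
  refine ⟨V, hV, hm, fun K hK hKU => ?_, fun j => ⟨Metric.closedBall 0 j ∩
    {x | 1 / ((j : ℝ) + 1) ≤ Metric.infDist x Uᶜ},
    (isCompact_closedBall _ _).inter_right (isClosed_le continuous_const hc), fun x hx => ?_,
    inter_subset_inter Metric.ball_subset_closedBall
      fun x (hx : 1 / ((j : ℝ) + 1) < Metric.infDist x Uᶜ) => hx.le⟩⟩
  · refine hK.elim_directed_cover V hV (fun x hx => ?_) (hm.directed_le)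
    have hpos : 0 < Metric.infDist x Uᶜ :=
      (hU.isClosed_compl.notMem_iff_infDist_pos hne).1 (not_not.2 (hKU hx))
    obtain ⟨m, hm1⟩ := exists_nat_gt ‖x‖
    obtain ⟨n, hn⟩ := exists_nat_one_div_lt hpos
    refine mem_iUnion.2 ⟨max m n, ?_, ?_⟩
    · rw [mem_ball_zero_iff]
      exact hm1.trans_le (Nat.cast_le.2 (le_max_left _ _))
    · refine lt_of_le_of_lt ?_ hn
      gcongr
      exact le_max_right _ _
  · by_contra hxU
    have : Metric.infDist x Uᶜ = 0 := Metric.infDist_zero_of_mem hxU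
    have h2 : 1 / ((j : ℝ) + 1) ≤ Metric.infDist x Uᶜ := hx.2
    rw [this] at h2
    have : 0 < 1 / ((j : ℝ) + 1) := by positivity
    linarith

/-- The difference quotient with step `h` in direction `e`. -/
noncomputable def dq (h : ℝ) (e : ℝ × ℝ) (f : ℝ × ℝ → ℝ) (x : ℝ × ℝ) : ℝ :=
  h⁻¹ * (f (x + h • e) - f x)

/-- Cauchy-Schwarz, with one factor as an integral and the other as an `eLpNorm`, the form needed to
apply `exists_weakD_of_bound`. -/
lemma abs_integral_mul_le_sqrt {K : Set (ℝ × ℝ)} {f g : ℝ × ℝ → ℝ}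
    (hf : MemLp f 2 (volume.restrict K)) (hg : MemLp g 2 (volume.restrict K)) :
    |∫ x in K, f x * g x| ≤ Real.sqrt (∫ x in K, f x ^ 2) * (eLpNorm g 2 (volume.restrict K)).toReal := by
  have h1 : ∫ x in K, f x * g x = inner ℝ (hf.toLp f) (hg.toLp g) := by
    rw [L2.inner_def]
    refine integral_congr_ae ?_
    filter_upwards [hf.coeFn_toLp, hg.coeFn_toLp] with x h1 h2
    rw [h1, h2]; simp [mul_comm]
  have h2 : Real.sqrt (∫ x in K, f x ^ 2) = ‖hf.toLp f‖ := by
    rw [eq_comm, norm_eq_sqrt_real_inner, L2.inner_def]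
    congr 1
    refine integral_congr_ae ?_
    filter_upwards [hf.coeFn_toLp] with x h1
    rw [h1]; simp [sq]
  have h3 : (eLpNorm g 2 (volume.restrict K)).toReal = ‖hg.toLp g‖ := (Lp.norm_toLp _ _).symm
  rw [h1, h2, h3]
  exact abs_real_inner_le_norm _ _

/-- A bounded function with difference quotients locally bounded in `L²` has a weak derivative
in `L²_loc`. -/
lemma exists_weakD_of_dq {U : Set (ℝ × ℝ)} (hU : IsOpen U) (hne : (Uᶜ).Nonempty)
    {f : ℝ × ℝ → ℝ} {e : ℝ × ℝ} (hf : Measurable f) {B : ℝ} (hB : ∀ x, |f x| ≤ B)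
    (h : ∀ K, IsCompact K → K ⊆ U → ∃ A h0, 0 < h0 ∧
      ∀ t, 0 < t → t < h0 → ∫ x in K, dq t e f x ^ 2 ≤ A) :
    ∃ v, InL2loc U v ∧ IsWeakD e U f v := by
  have hfl : LocallyIntegrable f :=
    (memLp_top_of_bound hf.aestronglyMeasurable B (Eventually.of_forall hB)).locallyIntegrable le_top
  obtain ⟨V, hV, hm, hcpt, hVK⟩ := exists_exhaustion hU hne
  refine exists_weakD_of_exhaustion hV hm hcpt (hfl.locallyIntegrableOn U) fun j => ?_
  obtain ⟨K, hK, hKU, hVj⟩ := hVK j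
  obtain ⟨A, h0, hh0, hA⟩ := h K hK hKU
  refine exists_weakD_of_bound (hfl.locallyIntegrableOn _) (A := Real.sqrt A) fun φ hφ => ?_
  obtain ⟨C, hC⟩ := hφ.lipschitz
  have hφK : ∀ x, x ∉ K → φ x = 0 := fun x hx => hφ.eq_zero fun h' => hx (hVj h')
  -- For small steps the shifted copies of `φ` are also supported in `K'`. Cutting `f` off there
  -- makes it integrable without changing any of the integrals.
  set K' := Metric.cthickening 1 (tsupport φ) with hK'
  have hK'c : IsCompact K' := hφ.compact.cthickening
  let F : ℝ × ℝ → ℝ := K'.indicator f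
  have hF : Integrable F := (hfl.integrableOn_isCompact hK'c).integrable_indicator
    hK'c.isClosed.measurableSet
  have htend := hC.integral_inv_smul_sub_mul_tendsto_integral_lineDeriv_mul hF (-e)
  have hlim : ∫ x, lineDeriv ℝ φ x (-e) * F x = -∫ x in V j, f x * fderiv ℝ φ x e := by
    rw [hφ.setIntegral_mul_fderiv, ← integral_neg]
    congr 1; ext x
    rw [((hφ.smooth.differentiable (by simp)) x).lineDeriv_eq_fderiv, map_neg]
    by_cases hx : x ∈ K'
    · simp [F, hx, mul_comm]
    · have : fderiv ℝ φ x = 0 := image_eq_zero_of_notMem_tsupport fun h' =>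
        hx (Metric.self_subset_cthickening _ (tsupport_fderiv_subset ℝ h'))
      simp [this]
  have hbound : ∀ᶠ t : ℝ in 𝓝[>] 0, |∫ x, (t⁻¹ • (φ (x + t • -e) - φ x)) * F x| ≤
      Real.sqrt A * (eLpNorm φ 2 (volume.restrict (V j))).toReal := by
    have e1 : ∀ᶠ t : ℝ in 𝓝[>] 0, t < h0 := (eventually_lt_nhds hh0).filter_mono nhdsWithin_le_nhds
    have e2 : ∀ᶠ t : ℝ in 𝓝[>] 0, t * (‖e‖ + 1) < 1 := by
      have : Tendsto (fun t : ℝ => t * (‖e‖ + 1)) (𝓝[>] 0) (𝓝 0) := by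
        have : Tendsto (fun t : ℝ => t * (‖e‖ + 1)) (𝓝 0) (𝓝 (0 * (‖e‖ + 1))) :=
          tendsto_id.mul_const _
        rw [zero_mul] at this
        exact this.mono_left nhdsWithin_le_nhds
      exact this.eventually_lt_const one_pos
    filter_upwards [e1, e2, self_mem_nhdsWithin] with t ht1 ht2 ht0
    have ht0' : 0 < t := ht0
    have hint1 : Integrable fun x => f (x + t • e) * φ x := by
      refine integrable_mul_of_locallyIntegrableOn (U := univ) ?_ hφ.smooth.continuous hφ.compact
        (subset_univ _)
      refine LocallyIntegrable.locallyIntegrableOn ?_ _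
      exact (memLp_top_of_bound (hf.comp (measurable_id.add_const _)).aestronglyMeasurable B
        (Eventually.of_forall fun x => hB _)).locallyIntegrable le_top
    have hint2 : Integrable fun x => f x * φ x :=
      integrable_mul_of_locallyIntegrableOn (U := univ) (hfl.locallyIntegrableOn _)
        hφ.smooth.continuous hφ.compact (subset_univ _)
    have hint3 : Integrable fun x => f x * φ (x - t • e) := by
      have := hint1.comp_sub_right (t • e)
      simpa using this
    have s1 : ∫ x, (t⁻¹ • (φ (x + t • -e) - φ x)) * F x =
        t⁻¹ * ((∫ x, f x * φ (x - t • e)) - ∫ x, f x * φ x) := by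
      rw [← integral_sub hint3 hint2, ← integral_const_mul]
      congr 1; ext x
      rw [smul_neg, ← sub_eq_add_neg, smul_eq_mul]
      by_cases hx : x ∈ K'
      · simp only [F, indicator_of_mem hx]; ring
      · have z1 : φ x = 0 := image_eq_zero_of_notMem_tsupport fun h' =>
          hx (Metric.self_subset_cthickening _ h')
        have z2 : φ (x - t • e) = 0 := image_eq_zero_of_notMem_tsupport fun h' => by
          refine hx (Metric.mem_cthickening_of_dist_le x _ _ _ h' ?_)
          rw [dist_eq_norm, sub_sub_cancel, norm_smul, Real.norm_of_nonneg ht0'.le]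
          nlinarith [norm_nonneg e]
        rw [z1, z2]; simp
    -- Translation invariance moves the difference quotient from `φ` onto `f`; the minus sign of
    -- integration by parts appears as the direction `-e`.
    have s2 : ∫ x, f x * φ (x - t • e) = ∫ x, f (x + t • e) * φ x := by
      rw [← integral_sub_right_eq_self (fun x => f (x + t • e) * φ x) (t • e)]
      simp only [sub_add_cancel]
    have s3 : ∫ x, (t⁻¹ • (φ (x + t • -e) - φ x)) * F x = ∫ x in K, dq t e f x * φ x := by
      rw [s1, s2, ← integral_sub hint1 hint2, ← integral_const_mul,
        setIntegral_eq_integral_of_forall_compl_eq_zero fun x hx => by rw [hφK x hx, mul_zero]]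
      congr 1; ext x; simp only [dq]; ring
    have hKfin : IsFiniteMeasure ((volume : Measure (ℝ × ℝ)).restrict K) :=
      ⟨by rw [Measure.restrict_apply_univ]; exact hK.measure_lt_top⟩
    have hdqm : MemLp (dq t e f) 2 (volume.restrict K) := by
      refine MemLp.of_bound (((hf.comp (measurable_id.add_const _)).sub hf).const_mul
        _).aestronglyMeasurable (t⁻¹ * (B + B)) (Eventually.of_forall fun x => ?_)
      rw [dq, norm_mul, Real.norm_of_nonneg (by positivity)]
      gcongr
      exact (abs_sub _ _).trans (add_le_add (hB _) (hB _))
    rw [s3]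
    refine (abs_integral_mul_le_sqrt hdqm (hφ.memLp 2 _)).trans ?_
    have e5 : eLpNorm φ 2 (volume.restrict K) = eLpNorm φ 2 (volume.restrict (V j)) := by
      have a1 : (V j).indicator φ = φ := indicator_eq_self.2 fun x hx => by
        by_contra h'; exact hx (hφ.eq_zero h')
      have a2 : K.indicator φ = φ := indicator_eq_self.2 fun x hx => by
        by_contra h'; exact hx (hφK x h')
      rw [← eLpNorm_indicator_eq_eLpNorm_restrict (hV j).measurableSet,
        ← eLpNorm_indicator_eq_eLpNorm_restrict hK.isClosed.measurableSet, a1, a2]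
    rw [e5]
    gcongr
    exact hA t ht0' ht1
  rw [hlim] at htend
  have := le_of_tendsto htend.abs hbound
  rwa [abs_neg] at this

end Fingering

namespace Fingering

/-! ### Interior `H²` estimate -/

lemma lipschitzWith_mul_of_bounded {f g : ℝ × ℝ → ℝ} {F G : NNReal} {A B : ℝ}
    (hf : LipschitzWith F f) (hg : LipschitzWith G g) (hA : ∀ x, |f x| ≤ A) (hB : ∀ x, |g x| ≤ B) :
    ∃ C, LipschitzWith C fun x => f x * g x := by
  have hA0 : 0 ≤ A := (abs_nonneg _).trans (hA 0)
  have hB0 : 0 ≤ B := (abs_nonneg _).trans (hB 0)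
  refine ⟨Real.toNNReal (A * G + B * F), LipschitzWith.of_dist_le_mul fun x y => ?_⟩
  rw [Real.coe_toNNReal _ (by positivity), Real.dist_eq]
  have e : f x * g x - f y * g y = f x * (g x - g y) + g y * (f x - f y) := by ring
  have h1 := hf.dist_le_mul x y
  have h2 := hg.dist_le_mul x y
  rw [Real.dist_eq] at h1 h2
  calc |f x * g x - f y * g y| ≤ |f x| * |g x - g y| + |g y| * |f x - f y| := by
        rw [e, ← abs_mul, ← abs_mul]; exact abs_add_le _ _
    _ ≤ A * (G * dist x y) + B * (F * dist x y) := by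
        gcongr
        · exact hA x
        · exact hB y
    _ = (A * G + B * F) * dist x y := by ring

lemma lipschitzWith_dq {p : ℝ × ℝ → ℝ} {C : NNReal} (hp : LipschitzWith C p) {h : ℝ} (hh : 0 < h)
    (e : ℝ × ℝ) : ∃ C', LipschitzWith C' (dq h e p) := by
  refine ⟨Real.toNNReal (h⁻¹ * (2 * C)), LipschitzWith.of_dist_le_mul fun x y => ?_⟩
  rw [Real.coe_toNNReal _ (by positivity), Real.dist_eq]
  have h1 := hp.dist_le_mul (x + h • e) (y + h • e)
  have h2 := hp.dist_le_mul x y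
  rw [dist_add_right] at h1
  rw [Real.dist_eq] at h1 h2
  calc |dq h e p x - dq h e p y| =
        h⁻¹ * |(p (x + h • e) - p (y + h • e)) - (p x - p y)| := by
        have : dq h e p x - dq h e p y =
            h⁻¹ * ((p (x + h • e) - p (y + h • e)) - (p x - p y)) := by simp only [dq]; ring
        rw [this, abs_mul, abs_of_pos (inv_pos.2 hh)]
    _ ≤ h⁻¹ * (C * dist x y + C * dist x y) := by
        gcongr
        exact (abs_sub _ _).trans (add_le_add h1 h2)
    _ = h⁻¹ * (2 * C) * dist x y := by ring

lemma abs_dq_le {p : ℝ × ℝ → ℝ} {C : NNReal} (hp : LipschitzWith C p) {h : ℝ} (hh : 0 < h)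
    (e x : ℝ × ℝ) : |dq h e p x| ≤ C * ‖e‖ := by
  have h1 := hp.dist_le_mul (x + h • e) x
  rw [Real.dist_eq, dist_eq_norm, add_sub_cancel_left, norm_smul, Real.norm_of_nonneg hh.le] at h1
  rw [dq, abs_mul, abs_of_pos (inv_pos.2 hh)]
  calc h⁻¹ * |p (x + h • e) - p x| ≤ h⁻¹ * (C * (h * ‖e‖)) := by gcongr
    _ = C * ‖e‖ := by field_simp

/-- The Lipschitz cutoff function of a set. -/
noncomputable def cutoff (δ : ℝ) (K : Set (ℝ × ℝ)) (x : ℝ × ℝ) : ℝ :=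
  max 0 (1 - δ⁻¹ * Metric.infDist x K)

section Cutoff

variable {δ : ℝ} {K : Set (ℝ × ℝ)}

lemma lipschitzWith_cutoff (hδ : 0 < δ) : LipschitzWith (Real.toNNReal δ⁻¹) (cutoff δ K) := by
  have : LipschitzWith (Real.toNNReal δ⁻¹) fun x => 1 - δ⁻¹ * Metric.infDist x K := by
    refine LipschitzWith.of_dist_le_mul fun x y => ?_
    rw [Real.coe_toNNReal _ (by positivity), Real.dist_eq]
    have h1 := (Metric.lipschitz_infDist_pt K).dist_le_mul x y
    rw [Real.dist_eq, NNReal.coe_one, one_mul] at h1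
    have : 1 - δ⁻¹ * Metric.infDist x K - (1 - δ⁻¹ * Metric.infDist y K) =
      -(δ⁻¹ * (Metric.infDist x K - Metric.infDist y K)) := by ring
    rw [this, abs_neg, abs_mul, abs_of_pos (inv_pos.2 hδ)]
    gcongr
  exact this.const_max 0

lemma cutoff_nonneg (x : ℝ × ℝ) : 0 ≤ cutoff δ K x := le_max_left _ _

lemma cutoff_le_one (hδ : 0 < δ) (x : ℝ × ℝ) : cutoff δ K x ≤ 1 :=
  max_le zero_le_one (by
    have : 0 ≤ δ⁻¹ * Metric.infDist x K := mul_nonneg (inv_pos.2 hδ).le Metric.infDist_nonneg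
    linarith)

lemma cutoff_of_mem {x : ℝ × ℝ} (hx : x ∈ K) : cutoff δ K x = 1 := by
  rw [cutoff, Metric.infDist_zero_of_mem hx]; simp

lemma mem_cthickening_of_cutoff_ne (hδ : 0 < δ) (hK : K.Nonempty) {x : ℝ × ℝ}
    (hx : cutoff δ K x ≠ 0) : x ∈ Metric.cthickening δ K := by
  by_contra h
  refine hx (max_eq_left ?_)
  have h1 : δ < Metric.infDist x K := by
    by_contra! h'
    refine h ?_
    rw [Metric.mem_cthickening_iff]
    exact (ENNReal.le_ofReal_iff_toReal_le (Metric.infEDist_ne_top hK) hδ.le).2 h'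
  have h2 : δ⁻¹ * δ ≤ δ⁻¹ * Metric.infDist x K := by gcongr
  rw [inv_mul_cancel₀ hδ.ne'] at h2
  linarith

lemma tsupport_cutoff (hδ : 0 < δ) (hK : K.Nonempty) :
    tsupport (cutoff δ K) ⊆ Metric.cthickening δ K :=
  closure_minimal (fun _ hx => mem_cthickening_of_cutoff_ne hδ hK hx) Metric.isClosed_cthickening

end Cutoff

lemma integrable_of_compact {F : ℝ × ℝ → ℝ} {K : Set (ℝ × ℝ)} (hK : IsCompact K)
    (hF : Measurable F) {B : ℝ} (hB : ∀ x ∈ K, |F x| ≤ B) (h0 : ∀ x, x ∉ K → F x = 0) :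
    Integrable F := by
  rw [← integrableOn_iff_integrable_of_support_subset
    (fun x hx => by by_contra h; exact hx (h0 x h) : Function.support F ⊆ K)]
  exact IntegrableOn.of_bound hK.measure_lt_top hF.aestronglyMeasurable B
    ((ae_restrict_mem hK.isClosed.measurableSet).mono hB)

/-- Pointwise coercivity for the interior estimate. -/
lemma energy_pointwise {a0 ah Am w W N1 N2 n η p1 p2 P α da β db X1 X2 : ℝ} (h0 : 0 < a0)
    (hah : a0 ≤ ah) (hAm : |ah| ≤ Am) (hw : |w| ≤ W) (hN1 : |N1| ≤ n) (hN2 : |N2| ≤ n)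
    (hη0 : 0 ≤ η) (hη1 : η ≤ 1) (hp1 : |p1| ≤ P) (hp2 : |p2| ≤ P) (hα : |α| ≤ da)
    (hβ : |β| ≤ db) :
    a0 / 2 * ((η * X1) ^ 2 + (η * X2) ^ 2) -
        ((2 * (Am * W * n) + da * P + db) ^ 2 / a0 + 2 * (W * (da * (P * n + P * n) + db * n))) ≤
      ah * (X1 * (η * (η * X1) + 2 * η * w * N1) + X2 * (η * (η * X2) + 2 * η * w * N2)) +
        α * (p1 * (η * (η * X1) + 2 * η * w * N1) + p2 * (η * (η * X2) + 2 * η * w * N2)) +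
        β * (η * (η * X2) + 2 * η * w * N2) := by
  have hAm0 := (abs_nonneg _).trans hAm
  have hW0 := (abs_nonneg _).trans hw
  have hn0 := (abs_nonneg _).trans hN1
  have hP0 := (abs_nonneg _).trans hp1
  have hda0 := (abs_nonneg _).trans hα
  have hdb0 := (abs_nonneg _).trans hβ
  have hη : |η| ≤ 1 := by rwa [abs_of_nonneg hη0]
  set A := 2 * (Am * W * n) + da * P + db with hA
  have hA0 : 0 ≤ A := by positivity
  have c1 : |2 * (ah * w * N1) + α * p1 * η| ≤ A := by
    refine (abs_add_le _ _).trans ?_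
    simp only [abs_mul, abs_two]
    calc 2 * (|ah| * |w| * |N1|) + |α| * |p1| * |η| ≤ 2 * (Am * W * n) + da * P * 1 := by gcongr
      _ ≤ A := by rw [hA]; linarith
  have c2 : |2 * (ah * w * N2) + α * p2 * η + β * η| ≤ A := by
    refine (abs_add_three _ _ _).trans ?_
    simp only [abs_mul, abs_two]
    calc 2 * (|ah| * |w| * |N2|) + |α| * |p2| * |η| + |β| * |η| ≤
        2 * (Am * W * n) + da * P * 1 + db * 1 := by gcongr
      _ ≤ A := by rw [hA]; linarith
  have c3 : |2 * (η * w * (α * (p1 * N1 + p2 * N2) + β * N2))| ≤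
      2 * (W * (da * (P * n + P * n) + db * n)) := by
    simp only [abs_mul, abs_two]
    have i1 : |p1 * N1 + p2 * N2| ≤ P * n + P * n := by
      refine (abs_add_le _ _).trans ?_
      rw [abs_mul, abs_mul]; gcongr
    have i2 : |α * (p1 * N1 + p2 * N2) + β * N2| ≤ da * (P * n + P * n) + db * n := by
      refine (abs_add_le _ _).trans ?_
      rw [abs_mul, abs_mul]; gcongr
    have i3 : |η| * |w| ≤ 1 * W := by gcongr
    rw [one_mul] at i3
    gcongr
  set Y1 := η * X1
  set Y2 := η * X2
  set d1 := 2 * (ah * w * N1) + α * p1 * η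
  set d2 := 2 * (ah * w * N2) + α * p2 * η + β * η
  set r := 2 * (η * w * (α * (p1 * N1 + p2 * N2) + β * N2))
  -- In the application `w` is the difference quotient of `p`, `X1` and `X2` those of its partial
  -- derivatives, `α` and `β` those of the coefficients, and `(N1, N2) = ∇η`. The factors `η * (η *
  -- Xi) + 2 * η * w * Ni` are the components of `∇(η² w)`. Regrouping leaves a coercive quadratic
  -- form in `η X`, linear terms with bounded coefficients, and a bounded remainder.
  have e : ah * (X1 * (η * Y1 + 2 * η * w * N1) + X2 * (η * Y2 + 2 * η * w * N2)) +
        α * (p1 * (η * Y1 + 2 * η * w * N1) + p2 * (η * Y2 + 2 * η * w * N2)) +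
        β * (η * Y2 + 2 * η * w * N2) = ah * (Y1 ^ 2 + Y2 ^ 2) + d1 * Y1 + d2 * Y2 + r := by
    simp only [Y1, Y2, d1, d2, r]; ring
  rw [e]
  -- Young's inequality spends half of the coercivity `a0` on each linear term.
  have young : ∀ d Y : ℝ, |d| ≤ A → -(a0 / 2 * Y ^ 2 + A ^ 2 / (2 * a0)) ≤ d * Y := by
    intro d Y hd
    have h1 : d ^ 2 ≤ A ^ 2 := sq_le_sq' (by linarith [(abs_le.1 hd).1]) (abs_le.1 hd).2
    have h2 : d ^ 2 / (2 * a0) ≤ A ^ 2 / (2 * a0) := by gcongr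
    have h3 : a0 / 2 * Y ^ 2 + d ^ 2 / (2 * a0) + d * Y = (a0 * Y + d) ^ 2 / (2 * a0) := by
      field_simp; ring
    have h4 : 0 ≤ (a0 * Y + d) ^ 2 / (2 * a0) := by positivity
    linarith
  have y1 := young d1 Y1 c1
  have y2 := young d2 Y2 c2
  have hY : a0 * (Y1 ^ 2 + Y2 ^ 2) ≤ ah * (Y1 ^ 2 + Y2 ^ 2) := by gcongr
  have hr := (abs_le.1 c3).1
  have hAA : A ^ 2 / a0 = A ^ 2 / (2 * a0) + A ^ 2 / (2 * a0) := by field_simp; ring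
  linarith

lemma ae_differentiableAt_add {p : ℝ × ℝ → ℝ} {C : NNReal} (hp : LipschitzWith C p) (v : ℝ × ℝ) :
    ∀ᵐ x, DifferentiableAt ℝ p (x + v) :=
  (quasiMeasurePreserving_add_right volume v).ae hp.ae_differentiableAt

/-- The difference quotients of the gradient of a Lipschitz weak solution of
`∇ · (a ∇p + b e_z) = 0` are locally bounded in `L²`. -/
lemma dq_gradient_bound {p a b : ℝ × ℝ → ℝ} {Cp Ca Cb : NNReal} (hp : LipschitzWith Cp p)
    (ha : LipschitzWith Ca a) (hb : LipschitzWith Cb b) {K : Set (ℝ × ℝ)} (hK : IsCompact K)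
    (hKne : K.Nonempty) {δ a0 : ℝ} (hδ : 0 < δ) (h0 : 0 < a0)
    (haK : ∀ x ∈ Metric.cthickening (2 * δ) K, a0 ≤ a x)
    (heq : ∀ (φ : ℝ × ℝ → ℝ) (C : NNReal), LipschitzWith C φ →
      tsupport φ ⊆ Metric.cthickening (2 * δ) K →
      ∫ x, (a x * (dy p x * dy φ x + dz p x * dz φ x) + b x * dz φ x) = 0) (e : ℝ × ℝ) :
    ∃ A, ∀ h, 0 < h → h * ‖e‖ ≤ δ →
      ∫ x in K, (dq h e (dy p) x ^ 2 + dq h e (dz p) x ^ 2) ≤ A := by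
  -- The cutoff is supported within distance `δ` of `K` and is shifted by at most another `δ`.
  set K2 := Metric.cthickening (2 * δ) K with hK2
  have hK2c : IsCompact K2 := hK.cthickening
  have hK12 : Metric.cthickening δ K ⊆ K2 := Metric.cthickening_mono (by linarith) K
  obtain ⟨Am, hAm⟩ := hK2c.exists_bound_of_continuousOn ha.continuous.continuousOn
  obtain ⟨Bm, hBm⟩ := hK2c.exists_bound_of_continuousOn hb.continuous.continuousOn
  set M := (2 * (Am * (Cp * ‖e‖) * δ⁻¹) + Ca * ‖e‖ * Cp + Cb * ‖e‖) ^ 2 / a0 +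
    2 * ((Cp * ‖e‖) * (Ca * ‖e‖ * (Cp * δ⁻¹ + Cp * δ⁻¹) + Cb * ‖e‖ * δ⁻¹)) with hM
  refine ⟨2 / a0 * (M * (volume K2).toReal), fun h hh hhδ => ?_⟩
  let η := cutoff δ K
  have hη : LipschitzWith (Real.toNNReal δ⁻¹) η := lipschitzWith_cutoff hδ
  have hη1 : ∀ x, |η x| ≤ 1 := fun x => by
    rw [abs_of_nonneg (cutoff_nonneg x)]; exact cutoff_le_one hδ x
  let w := dq h e p
  obtain ⟨Cw, hw⟩ := lipschitzWith_dq hp hh e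
  have hwb : ∀ x, |w x| ≤ Cp * ‖e‖ := abs_dq_le hp hh e
  obtain ⟨C1, hC1⟩ := lipschitzWith_mul_of_bounded hη hw hη1 hwb
  have hb1 : ∀ x, |η x * w x| ≤ 1 * (Cp * ‖e‖) := fun x => by
    rw [abs_mul]; exact mul_le_mul (hη1 x) (hwb x) (abs_nonneg _) zero_le_one
  obtain ⟨Cq, hq⟩ := lipschitzWith_mul_of_bounded hη hC1 hη1 hb1
  -- The classical choice `η² w`, with `w` the difference quotient of `p`. It is Lipschitz because
  -- `p` is, so no smoothing is needed.
  let q : ℝ × ℝ → ℝ := fun x => η x * (η x * w x)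
  have hqs : tsupport q ⊆ Metric.cthickening δ K :=
    (closure_mono (Function.support_mul_subset_left _ _)).trans (tsupport_cutoff hδ hKne)
  -- Testing with the translate `q'` and changing variables yields the shifted equation tested with
  -- `q`.
  let q' : ℝ × ℝ → ℝ := fun x => q (x - h • e)
  have hq' : LipschitzWith Cq q' := by
    refine LipschitzWith.of_dist_le_mul fun x y => ?_
    have := hq.dist_le_mul (x - h • e) (y - h • e)
    rwa [dist_sub_right] at this
  have hhe : ‖h • e‖ ≤ δ := by rwa [norm_smul, Real.norm_of_nonneg hh.le]
  have hshift : ∀ x ∈ Metric.cthickening δ K, ∀ v : ℝ × ℝ, ‖v‖ ≤ δ → x + v ∈ K2 := by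
    intro x hx v hv
    have h1 : x + v ∈ Metric.cthickening δ (Metric.cthickening δ K) :=
      Metric.mem_cthickening_of_dist_le _ x _ _ hx (by rwa [dist_eq_norm, add_sub_cancel_left])
    have h2 := Metric.cthickening_cthickening_subset hδ.le hδ.le K h1
    rwa [← two_mul] at h2
  have hq's : tsupport q' ⊆ K2 := by
    refine closure_minimal (fun x hx => ?_) hK2c.isClosed
    have h1 : x - h • e ∈ Metric.cthickening δ K := hqs (subset_tsupport _ hx)
    simpa using hshift _ h1 (h • e) hhe
  have E1 := heq q Cq hq (hqs.trans hK12)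
  have E2 := heq q' Cq hq' hq's
  have hdy' : ∀ x, dy q' x = dy q (x - h • e) := fun x => by
    simp only [dy, q']; rw [fderiv_comp_sub]
  have hdz' : ∀ x, dz q' x = dz q (x - h • e) := fun x => by
    simp only [dz, q']; rw [fderiv_comp_sub]
  have hdq0 : ∀ x, x ∉ Metric.cthickening δ K → fderiv ℝ q x = 0 := fun x hx =>
    image_eq_zero_of_notMem_tsupport fun h' => hx (hqs (tsupport_fderiv_subset ℝ h'))
  have e1n : ‖((1 : ℝ), (0 : ℝ))‖ = 1 := by simp [Prod.norm_def]
  have e2n : ‖((0 : ℝ), (1 : ℝ))‖ = 1 := by simp [Prod.norm_def]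
  have by_ : ∀ {f : ℝ × ℝ → ℝ} {C : NNReal}, LipschitzWith C f → ∀ x, |dy f x| ≤ C :=
    fun hf x => by
      have := norm_fderiv_apply_le hf x (1, 0)
      rwa [e1n, mul_one] at this
  have bz_ : ∀ {f : ℝ × ℝ → ℝ} {C : NNReal}, LipschitzWith C f → ∀ x, |dz f x| ≤ C :=
    fun hf x => by
      have := norm_fderiv_apply_le hf x (0, 1)
      rwa [e2n, mul_one] at this
  have my : ∀ f : ℝ × ℝ → ℝ, Measurable (dy f) := fun f => measurable_fderiv_apply_const ℝ f _
  have mz : ∀ f : ℝ × ℝ → ℝ, Measurable (dz f) := fun f => measurable_fderiv_apply_const ℝ f _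
  have mp1 := my p
  have mp2 := mz p
  have mq1 := my q
  have mq2 := mz q
  have ma := ha.continuous.measurable
  have mb := hb.continuous.measurable
  have mη := hη.continuous.measurable
  have msh : Measurable fun x : ℝ × ℝ => x + h • e := measurable_id.add_const _
  -- the two fluxes tested with `q`
  have fluxbound : ∀ a' b' p1 p2 q1 q2 : ℝ, |a'| ≤ Am → |b'| ≤ Bm → |p1| ≤ Cp → |p2| ≤ Cp →
      |q1| ≤ Cq → |q2| ≤ Cq →
      |a' * (p1 * q1 + p2 * q2) + b' * q2| ≤ Am * (Cp * Cq + Cp * Cq) + Bm * Cq := by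
    intro a' b' p1 p2 q1 q2 h1 h2 h3 h4 h5 h6
    have hA0 := (abs_nonneg _).trans h1
    have hB0 := (abs_nonneg _).trans h2
    have i1 : |p1 * q1 + p2 * q2| ≤ Cp * Cq + Cp * Cq := by
      refine (abs_add_le _ _).trans ?_
      rw [abs_mul, abs_mul]; gcongr
    refine (abs_add_le _ _).trans ?_
    rw [abs_mul, abs_mul]; gcongr
  have I1 : Integrable fun x => a x * (dy p x * dy q x + dz p x * dz q x) + b x * dz q x := by
    refine integrable_of_compact hK2c
      ((ma.mul ((mp1.mul mq1).add (mp2.mul mq2))).add (mb.mul mq2))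
      (fun x hx => fluxbound _ _ _ _ _ _ (hAm x hx) (hBm x hx) (by_ hp x) (bz_ hp x) (by_ hq x)
        (bz_ hq x)) fun x hx => ?_
    simp [dy, dz, hdq0 x fun h' => hx (hK12 h')]
  have I2 : Integrable fun x => a (x + h • e) * (dy p (x + h • e) * dy q x +
      dz p (x + h • e) * dz q x) + b (x + h • e) * dz q x := by
    refine integrable_of_compact (hK.cthickening (r := δ))
      (((ma.comp msh).mul (((mp1.comp msh).mul mq1).add ((mp2.comp msh).mul mq2))).add
        ((mb.comp msh).mul mq2))
      (fun x hx => fluxbound _ _ _ _ _ _ (hAm _ (hshift x hx _ hhe)) (hBm _ (hshift x hx _ hhe))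
        (by_ hp _) (bz_ hp _) (by_ hq x) (bz_ hq x)) fun x hx => ?_
    simp [dy, dz, hdq0 x hx]
  have E2' : ∫ x, (a (x + h • e) * (dy p (x + h • e) * dy q x +
      dz p (x + h • e) * dz q x) + b (x + h • e) * dz q x) = 0 := by
    rw [← E2, ← integral_sub_right_eq_self _ (h • e)]
    simp only [sub_add_cancel, hdy', hdz']
  -- `J` is the difference quotient of the equation tested with `q`. It has integral zero and is
  -- bounded below pointwise through `energy_pointwise`.
  let J : ℝ × ℝ → ℝ := fun x => h⁻¹ * ((a (x + h • e) * (dy p (x + h • e) * dy q x +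
      dz p (x + h • e) * dz q x) + b (x + h • e) * dz q x) -
      (a x * (dy p x * dy q x + dz p x * dz q x) + b x * dz q x))
  have hJi : Integrable J := (I2.sub I1).const_mul _
  have hJ0 : ∫ x, J x = 0 := by
    simp only [J]
    rw [integral_const_mul, integral_sub I2 I1, E1, E2', sub_zero, mul_zero]
  let Q : ℝ × ℝ → ℝ := fun x => (η x * dq h e (dy p) x) ^ 2 + (η x * dq h e (dz p) x) ^ 2
  have bX : ∀ {f : ℝ × ℝ → ℝ}, (∀ x, |f x| ≤ Cp) → ∀ x, |dq h e f x| ≤ h⁻¹ * (Cp + Cp) := by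
    intro f hf x
    rw [dq, abs_mul, abs_of_pos (inv_pos.2 hh)]
    gcongr
    exact (abs_sub _ _).trans (add_le_add (hf _) (hf _))
  have mX : ∀ {f : ℝ × ℝ → ℝ}, Measurable f → Measurable (dq h e f) := fun hf =>
    ((hf.comp msh).sub hf).const_mul _
  have hη0 : ∀ x, x ∉ Metric.cthickening δ K → η x = 0 := fun x hx => by
    by_contra h'; exact hx (mem_cthickening_of_cutoff_ne hδ hKne h')
  have hQi : Integrable Q := by
    refine integrable_of_compact hK2c
      (((mη.mul (mX mp1)).pow_const 2).add ((mη.mul (mX mp2)).pow_const 2))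
      (B := (1 * (h⁻¹ * (Cp + Cp))) ^ 2 + (1 * (h⁻¹ * (Cp + Cp))) ^ 2) (fun x _ => ?_)
      fun x hx => by simp [Q, hη0 x fun h' => hx (hK12 h')]
    rw [abs_of_nonneg (by positivity)]
    have i1 := mul_le_mul (hη1 x) (bX (by_ hp) x) (abs_nonneg _) zero_le_one
    have i2 := mul_le_mul (hη1 x) (bX (bz_ hp) x) (abs_nonneg _) zero_le_one
    rw [← abs_mul] at i1 i2
    exact add_le_add (sq_le_sq' (by linarith [(abs_le.1 i1).1]) (abs_le.1 i1).2)
      (sq_le_sq' (by linarith [(abs_le.1 i2).1]) (abs_le.1 i2).2)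
  have hpt : ∀ᵐ x, a0 / 2 * Q x - K2.indicator (fun _ => M) x ≤ J x := by
    filter_upwards [hp.ae_differentiableAt, ae_differentiableAt_add hp (h • e),
      hη.ae_differentiableAt] with x d1 d2 d3
    by_cases hx : x ∈ Metric.cthickening δ K
    swap
    · have z1 : J x = 0 := by simp [J, dy, dz, hdq0 x hx]
      have z2 : Q x = 0 := by simp [Q, hη0 x hx]
      have hAm0 : 0 ≤ Am := by
        obtain ⟨x0, hx0⟩ := hKne
        exact (norm_nonneg _).trans (hAm x0 (Metric.self_subset_cthickening _ hx0))
      have : 0 ≤ K2.indicator (fun _ => M) x := indicator_nonneg (fun _ _ => by positivity) x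
      rw [z1, z2]; linarith
    have hxK2 : x ∈ K2 := hK12 hx
    have hxs : x + h • e ∈ K2 := hshift x hx _ hhe
    rw [indicator_of_mem hxK2]
    have dw : HasFDerivAt w (h⁻¹ • (fderiv ℝ p (x + h • e) - fderiv ℝ p x)) x := by
      have g1 : HasFDerivAt (fun x => p (x + h • e)) (fderiv ℝ p (x + h • e)) x := by
        rw [hasFDerivAt_comp_add_right]; exact d2.hasFDerivAt
      exact (g1.sub d1.hasFDerivAt).const_mul h⁻¹
    have dqd := d3.hasFDerivAt.mul (d3.hasFDerivAt.mul dw)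
    have hqd : ∀ v : ℝ × ℝ, fderiv ℝ q x v = η x * (η x * (h⁻¹ * (fderiv ℝ p (x + h • e) v -
        fderiv ℝ p x v))) + 2 * η x * w x * fderiv ℝ η x v := by
      intro v
      have : HasFDerivAt q _ x := dqd
      rw [this.fderiv]
      simp only [add_apply, smul_apply, sub_apply, smul_eq_mul, Pi.mul_apply]
      ring
    have key := energy_pointwise (X1 := dq h e (dy p) x) (X2 := dq h e (dz p) x) (n := δ⁻¹) (η := η x) h0
      (haK _ hxs) (hAm _ hxs) (hwb x)
      (by have := by_ hη x; rwa [Real.coe_toNNReal _ (inv_pos.2 hδ).le] at this)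
      (by have := bz_ hη x; rwa [Real.coe_toNNReal _ (inv_pos.2 hδ).le] at this)
      (cutoff_nonneg (δ := δ) (K := K) x) (cutoff_le_one (K := K) hδ x) (by_ hp x) (bz_ hp x)
      (abs_dq_le ha hh e x)
      (abs_dq_le hb hh e x)
    refine key.trans (le_of_eq ?_)
    have gy : dy q x = η x * (η x * dq h e (dy p) x) + 2 * η x * w x * dy η x := hqd (1, 0)
    have gz : dz q x = η x * (η x * dq h e (dz p) x) + 2 * η x * w x * dz η x := hqd (0, 1)
    simp only [J, gy, gz, η]
    simp only [dq]
    field_simp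
    ring
  have hind : Integrable (K2.indicator fun _ : ℝ × ℝ => M) := by
    rw [integrable_indicator_iff hK2c.isClosed.measurableSet]
    exact integrableOn_const hK2c.measure_lt_top.ne
  have hfin : a0 / 2 * ∫ x, Q x ≤ M * (volume K2).toReal := by
    have h1 := integral_mono_ae ((hQi.const_mul (a0 / 2)).sub hind) hJi hpt
    rw [hJ0] at h1
    simp only [Pi.sub_apply] at h1
    rw [integral_sub (hQi.const_mul _) hind, integral_const_mul,
      integral_indicator hK2c.isClosed.measurableSet, setIntegral_const, smul_eq_mul,
      Measure.real] at h1
    linarith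
  have hle : ∫ x in K, (dq h e (dy p) x ^ 2 + dq h e (dz p) x ^ 2) ≤ ∫ x, Q x := by
    have : ∫ x in K, (dq h e (dy p) x ^ 2 + dq h e (dz p) x ^ 2) = ∫ x in K, Q x :=
      setIntegral_congr_fun hK.isClosed.measurableSet fun x hx => by
        simp [Q, η, cutoff_of_mem hx]
    rw [this]
    exact setIntegral_le_integral hQi (Eventually.of_forall fun x => by positivity)
  refine hle.trans ?_
  rw [div_mul_eq_mul_div, le_div_iff₀ h0]
  linarith

end Fingering

/-! ### Interior second derivatives with locally Lipschitz coefficients -/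

namespace Fingering

/-- The coefficients are Lipschitz only on compact subsets of `U`. Extended from a compact
neighbourhood of `K` to the plane, they leave the equation unchanged for test functions supported in
that neighbourhood. -/
lemma dq_gradient_bound_of_subset {p a b : ℝ × ℝ → ℝ} {Cp : NNReal} (hp : LipschitzWith Cp p)
    {U : Set (ℝ × ℝ)} (hU : IsOpen U)
    (ha : ∀ K, IsCompact K → K ⊆ U → ∃ C, LipschitzOnWith C a K)
    (hb : ∀ K, IsCompact K → K ⊆ U → ∃ C, LipschitzOnWith C b K) {a0 : ℝ} (h0 : 0 < a0)
    (haU : ∀ x ∈ U, a0 ≤ a x)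
    (heq : ∀ (φ : ℝ × ℝ → ℝ) (C : NNReal), LipschitzWith C φ → HasCompactSupport φ →
      tsupport φ ⊆ U → ∫ x in U, (a x * (dy p x * dy φ x + dz p x * dz φ x) + b x * dz φ x) = 0)
    (e : ℝ × ℝ) {K : Set (ℝ × ℝ)} (hK : IsCompact K) (hKU : K ⊆ U) :
    ∃ A h0, 0 < h0 ∧ ∀ h, 0 < h → h < h0 →
      ∫ x in K, (dq h e (dy p) x ^ 2 + dq h e (dz p) x ^ 2) ≤ A := by
  rcases K.eq_empty_or_nonempty with rfl | hne
  · exact ⟨0, 1, one_pos, fun h _ _ => by simp⟩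
  obtain ⟨δ', hδ', hsub⟩ := hK.exists_cthickening_subset_open hU hKU
  obtain ⟨δ, hδ, rfl⟩ : ∃ δ, 0 < δ ∧ δ' = 2 * δ := ⟨δ' / 2, by positivity, by ring⟩
  set T := Metric.cthickening (2 * δ) K with hT
  have hTc : IsCompact T := hK.cthickening
  obtain ⟨Ca, hCa⟩ := ha T hTc hsub
  obtain ⟨Cb, hCb⟩ := hb T hTc hsub
  obtain ⟨a', ha', haa⟩ := hCa.extend_real
  obtain ⟨b', hb', hbb⟩ := hCb.extend_real
  have heq' : ∀ (φ : ℝ × ℝ → ℝ) (C : NNReal), LipschitzWith C φ → tsupport φ ⊆ T →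
      ∫ x, (a' x * (dy p x * dy φ x + dz p x * dz φ x) + b' x * dz φ x) = 0 := by
    intro φ C hφ hφT
    rw [← heq φ C hφ (hTc.of_isClosed_subset (isClosed_tsupport φ) hφT) (hφT.trans hsub),
      ← integral_indicator hU.measurableSet]
    refine integral_congr_ae (Eventually.of_forall fun x => ?_)
    by_cases hx : x ∈ T
    · rw [indicator_of_mem (hsub hx)]
      simp only [← haa hx, ← hbb hx]
    · have hz : fderiv ℝ φ x = 0 := by
        by_contra hne'
        exact hx (hφT (tsupport_fderiv_subset ℝ (subset_tsupport _ hne')))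
      by_cases hxU : x ∈ U
      · simp [indicator_of_mem hxU, dy, dz, hz]
      · simp [indicator_of_notMem hxU, dy, dz, hz]
  obtain ⟨A, hA⟩ := dq_gradient_bound hp ha' hb' hK hne hδ h0
    (fun x hx => by rw [← haa hx]; exact haU x (hsub hx)) heq' e
  refine ⟨A, δ / (‖e‖ + 1), by positivity, fun h hh hlt => hA h hh ?_⟩
  rw [lt_div_iff₀ (by positivity)] at hlt
  nlinarith

lemma exists_weakD_gradient {p a b : ℝ × ℝ → ℝ} {Cp : NNReal} (hp : LipschitzWith Cp p)
    {U : Set (ℝ × ℝ)} (hU : IsOpen U) (hne : (Uᶜ).Nonempty)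
    (ha : ∀ K, IsCompact K → K ⊆ U → ∃ C, LipschitzOnWith C a K)
    (hb : ∀ K, IsCompact K → K ⊆ U → ∃ C, LipschitzOnWith C b K) {a0 : ℝ} (h0 : 0 < a0)
    (haU : ∀ x ∈ U, a0 ≤ a x)
    (heq : ∀ (φ : ℝ × ℝ → ℝ) (C : NNReal), LipschitzWith C φ → HasCompactSupport φ →
      tsupport φ ⊆ U → ∫ x in U, (a x * (dy p x * dy φ x + dz p x * dz φ x) + b x * dz φ x) = 0)
    (e : ℝ × ℝ) :
    (∃ v, InL2loc U v ∧ IsWeakD e U (dy p) v) ∧ ∃ v, InL2loc U v ∧ IsWeakD e U (dz p) v := by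
  have my : Measurable (dy p) := measurable_fderiv_apply_const ℝ p _
  have mz : Measurable (dz p) := measurable_fderiv_apply_const ℝ p _
  have by_ : ∀ x, |dy p x| ≤ Cp := fun x => by
    have := norm_fderiv_apply_le hp x (1, 0)
    simpa [dy] using this
  have bz_ : ∀ x, |dz p x| ≤ Cp := fun x => by
    have := norm_fderiv_apply_le hp x (0, 1)
    simpa [dz] using this
  have key : ∀ {f : ℝ × ℝ → ℝ}, Measurable f → (∀ x, |f x| ≤ Cp) → ∀ h, 0 < h →
      ∀ K, IsCompact K → IntegrableOn (fun x => dq h e f x ^ 2) K := by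
    intro f hf hB h hh K hK
    have : ∀ x, |dq h e f x| ≤ h⁻¹ * (Cp + Cp) := fun x => by
      rw [dq, abs_mul, abs_of_pos (inv_pos.2 hh)]
      gcongr
      exact (abs_sub _ _).trans (add_le_add (hB _) (hB _))
    refine Measure.integrableOn_of_bounded (M := (h⁻¹ * (Cp + Cp)) ^ 2) hK.measure_lt_top.ne
      ((((hf.comp (measurable_id.add_const _)).sub hf).const_mul _).pow_const 2).aestronglyMeasurable
      (Eventually.of_forall fun x => ?_)
    rw [Real.norm_eq_abs, abs_pow]
    gcongr
    exact this x
  refine ⟨exists_weakD_of_dq hU hne my by_ fun K hK hKU => ?_,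
    exists_weakD_of_dq hU hne mz bz_ fun K hK hKU => ?_⟩ <;>
  · obtain ⟨A, t0, ht0, hA⟩ := dq_gradient_bound_of_subset hp hU ha hb h0 haU heq e hK hKU
    refine ⟨A, t0, ht0, fun t ht htt => le_trans ?_ (hA t ht htt)⟩
    refine setIntegral_mono_on (key (by assumption) (by assumption) t ht K hK)
      ((key my by_ t ht K hK).add (key mz bz_ t ht K hK)) hK.measurableSet fun x _ => ?_
    nlinarith [sq_nonneg (dq t e (dy p) x), sq_nonneg (dq t e (dz p) x)]

end Fingering

namespace Fingering

/-! ### Truncated solutions with Lipschitz pressure -/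

variable {D : TWData} {sstar H : ℝ} {s sz p py pz : ℝ × ℝ → ℝ} {pstar : ℝ}

lemma le_of_ae_le_of_isOpen {U : Set (ℝ × ℝ)} (hU : IsOpen U) {f : ℝ × ℝ → ℝ} (hf : Continuous f)
    {M : ℝ} (h : ∀ᵐ x ∂volume.restrict U, f x ≤ M) : ∀ x ∈ closure U, f x ≤ M := by
  have h1 : EqOn (fun x => max (f x) M) (fun _ => M) U :=
    Measure.eqOn_open_of_ae_eq (by filter_upwards [h] with x hx; exact max_eq_right hx) hU
      (by fun_prop) continuousOn_const
  intro x hx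
  have := h1.closure (by fun_prop) continuous_const hx
  exact max_eq_right_iff.1 this

lemma closure_rect {L a b : ℝ} (hL : 0 < L) (hab : a < b) :
    closure (rect L a b) = Icc 0 L ×ˢ Icc a b := by
  rw [rect, closure_prod_eq, closure_Ioo hL.ne, closure_Ioo hab.ne]

/-- The solution `(s, p)` of the truncated problem has a Lipschitz pressure `P ≤ B` and saturations
in `[s_*, hi]`; almost all vertical slices solve the imbibition equation. -/
structure IsLipschitzSolution (D : TWData) (sstar hi : ℝ) (C : NNReal) (B H : ℝ)
    (s sz p py pz : ℝ × ℝ → ℝ) (pstar : ℝ) (P : ℝ × ℝ → ℝ) : Prop where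
  sol : IsTWSolutionWith D H s sz p py pz pstar
  lip : LipschitzWith C P
  p_eq : p =ᵐ[volume.restrict (rect D.L 0 H)] P
  py_eq : py =ᵐ[volume.restrict (rect D.L 0 H)] dy P
  pz_eq : pz =ᵐ[volume.restrict (rect D.L 0 H)] dz P
  bottom : ∀ y ∈ Ioo 0 D.L, P (y, 0) = D.p0 y
  bound : ∀ y ∈ Ioo 0 D.L, ∀ z ∈ Icc 0 H, P (y, z) ≤ B
  imb : ∀ᵐ y ∂volume.restrict (Ioo 0 D.L), IsImbibition (D.c * D.τ) D.pc (fun z => P (y, z))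
    sstar hi H (D.s0 y) (fun z => slicePrim 0 D.s0 sz (y, z))
  rate_eq : ∀ᵐ y ∂volume.restrict (Ioo 0 D.L), ∀ᵐ z ∂volume.restrict (Ioo 0 H),
    sz (y, z) = rate (D.c * D.τ) D.pc (P (y, z)) (slicePrim 0 D.s0 sz (y, z))

/-- On a generic vertical line the primitive of `pz` and the Lipschitz function `P` have the same
derivative and agree almost everywhere. Hence their base values agree, which identifies `P(·,0)`
with the trace `p0`. -/
lemma IsTWSolutionWith.ae_eq_slices (h : IsTWSolutionWith D H s sz p py pz pstar) (hH : 0 < H)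
    {C : NNReal} {P : ℝ × ℝ → ℝ} (hP : LipschitzWith C P)
    (hp : p =ᵐ[volume.restrict (rect D.L 0 H)] P)
    (hpz : pz =ᵐ[volume.restrict (rect D.L 0 H)] dz P) :
    ∀ᵐ y ∂volume.restrict (Ioo 0 D.L), P (y, 0) = D.p0 y ∧
      ∀ z ∈ Icc 0 H, slicePrim 0 D.p0 pz (y, z) = P (y, z) := by
  filter_upwards [ae_ae_of_ae_rect ((h.p_ae_eq hH.le).symm.trans hp), ae_ae_of_ae_rect hpz,
    ae_restrict_of_ae (slicePrim_of_lipschitz hP 0)] with y h1 h2 h3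
  have hint : ∀ z ∈ Icc 0 H, ∫ ζ in 0..z, pz (y, ζ) = ∫ ζ in 0..z, dz P (y, ζ) := by
    intro z hz
    rw [intervalIntegral_eq_Ioo hz.1, intervalIntegral_eq_Ioo hz.1]
    exact integral_congr_ae (ae_restrict_of_ae_restrict_of_subset (Ioo_subset_Ioo le_rfl hz.2) h2)
  have hb : P (y, 0) = D.p0 y := by
    have : ∀ᵐ z ∂volume.restrict (Ioo 0 H), P (y, 0) = D.p0 y := by
      -- The conclusion does not involve the height, so a single good `z` will do.
      filter_upwards [h1, ae_restrict_mem measurableSet_Ioo] with z hz hzm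
      have e1 := h3 z
      rw [← hz] at e1
      simp only [slicePrim, hint z (Ioo_subset_Icc_self hzm)] at e1
      linarith
    have hne : NeBot (ae ((volume : Measure ℝ).restrict (Ioo 0 H))) := by
      rw [ae_neBot]
      simp [Measure.restrict_eq_zero, hH]
    exact this.exists.choose_spec
  refine ⟨hb, fun z hz => ?_⟩
  rw [← h3 z, slicePrim, slicePrim, hint z hz]
  simp [hb]

/-- The gradient bound supplies the Lipschitz representative of the pressure. The upper bound `hi`
on the saturation is a barrier argument based on `P ≤ B ≤ p_c(hi)`. -/
lemma IsTWSolutionWith.exists_lipschitz (hL : 0 < D.L) (hc : 0 < D.c) (hτ : 0 < D.τ)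
    (hss : sstar ∈ Ioo (0 : ℝ) 1) (hpc : CapillaryAssumption D.pc sstar)
    (hs0 : ∀ y ∈ Ioo 0 D.L, sstar ≤ D.s0 y ∧ D.s0 y ≤ 1) (hp0 : ContinuousOn D.p0 (Ioo 0 D.L))
    (hcomp : ∀ y ∈ Ioo 0 D.L, D.s0 y < 1 ∧ D.pc (D.s0 y) < D.p0 y) {B hi : ℝ}
    (hhi : hi ∈ Ioo (0 : ℝ) 1) (hB : B ≤ D.pc hi) {CP : ℝ} (hH : 0 < H)
    (h : IsTWSolutionWith D H s sz p py pz pstar)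
    (hpB : ∀ᵐ x ∂volume.restrict (rect D.L 0 H), p x ≤ B)
    (hgrad : GradientBound (rect D.L 0 H) p CP) :
    ∃ P, IsLipschitzSolution D sstar hi (2 * CP.toNNReal) B H s sz p py pz pstar P := by
  have hκ : 0 < D.c * D.τ := mul_pos hc hτ
  obtain ⟨uy, uz, hy, hz, hb⟩ := hgrad
  have by_ : ∀ᵐ x ∂volume.restrict (rect D.L 0 H), |uy x| ≤ CP.toNNReal := by
    filter_upwards [hb] with x hx
    refine le_trans ?_ (hx.trans (Real.le_coe_toNNReal _))
    exact Real.abs_le_sqrt (by nlinarith [sq_nonneg (uz x)])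
  have bz_ : ∀ᵐ x ∂volume.restrict (rect D.L 0 H), |uz x| ≤ CP.toNNReal := by
    filter_upwards [hb] with x hx
    refine le_trans ?_ (hx.trans (Real.le_coe_toNNReal _))
    exact Real.abs_le_sqrt (by nlinarith [sq_nonneg (uy x)])
  obtain ⟨P, hP, hpP⟩ := exists_lipschitz_of_weakD (isOpen_rect _ _ _)
    ((convex_Ioo 0 D.L).prod (convex_Ioo 0 H)) (h.p_h1.mem.integrable one_le_two) hy hz by_ bz_
  have hpy : py =ᵐ[volume.restrict (rect D.L 0 H)] dy P :=
    IsWeakD.ae_eq (isOpen_rect _ _ _) (IsWeakD.congr (e := (1, 0)) h.p_h1.weak_y hpP ae_eq_rfl)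
      (isWeakD_of_lipschitz hP (1, 0) _)
  have hpz : pz =ᵐ[volume.restrict (rect D.L 0 H)] dz P :=
    IsWeakD.ae_eq (isOpen_rect _ _ _) (IsWeakD.congr (e := (0, 1)) h.p_h1.weak_z hpP ae_eq_rfl)
      (isWeakD_of_lipschitz hP (0, 1) _)
  have hsl := h.ae_eq_slices hH hP hpP hpz
  have hbot : ∀ y ∈ Ioo 0 D.L, P (y, 0) = D.p0 y :=
    Measure.eqOn_open_of_ae_eq (hsl.mono fun y hy => hy.1) isOpen_Ioo
      (by have := hP.continuous; fun_prop) hp0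
  have hbd : ∀ y ∈ Ioo 0 D.L, ∀ z ∈ Icc 0 H, P (y, z) ≤ B := by
    intro y hy z hz
    refine le_of_ae_le_of_isOpen (isOpen_rect D.L 0 H) hP.continuous
      (by filter_upwards [hpB, hpP] with x h1 h2; rwa [← h2]) _ ?_
    rw [closure_rect hL hH]
    exact ⟨Ioo_subset_Icc_self hy, hz⟩
  have hrate : ∀ᵐ y ∂volume.restrict (Ioo 0 D.L), ∀ᵐ z ∂volume.restrict (Ioo 0 H),
      sz (y, z) = rate (D.c * D.τ) D.pc (P (y, z)) (slicePrim 0 D.s0 sz (y, z)) := by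
    filter_upwards [h.ae_isGoodSlice hH hc hτ hs0, hsl] with y g1 g2
    filter_upwards [g1.eq, ae_restrict_mem measurableSet_Ioo] with z hz hzm
    rw [rate, eq_div_iff hκ.ne', ← g2.2 z (Ioo_subset_Icc_self hzm), ← hz]
    ring
  refine ⟨P, h, hP, hpP, hpy, hpz, hbot, hbd, ?_, hrate⟩
  filter_upwards [h.ae_isGoodSlice hH hc hτ hs0, hsl, hrate,
    ae_restrict_mem measurableSet_Ioo] with y g1 g2 g3 hy
  have hmono := hpc.strictMonoOn
  -- The compatibility condition starts the slice below the barrier: `p_c(s0) < p0 ≤ B ≤ p_c(hi)`.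
  have h0 : D.s0 y ≤ hi := by
    refine le_of_lt ((hmono.lt_iff_lt ⟨hss.1.trans_le (hs0 y hy).1, (hcomp y hy).1⟩ hhi).1 ?_)
    refine (hcomp y hy).2.trans_le (le_trans ?_ hB)
    rw [← hbot y hy]
    exact hbd y hy 0 ⟨le_rfl, hH.le⟩
  -- Above `hi` the capillary pressure exceeds `B ≥ P`, so the rate vanishes and the slice cannot
  -- move further up.
  have hup := nonpos_of_primitive (F := fun z => slicePrim 0 D.s0 sz (y, z) - hi)
    (F0 := D.s0 y - hi) g1.int_s (fun z _ => by simp only [slicePrim]; ring) (by linarith) (by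
      filter_upwards [g3, ae_restrict_mem measurableSet_Ioo] with z hz hzm hpos
      rw [hz, rate, max_eq_left, zero_div]
      have hS : slicePrim 0 D.s0 sz (y, z) ∈ Ioo (0 : ℝ) 1 :=
        ⟨hss.1.trans_le (g1.lower z (Ioo_subset_Icc_self hzm)), g1.upper z ⟨hzm.1.le, hzm.2⟩⟩
      have := hmono hhi hS (by linarith)
      linarith [hbd y hy z (Ioo_subset_Icc_self hzm)])
  refine ⟨?_, fun z hz => ⟨g1.lower z hz, by linarith [hup z hz]⟩, fun z hz => ?_⟩
  · have := (absolutelyContinuous_slicePrim (t := D.s0) g1.int_s).continuousOn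
    rwa [uIcc_of_le hH.le] at this
  · rw [slicePrim, intervalIntegral_eq_Ioo hz.1, intervalIntegral_eq_Ioo hz.1]
    congr 1
    exact integral_congr_ae (ae_restrict_of_ae_restrict_of_subset (Ioo_subset_Ioo le_rfl hz.2) g3)

end Fingering

namespace Fingering

/-! ### Pressure decay and flux for Lipschitz pressure -/

variable {D : TWData} {sstar hi B H : ℝ} {C : NNReal} {s sz p py pz P : ℝ × ℝ → ℝ} {pstar : ℝ}

lemma integrableOn_kExt_mul {k : ℝ → ℝ} (hk : PermeabilityAssumption k) {X : Type*}
    [MeasurableSpace X] {μ : Measure X} {U : Set X} {σ q : X → ℝ}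
    (hσ : AEStronglyMeasurable σ (μ.restrict U)) (hq : IntegrableOn q U μ) :
    IntegrableOn (fun x => kExt k (σ x) * q x) U μ :=
  Integrable.bdd_mul (c := k 1) hq ((continuous_kExt hk).comp_aestronglyMeasurable hσ)
    (Eventually.of_forall fun _ => abs_kExt_le hk _)

/-- Above which height a Lipschitz pressure must lie below `M`. -/
noncomputable def decayHeight (D : TWData) (C : NNReal) (B z0 Ck M : ℝ) : ℝ :=
  z0 + 1 + (max 0 B + |M - C * D.L|) * D.k 1 * D.L / (Ck - D.Finf)

lemma lt_decayHeight (hL : 0 < D.L) (hk : PermeabilityAssumption D.k) {z0 Ck : ℝ}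
    (hCk : D.Finf < Ck) (M : ℝ) : z0 < decayHeight D C B z0 Ck M := by
  have h1 := k_one_nonneg hk
  have h2 : 0 ≤ (max 0 B + |M - C * D.L|) * D.k 1 * D.L / (Ck - D.Finf) := by
    have : 0 < Ck - D.Finf := sub_pos.2 hCk
    positivity
  unfold decayHeight; linarith

/-- A value above `M` at one point forces `P ≥ M - C L` along the whole horizontal section, because
the section has length `L`. This bounds the weighted mean of `P` from below and contradicts the
linear decay above `decayHeight`. -/
lemma IsLipschitzSolution.pressure_le (hk : PermeabilityAssumption D.k) (hL : 0 < D.L)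
    (hg : 0 < D.g) (hc : 0 < D.c) (hτ : 0 < D.τ) (hss : sstar ∈ Ioo (0 : ℝ) 1)
    (hs0 : ∀ y ∈ Ioo 0 D.L, sstar ≤ D.s0 y ∧ D.s0 y ≤ 1)
    (h : IsLipschitzSolution D sstar hi C B H s sz p py pz pstar P) {z0 Ck : ℝ} (hz0 : 0 < z0)
    (hCkF : D.Finf < Ck) {t : ℝ → ℝ} (ht : IsValueAtHeight D.L z0 s t)
    (hCk : Ck ≤ ∫ y in Ioo 0 D.L, D.g * D.k (t y)) {M y z : ℝ} (hy : y ∈ Ioo 0 D.L)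
    (hz : decayHeight D C B z0 Ck M ≤ z) (hzH : z < H) : P (y, z) ≤ M := by
  by_contra! hlt
  have hz0z : z0 < z := (lt_decayHeight hL hk hCkF M).trans_le hz
  have hz' : z ∈ Icc 0 H := ⟨(hz0.trans hz0z).le, hzH.le⟩
  have hH : 0 < H := hz0.trans (hz0z.trans hzH)
  have hdec := h.sol.pressure_decay hk hL hg hc hτ hss hs0 hz0 hz0z hzH (le_max_left 0 B) (by
    have : ∀ x ∈ rect D.L 0 H, P x ≤ B := fun x hx => h.bound x.1 hx.1 x.2 (Ioo_subset_Icc_self hx.2)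
    filter_upwards [h.p_eq, ae_restrict_mem (measurableSet_rect _ _ _)] with x h1 h2
    rw [h1]; exact (this x h2).trans (le_max_right _ _)) ht hCk
  have hosc : ∀ y' ∈ Ioo 0 D.L, -|M - C * D.L| ≤ P (y', z) := by
    intro y' hy'
    have h1 := h.lip.dist_le_mul (y, z) (y', z)
    rw [Real.dist_eq] at h1
    have h2 : dist (y, z) (y', z) ≤ D.L := by
      rw [Prod.dist_eq, dist_self, max_eq_left dist_nonneg, Real.dist_eq, abs_le]
      constructor <;> linarith [hy.1, hy.2, hy'.1, hy'.2]
    have h3 := (abs_le.1 (h1.trans (mul_le_mul_of_nonneg_left h2 C.2))).2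
    have h4 := neg_abs_le (M - C * D.L)
    linarith
  have hcont : IntegrableOn (fun y => P (y, z)) (Ioo 0 D.L) :=
    (memLp_lipschitz_slice h.lip z).integrable one_le_two
  have hslice := integrableOn_slicePrim_slice h.sol.integrable_s0 h.sol.integrable_sz hz'
  have hI := integrableOn_kExt_mul hk hslice.aestronglyMeasurable hcont
  have hk1 := k_one_nonneg hk
  have hlow : -(|M - C * D.L| * D.k 1 * D.L) ≤ ∫ y in Ioo 0 D.L,
      kExt D.k (slicePrim 0 D.s0 sz (y, z)) * slicePrim 0 D.p0 pz (y, z) := by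
    have e1 : ∫ y in Ioo 0 D.L,
        kExt D.k (slicePrim 0 D.s0 sz (y, z)) * slicePrim 0 D.p0 pz (y, z) =
        ∫ y in Ioo 0 D.L, kExt D.k (slicePrim 0 D.s0 sz (y, z)) * P (y, z) := by
      refine integral_congr_ae ?_
      filter_upwards [h.sol.ae_eq_slices hH h.lip h.p_eq h.pz_eq] with y' hy'
      rw [hy'.2 z hz']
    rw [e1]
    have e2 : ∫ _ in Ioo 0 D.L, -(|M - C * D.L| * D.k 1) = -(|M - C * D.L| * D.k 1 * D.L) := by
      rw [setIntegral_const, Measure.real, Real.volume_Ioo, sub_zero, ENNReal.toReal_ofReal hL.le,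
        smul_eq_mul]
      ring
    rw [← e2]
    refine setIntegral_mono_on (integrableOn_const (by simp)) hI measurableSet_Ioo fun y' hy' => ?_
    have a1 := kExt_nonneg hk (slicePrim 0 D.s0 sz (y', z))
    have a2 := kExt_le hk (slicePrim 0 D.s0 sz (y', z))
    have a3 := mul_le_mul_of_nonneg_left (hosc y' hy') a1
    have a4 := mul_le_mul_of_nonneg_right a2 (abs_nonneg (M - C * D.L))
    linarith
  have hCk' : 0 < Ck - D.Finf := sub_pos.2 hCkF
  have hfin : (max 0 B + |M - C * D.L|) * D.k 1 * D.L < (Ck - D.Finf) * (z - z0) := by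
    have : (max 0 B + |M - C * D.L|) * D.k 1 * D.L / (Ck - D.Finf) < z - z0 := by
      unfold decayHeight at hz; linarith
    rw [div_lt_iff₀ hCk'] at this
    linarith
  nlinarith

/-- The normalization `p_c(s_*) = 0` makes `p_c` nonnegative on the admissible saturations, so a
nonpositive pressure drives no imbibition. This is the source of the free boundary. -/
lemma rate_eq_zero {κ sstar hi P σ : ℝ} {pc : ℝ → ℝ} (hpc : CapillaryAssumption pc sstar)
    (hss : sstar ∈ Ioo (0 : ℝ) 1) (hhi : hi < 1) (hσ : σ ∈ Icc sstar hi) (hP : P ≤ 0) :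
    rate κ pc P σ = 0 := by
  have : pc sstar ≤ pc σ := hpc.strictMonoOn.monotoneOn hss (Icc_sub_Ioo hss.1 hhi hσ) hσ.1
  rw [rate, max_eq_left, zero_div]
  rw [hpc.normalized] at this
  linarith

/-- The source term vanishes everywhere: the ramp is zero below `z1`, and the rate is zero above it
because the pressure is nonpositive there. The flux inequality becomes an equality. -/
lemma IsLipschitzSolution.flux_eq (hk : PermeabilityAssumption D.k)
    (hpc : CapillaryAssumption D.pc sstar) (hss : sstar ∈ Ioo (0 : ℝ) 1) (hhi : hi < 1)
    (h : IsLipschitzSolution D sstar hi C B H s sz p py pz pstar P) {z1 z2 : ℝ} (h1 : 0 ≤ z1)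
    (h12 : z1 < z2) (h2 : z2 ≤ H) (hP : ∀ y ∈ Ioo 0 D.L, ∀ z, z1 ≤ z → z < H → P (y, z) ≤ 0) :
    ∫ x in rect D.L z1 z2, kExt D.k (slicePrim 0 D.s0 sz x) * (dz P x + D.g) =
      (z2 - z1) * D.Finf := by
  have hH : 0 ≤ H := h1.trans (h12.le.trans h2)
  have hfl := h.sol.flux_eq hk h1 h12 h2
  have hzero : ∫ x in rect D.L 0 H, sz x * ramp z1 z2 x = 0 := by
    obtain ⟨Cr, hCr⟩ := lipschitzWith_ramp h12
    rw [setIntegral_rect (integrableOn_rect_mul h.sol.integrable_sz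
      (memLp_rect_of_continuous hCr.continuous _ _ _ _))]
    refine integral_eq_zero_of_ae ?_
    filter_upwards [h.imb, h.rate_eq, ae_restrict_mem measurableSet_Ioo] with y i1 i2 hy
    refine integral_eq_zero_of_ae ?_
    filter_upwards [i2, ae_restrict_mem measurableSet_Ioo] with z hz hzm
    rcases le_total z z1 with hle | hle
    · simp [ramp_of_le h12 (x := (y, z)) hle]
    · rw [hz, rate_eq_zero hpc hss hhi (i1.mem z (Ioo_subset_Icc_self hzm)) (hP y hy z hle hzm.2)]
      simp
  rw [hzero, mul_zero, sub_zero] at hfl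
  rw [← hfl]
  refine integral_congr_ae ?_
  have hsub := rect_mono (L := D.L) h1 h2
  filter_upwards [ae_restrict_of_ae_restrict_of_subset hsub (h.sol.s_ae_eq hH),
    ae_restrict_of_ae_restrict_of_subset hsub h.pz_eq] with x e1 e2
  rw [e1, e2]

lemma fderiv_eq_zero_of_gt {φ : ℝ × ℝ → ℝ} {R : ℝ} (h : ∀ x : ℝ × ℝ, R ≤ x.2 → φ x = 0) {x : ℝ × ℝ}
    (hx : R < x.2) : fderiv ℝ φ x = 0 := by
  have : φ =ᶠ[𝓝 x] fun _ => 0 := by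
    filter_upwards [(isOpen_lt continuous_const continuous_snd).mem_nhds hx] with x' hx'
    exact h x' (le_of_lt hx')
  rw [this.fderiv_eq]; simp

/-- Gauss-Green moves `∂_z s` onto the test function, so that only `s` itself, which converges
pointwise, has to be passed to the limit. The result also has the divergence form `∇ · (a ∇p + b
e_z) = 0` used for the interior estimate. As `φ` vanishes at the top, `F_∞` drops out. -/
lemma IsLipschitzSolution.weak_eq (hk : PermeabilityAssumption D.k)
    (h : IsLipschitzSolution D sstar hi C B H s sz p py pz pstar P) {R : ℝ} (hR : 0 < R)
    (hRH : R ≤ H) {φ : ℝ × ℝ → ℝ} {C' : NNReal} (hφ : LipschitzWith C' φ)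
    (h0 : ∀ y, φ (y, 0) = 0) (hφR : ∀ x : ℝ × ℝ, R ≤ x.2 → φ x = 0) :
    ∫ x in rect D.L 0 R, (kExt D.k (slicePrim 0 D.s0 sz x) * (dy P x * dy φ x + dz P x * dz φ x) +
      (D.g * kExt D.k (slicePrim 0 D.s0 sz x) - D.c * slicePrim 0 D.s0 sz x) * dz φ x) = 0 := by
  have hH : 0 < H := hR.trans_le hRH
  have hw := h.sol.weak φ (dy φ) (dz φ) 0
    (isH1Sharp_of_lipschitz hH.le hφ h0 fun y _ => hφR (y, H) hRH)
  have hgg := gauss_green hH.le h.sol.integrable_s0 h.sol.integrable_sz hφ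
  have hb0 : ∫ y in Ioo 0 D.L, slicePrim 0 D.s0 sz (y, H) * φ (y, H) = 0 := by
    simp [hφR (_, H) hRH]
  have hb1 : ∫ y in Ioo 0 D.L, D.s0 y * φ (y, 0) = 0 := by simp [h0]
  rw [hb0, hb1, sub_zero] at hgg
  set S := slicePrim 0 D.s0 sz with hS
  have hSi : IntegrableOn S (rect D.L 0 H) :=
    integrableOn_slicePrim hH.le h.sol.integrable_s0 h.sol.integrable_sz
  have i1 : IntegrableOn (fun x => S x * dz φ x + sz x * φ x) (rect D.L 0 H) :=
    (integrableOn_rect_mul hSi (memLp_top_dz hφ _)).add (integrableOn_rect_mul h.sol.integrable_sz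
      (memLp_rect_of_continuous hφ.continuous _ _ _ _))
  have hdy : IntegrableOn (dy P) (rect D.L 0 H) := (isH1_of_lipschitz h.lip D.L 0 H).mem_y.integrable one_le_two
  have hdz : IntegrableOn (dz P) (rect D.L 0 H) := (isH1_of_lipschitz h.lip D.L 0 H).mem_z.integrable one_le_two
  have i2 : IntegrableOn (fun x => D.c * sz x * φ x + kExt D.k (S x) * (dy P x * dy φ x +
      (dz P x + D.g) * dz φ x)) (rect D.L 0 H) := by
    refine (integrableOn_rect_mul (h.sol.integrable_sz.const_mul D.c)
      (memLp_rect_of_continuous hφ.continuous _ _ _ _)).add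
      (integrableOn_kExt_mul hk hSi.aestronglyMeasurable ?_)
    refine (integrableOn_rect_mul hdy (memLp_top_dy hφ _)).add
      (integrableOn_rect_mul (hdz.add ?_) (memLp_top_dz hφ _))
    exact (memLp_rect_of_continuous continuous_const D.L 0 H 1).integrable le_rfl
  have hw2 : ∫ x in rect D.L 0 H, (D.c * sz x * φ x + kExt D.k (S x) * (dy P x * dy φ x +
      (dz P x + D.g) * dz φ x)) = 0 := by
    rw [mul_zero] at hw
    refine Eq.trans (integral_congr_ae ?_) hw
    filter_upwards [h.sol.s_ae_eq hH.le, h.py_eq, h.pz_eq, h.sol.kExt_ae_eq] with x e1 e2 e3 e4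
    rw [hS, ← e1, e2, e3, e4]
  have hw3 : ∫ x in rect D.L 0 H, (kExt D.k (S x) * (dy P x * dy φ x + dz P x * dz φ x) +
      (D.g * kExt D.k (S x) - D.c * S x) * dz φ x) = 0 := by
    have := integral_sub i2 (i1.const_mul D.c)
    rw [hw2, integral_const_mul, hgg, mul_zero, sub_zero] at this
    refine Eq.trans ?_ this
    congr 1 with x
    ring
  refine Eq.trans (Eq.symm ?_) hw3
  refine setIntegral_eq_of_subset_of_ae_sdiff_eq_zero (measurableSet_rect _ _ _).nullMeasurableSet
    (rect_mono le_rfl hRH) ?_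
  filter_upwards [ae_snd_ne R] with x hx hxm
  have hx2 : R < x.2 := by
    refine lt_of_le_of_ne ?_ hx.symm
    by_contra! hlt
    exact hxm.2 ⟨hxm.1.1, hxm.1.2.1, hlt⟩
  simp [dy, dz, fderiv_eq_zero_of_gt hφR hx2]

end Fingering

namespace Fingering

/-! ### The limit saturation -/

variable {D : TWData} {sstar hi B : ℝ} {C : NNReal} {P S : ℝ × ℝ → ℝ}

/-- `S` is the saturation in the half-infinite strip that belongs to the Lipschitz pressure
`P ≤ B`: every vertical slice solves the imbibition equation. -/
structure IsImbibitionField (D : TWData) (sstar hi : ℝ) (C : NNReal) (B : ℝ) (P S : ℝ × ℝ → ℝ) :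
    Prop where
  lip : LipschitzWith C P
  bottom : ∀ y ∈ Ioo 0 D.L, P (y, 0) = D.p0 y
  bound : ∀ y ∈ Ioo 0 D.L, ∀ z, 0 ≤ z → P (y, z) ≤ B
  imb : ∀ y ∈ Ioo 0 D.L, ∀ R, IsImbibition (D.c * D.τ) D.pc (fun z => P (y, z)) sstar hi R
    (D.s0 y) (fun z => S (y, z))

lemma exists_mem_of_ae_restrict_Ioo {L : ℝ} {q : ℝ → Prop}
    (h : ∀ᵐ y ∂volume.restrict (Ioo 0 L), q y) {y ε : ℝ} (hy : y ∈ Ioo 0 L) (hε : 0 < ε) :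
    ∃ y' ∈ Ioo 0 L, |y' - y| < ε ∧ q y' := by
  have hlt : max 0 (y - ε) < min L (y + ε) :=
    max_lt (lt_min (hy.1.trans hy.2) (by linarith [hy.1])) (lt_min (by linarith [hy.2]) (by linarith))
  have hsub : Ioo (max 0 (y - ε)) (min L (y + ε)) ⊆ Ioo 0 L :=
    Ioo_subset_Ioo (le_max_left _ _) (min_le_left _ _)
  have hne : NeBot (ae ((volume : Measure ℝ).restrict (Ioo (max 0 (y - ε)) (min L (y + ε))))) := by
    rw [ae_neBot]
    simp only [ne_eq, Measure.restrict_eq_zero, Real.volume_Ioo, ENNReal.ofReal_eq_zero, not_le,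
      sub_pos]
    exact hlt
  obtain ⟨y', h1, h2⟩ := ((ae_restrict_of_ae_restrict_of_subset hsub h).and
    (ae_restrict_mem measurableSet_Ioo)).exists
  refine ⟨y', hsub h2, ?_, h1⟩
  rw [abs_lt]
  constructor
  · linarith [le_max_right 0 (y - ε), h2.1]
  · linarith [min_le_right L (y + ε), h2.2]

lemma dist_slice_le (y y' z : ℝ) : dist (y, z) (y', z) ≤ |y - y'| := by
  rw [Prod.dist_eq, dist_self, max_eq_left dist_nonneg, Real.dist_eq]

lemma abs_sub_slice_le {f : ℝ × ℝ → ℝ} (hf : LipschitzWith C f) (y y' z : ℝ) :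
    |f (y, z) - f (y', z)| ≤ C * |y - y'| := by
  have := hf.dist_le_mul (y, z) (y', z)
  rw [Real.dist_eq] at this
  exact this.trans (mul_le_mul_of_nonneg_left (dist_slice_le y y' z) C.2)

lemma abs_sub_base_le {f : ℝ × ℝ → ℝ} (hf : LipschitzWith C f) (y : ℝ) {z R : ℝ} (hz : z ∈ Icc 0 R) :
    |f (y, z) - f (y, 0)| ≤ C * R := by
  have := hf.dist_le_mul (y, z) (y, 0)
  rw [Real.dist_eq, Prod.dist_eq, dist_self, max_eq_right dist_nonneg, Real.dist_eq, sub_zero,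
    abs_of_nonneg hz.1] at this
  exact this.trans (mul_le_mul_of_nonneg_left hz.2 C.2)

section Limit

variable {H : ℕ → ℝ} {s sz p py pz Pn : ℕ → ℝ × ℝ → ℝ} {pstar : ℕ → ℝ}

/-- The slices of the approximations solve the imbibition equation only for almost every abscissa. A
given `y` is approached by good abscissae `Y j` of the `j`-th solution; continuity of `s0` and the
common Lipschitz constant let the stability result apply. The limit equation thus holds for every
`y`. -/
lemma exists_imbibitionField (hc : 0 < D.c) (hτ : 0 < D.τ) (hss : sstar ∈ Ioo (0 : ℝ) 1)
    (hhi : hi < 1) (hpc : CapillaryAssumption D.pc sstar) (hs0 : ContinuousOn D.s0 (Ioo 0 D.L))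
    (hH : Tendsto H atTop atTop)
    (h : ∀ n, IsLipschitzSolution D sstar hi C B (H n) (s n) (sz n) (p n) (py n) (pz n) (pstar n)
      (Pn n)) (hP : LipschitzWith C P) (hlim : ∀ x, Tendsto (fun n => Pn n x) atTop (𝓝 (P x))) :
    ∃ S, IsImbibitionField D sstar hi C B P S := by
  have hκ : 0 < D.c * D.τ := mul_pos hc hτ
  have hbot : ∀ y ∈ Ioo 0 D.L, P (y, 0) = D.p0 y := fun y hy =>
    tendsto_nhds_unique (hlim (y, 0)) (by simp [(h _).bottom y hy])
  have hbd : ∀ y ∈ Ioo 0 D.L, ∀ z, 0 ≤ z → P (y, z) ≤ B := fun y hy z hz =>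
    le_of_tendsto (hlim (y, z)) (by
      filter_upwards [hH.eventually_ge_atTop z] with n hn
      exact (h n).bound y hy z ⟨hz, hn⟩)
  have key : ∀ y ∈ Ioo 0 D.L, ∃ σ, ∀ R, IsImbibition (D.c * D.τ) D.pc (fun z => P (y, z)) sstar hi R
      (D.s0 y) σ := by
    intro y hy
    have hch : ∀ j : ℕ, ∃ y' ∈ Ioo 0 D.L, |y' - y| < 1 / ((j : ℝ) + 1) ∧
        IsImbibition (D.c * D.τ) D.pc (fun z => Pn j (y', z)) sstar hi (H j) (D.s0 y')
          (fun z => slicePrim 0 D.s0 (sz j) (y', z)) := fun j =>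
      exists_mem_of_ae_restrict_Ioo (h j).imb hy (by positivity)
    choose Y hYm hYd hYi using hch
    have hYlim : Tendsto Y atTop (𝓝 y) := by
      rw [tendsto_iff_dist_tendsto_zero]
      exact squeeze_zero (fun _ => dist_nonneg) (fun j => by rw [Real.dist_eq]; exact (hYd j).le)
        tendsto_one_div_add_atTop_nhds_zero_nat
    refine exists_imbibition_of_tendsto hpc hκ hss.1 hhi (by have := hP.continuous; fun_prop)
      (fun n => by have := (h n).lip.continuous; fun_prop) (fun z => ?_)
      (((hs0 y hy).continuousAt (Ioo_mem_nhds hy.1 hy.2)).tendsto.comp hYlim) hH (fun R => ?_) hYi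
    · have h1 : Tendsto (fun n => Pn n (Y n, z) - Pn n (y, z)) atTop (𝓝 0) := by
        refine squeeze_zero_norm (fun n => abs_sub_slice_le (h n).lip (Y n) y z) ?_
        have := (tendsto_iff_norm_sub_tendsto_zero.1 hYlim).const_mul (C : ℝ)
        simpa using this
      simpa using h1.add (hlim (y, z))
    -- The three summands bound the bottom value at `y`, the horizontal step of length at most `1`
    -- to `Y n`, and the vertical step up to height `R`.
    · refine ⟨|D.p0 y| + C * 1 + C * R, fun n z hz => ?_⟩
      have e1 := abs_sub_base_le (h n).lip (Y n) hz
      have e2 := abs_sub_slice_le (h n).lip (Y n) y 0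
      rw [(h n).bottom y hy] at e2
      have e3 : |Y n - y| ≤ 1 := (hYd n).le.trans (by
        rw [div_le_one (by positivity)]; linarith [n.cast_nonneg (α := ℝ)])
      have e4 := e2.trans (mul_le_mul_of_nonneg_left e3 C.2)
      have e5 : Pn n (Y n, z) = (Pn n (Y n, z) - Pn n (Y n, 0)) + ((Pn n (Y n, 0) - D.p0 y) + D.p0 y) := by
        ring
      rw [e5]
      refine (abs_add_le _ _).trans ((add_le_add e1 ((abs_add_le _ _).trans
        (add_le_add_left e4 _))).trans (le_of_eq ?_))
      ring
  choose! σ hσ using key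
  exact ⟨fun x => σ x.1 x.2, hP, hbot, hbd, hσ⟩

/-- Almost every abscissa is good for all `n` at once. There both slices start from the same `s0 y`,
and stability leaves only the integral of `|Pn n - P|`, which tends to zero by dominated
convergence. -/
lemma IsImbibitionField.tendsto_slices (hc : 0 < D.c) (hτ : 0 < D.τ) (hss : sstar ∈ Ioo (0 : ℝ) 1)
    (hhi : hi < 1) (hpc : CapillaryAssumption D.pc sstar)
    (hH : Tendsto H atTop atTop)
    (h : ∀ n, IsLipschitzSolution D sstar hi C B (H n) (s n) (sz n) (p n) (py n) (pz n) (pstar n)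
      (Pn n)) (hlim : ∀ x, Tendsto (fun n => Pn n x) atTop (𝓝 (P x)))
    (hS : IsImbibitionField D sstar hi C B P S) :
    ∀ᵐ y ∂volume.restrict (Ioo 0 D.L), ∀ z, 0 ≤ z →
      Tendsto (fun n => slicePrim 0 D.s0 (sz n) (y, z)) atTop (𝓝 (S (y, z))) := by
  have hκ : 0 < D.c * D.τ := mul_pos hc hτ
  filter_upwards [ae_all_iff.2 fun n => (h n).imb, ae_restrict_mem measurableSet_Ioo] with y hy hym
  intro z hz
  have hint : Tendsto (fun n => ∫ ζ in 0..z, |Pn n (y, ζ) - P (y, ζ)| / (D.c * D.τ)) atTop (𝓝 0) := by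
    suffices h0 : Tendsto (fun n => ∫ ζ in 0..z, |Pn n (y, ζ) - P (y, ζ)| / (D.c * D.τ)) atTop
        (𝓝 (∫ _ in 0..z, (0 : ℝ))) by simpa using h0
    refine intervalIntegral.tendsto_integral_filter_of_dominated_convergence
      (fun _ => (C * z + C * z) / (D.c * D.τ)) (Eventually.of_forall fun n => ?_)
      (Eventually.of_forall fun n => Eventually.of_forall fun ζ hζ => ?_) intervalIntegrable_const
      (Eventually.of_forall fun ζ _ => ?_)
    · have := (h n).lip.continuous
      have := hS.lip.continuous
      exact Continuous.aestronglyMeasurable (by fun_prop)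
    · rw [uIoc_of_le hz] at hζ
      have hζ' : ζ ∈ Icc 0 z := Ioc_subset_Icc_self hζ
      have e1 := abs_sub_base_le (h n).lip y hζ'
      have e2 := abs_sub_base_le hS.lip y hζ'
      rw [(h n).bottom y hym] at e1
      rw [hS.bottom y hym, abs_sub_comm] at e2
      rw [Real.norm_eq_abs, abs_div, abs_abs, abs_of_pos hκ]
      gcongr
      calc |Pn n (y, ζ) - P (y, ζ)| = |(Pn n (y, ζ) - D.p0 y) + (D.p0 y - P (y, ζ))| := by ring_nf
        _ ≤ _ := (abs_add_le _ _).trans (add_le_add e1 e2)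
    · have := ((hlim (y, ζ)).sub_const (P (y, ζ))).abs.div_const (D.c * D.τ)
      simpa using this
  rw [tendsto_iff_norm_sub_tendsto_zero]
  refine squeeze_zero' (Eventually.of_forall fun _ => norm_nonneg _) ?_ hint
  filter_upwards [hH.eventually_ge_atTop z] with n hn
  have hz' : z ∈ Icc 0 z := ⟨hz, le_rfl⟩
  have i1 : IsImbibition (D.c * D.τ) D.pc (fun z => Pn n (y, z)) sstar hi z
      (D.s0 y) (fun z => slicePrim 0 D.s0 (sz n) (y, z)) :=
    ⟨(hy n).cont.mono (Icc_subset_Icc le_rfl hn), fun ζ hζ => (hy n).mem ζ ⟨hζ.1, hζ.2.trans hn⟩,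
      fun ζ hζ => (hy n).eq ζ ⟨hζ.1, hζ.2.trans hn⟩⟩
  have cn := (h n).lip.continuous
  have cP := hS.lip.continuous
  have := i1.abs_sub_le hpc hκ hss.1 hhi (by fun_prop) (by fun_prop) (hS.imb y hym z) hz'
  simpa using this

end Limit

end Fingering

namespace Fingering

/-! ### Regularity of the limit saturation -/

variable {D : TWData} {sstar hi B : ℝ} {C : NNReal} {P S : ℝ × ℝ → ℝ}

/-- The right-hand side `∂_z s` of the imbibition equation. -/
noncomputable def satRate (D : TWData) (P S : ℝ × ℝ → ℝ) (x : ℝ × ℝ) : ℝ :=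
  rate (D.c * D.τ) D.pc (P x) (S x)

lemma exists_box_of_subset_strip {L : ℝ} {K : Set (ℝ × ℝ)} (hK : IsCompact K) (h : K ⊆ strip L) :
    ∃ α β R, 0 < α ∧ β < L ∧ 0 < R ∧ ∀ x ∈ K, x.1 ∈ Icc α β ∧ x.2 < R := by
  rcases K.eq_empty_or_nonempty with rfl | hne
  · exact ⟨1, L - 1, 1, one_pos, by linarith, one_pos, by simp⟩
  obtain ⟨a, ha, ha'⟩ := hK.exists_isMinOn hne continuous_fst.continuousOn
  obtain ⟨b, hb, hb'⟩ := hK.exists_isMaxOn hne continuous_fst.continuousOn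
  obtain ⟨r, hr, hr'⟩ := hK.exists_isMaxOn hne continuous_snd.continuousOn
  have hr0 : 0 < r.2 := (h hr).2
  exact ⟨a.1, b.1, r.2 + 1, (h ha).1.1, (h hb).1.2, by positivity, fun x hx =>
    ⟨⟨ha' hx, hb' hx⟩, (hr' hx : x.2 ≤ r.2).trans_lt (lt_add_one _)⟩⟩

lemma exists_height {φ : ℝ × ℝ → ℝ} (hφ : HasCompactSupport φ) :
    ∃ R, 0 < R ∧ ∀ x ∈ tsupport φ, x.2 < R := by
  obtain ⟨M, hM⟩ := (hφ.isCompact.image continuous_snd).bddAbove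
  exact ⟨max M 0 + 1, by positivity, fun x hx =>
    ((hM ⟨x, hx, rfl⟩).trans (le_max_left _ _)).trans_lt (lt_add_one _)⟩

lemma rect_subset_strip {L R : ℝ} : rect L 0 R ⊆ strip L := fun _ hx => ⟨hx.1, hx.2.1⟩

namespace IsImbibitionField

lemma mem (h : IsImbibitionField D sstar hi C B P S) {y z : ℝ} (hy : y ∈ Ioo 0 D.L) (hz : 0 ≤ z) :
    S (y, z) ∈ Icc sstar hi := (h.imb y hy z).mem z ⟨hz, le_rfl⟩

lemma eq_slicePrim (h : IsImbibitionField D sstar hi C B P S) {y z : ℝ} (hy : y ∈ Ioo 0 D.L)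
    (hz : 0 ≤ z) : S (y, z) = slicePrim 0 D.s0 (satRate D P S) (y, z) :=
  (h.imb y hy z).eq z ⟨hz, le_rfl⟩

lemma continuous_slice (h : IsImbibitionField D sstar hi C B P S) (y R : ℝ) :
    ContinuousOn (fun z => P (y, z)) (Icc 0 R) := by
  have := h.lip.continuous
  fun_prop

/-- Horizontally, stability compares two slices whose pressures differ by at most `C |y - y'|`;
vertically, the rate is bounded because `P ≤ B` and the saturation is at least `s_*`. -/
lemma abs_sub_le (h : IsImbibitionField D sstar hi C B P S) (hκ : 0 < D.c * D.τ) (hss : 0 < sstar)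
    (hhi : hi < 1) (hpc : CapillaryAssumption D.pc sstar) {y y' z z' R : ℝ} (hy : y ∈ Ioo 0 D.L)
    (hy' : y' ∈ Ioo 0 D.L) (hz : z ∈ Icc 0 R) (hz' : z' ∈ Icc 0 R) :
    |S (y, z) - S (y', z')| ≤ |D.s0 y - D.s0 y'| + R * (C / (D.c * D.τ)) * |y - y'| +
      max 0 (B - D.pc sstar) / (D.c * D.τ) * |z - z'| := by
  have h1 := (h.imb y hy R).abs_sub_le hpc hκ hss hhi (h.continuous_slice y R)
    (h.continuous_slice y' R) (h.imb y' hy' R) hz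
  have h2 := (h.imb y' hy' R).abs_sub_le_mul hpc hκ hss hhi (h.continuous_slice y' R)
    (fun ζ hζ => h.bound y' hy' ζ hζ.1) hz' hz
  have h3 : ∫ ζ in 0..z, |P (y, ζ) - P (y', ζ)| / (D.c * D.τ) ≤
      R * (C / (D.c * D.τ)) * |y - y'| := by
    have cP := h.lip.continuous
    have e1 : ∫ ζ in 0..z, |P (y, ζ) - P (y', ζ)| / (D.c * D.τ) ≤
        ∫ _ in 0..z, C * |y - y'| / (D.c * D.τ) := by
      refine intervalIntegral.integral_mono_on hz.1 (Continuous.intervalIntegrable (by fun_prop) _ _)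
        intervalIntegrable_const fun ζ _ => ?_
      gcongr
      exact abs_sub_slice_le h.lip y y' ζ
    refine e1.trans ?_
    rw [intervalIntegral.integral_const, smul_eq_mul, sub_zero]
    calc z * (C * |y - y'| / (D.c * D.τ)) ≤ R * (C * |y - y'| / (D.c * D.τ)) := by
          gcongr; exact hz.2
      _ = _ := by ring
  calc |S (y, z) - S (y', z')| = |(S (y, z) - S (y', z)) + (S (y', z) - S (y', z'))| := by ring_nf
    _ ≤ |S (y, z) - S (y', z)| + |S (y', z) - S (y', z')| := abs_add_le _ _
    _ ≤ _ := add_le_add (h1.trans (by gcongr)) h2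

/-- Lipschitz continuity is only local because `s0` is `C¹` on the open interval, with no control
near the lateral sides. -/
lemma exists_lipschitzOnWith (h : IsImbibitionField D sstar hi C B P S) (hκ : 0 < D.c * D.τ)
    (hss : 0 < sstar) (hhi : hi < 1) (hpc : CapillaryAssumption D.pc sstar)
    (hs0 : ContDiffOn ℝ 1 D.s0 (Ioo 0 D.L)) {K : Set (ℝ × ℝ)} (hK : IsCompact K)
    (hKs : K ⊆ strip D.L) : ∃ C', LipschitzOnWith C' S K := by
  obtain ⟨α, β, R, hα, hβ, hR, hbox⟩ := exists_box_of_subset_strip hK hKs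
  have hsub : Icc α β ⊆ Ioo 0 D.L := fun x hx => ⟨hα.trans_le hx.1, hx.2.trans_lt hβ⟩
  obtain ⟨C0, hC0⟩ := (hs0.mono hsub).exists_lipschitzOnWith one_ne_zero (convex_Icc α β)
    isCompact_Icc
  refine ⟨_, LipschitzOnWith.of_dist_le' (K := C0 + R * (C / (D.c * D.τ)) +
    max 0 (B - D.pc sstar) / (D.c * D.τ)) fun x hx x' hx' => ?_⟩
  have h1 := h.abs_sub_le hκ hss hhi hpc (hKs hx).1 (hKs hx').1
    ⟨(hKs hx).2.le, (hbox x hx).2.le⟩ ⟨(hKs hx').2.le, (hbox x' hx').2.le⟩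
  have h2 := hC0.dist_le_mul _ (hbox x hx).1 _ (hbox x' hx').1
  rw [Real.dist_eq, Real.dist_eq] at h2
  have d1 : |x.1 - x'.1| ≤ dist x x' := by
    rw [Prod.dist_eq, ← Real.dist_eq]; exact le_max_left _ _
  have d2 : |x.2 - x'.2| ≤ dist x x' := by
    rw [Prod.dist_eq, ← Real.dist_eq]; exact le_max_right _ _
  rw [Real.dist_eq]
  refine h1.trans ?_
  rw [add_mul, add_mul]
  gcongr
  exact h2.trans (by gcongr)

lemma continuousOn (h : IsImbibitionField D sstar hi C B P S) (hκ : 0 < D.c * D.τ)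
    (hss : 0 < sstar) (hhi : hi < 1) (hpc : CapillaryAssumption D.pc sstar)
    (hs0 : ContDiffOn ℝ 1 D.s0 (Ioo 0 D.L)) : ContinuousOn S (strip D.L) := by
  intro x hx
  obtain ⟨K, hK, hxK, hKs⟩ := exists_compact_subset (isOpen_strip D.L) hx
  obtain ⟨C', hC'⟩ := h.exists_lipschitzOnWith hκ hss hhi hpc hs0 hK hKs
  exact (hC'.continuousOn.continuousAt (mem_interior_iff_mem_nhds.1 hxK)).continuousWithinAt

lemma range (h : IsImbibitionField D sstar hi C B P S) (hss : 0 < sstar) (hhi : hi < 1) :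
    ∀ x ∈ strip D.L, S x ∈ Ioo (0 : ℝ) 1 := fun _ hx =>
  Icc_sub_Ioo hss hhi (h.mem hx.1 (le_of_lt hx.2))

lemma aestronglyMeasurable_satRate (h : IsImbibitionField D sstar hi C B P S) (hκ : 0 < D.c * D.τ)
    (hss : 0 < sstar) (hhi : hi < 1) (hpc : CapillaryAssumption D.pc sstar)
    (hs0 : ContDiffOn ℝ 1 D.s0 (Ioo 0 D.L)) :
    AEStronglyMeasurable (satRate D P S) (volume.restrict (strip D.L)) :=
  (continuousOn_rate hpc h.lip.continuous.continuousOn (h.continuousOn hκ hss hhi hpc hs0)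
    (h.range hss hhi)).aestronglyMeasurable (isOpen_strip _).measurableSet

lemma abs_satRate_le (h : IsImbibitionField D sstar hi C B P S) (hκ : 0 < D.c * D.τ)
    (hss : 0 < sstar) (hhi : hi < 1) (hpc : CapillaryAssumption D.pc sstar) :
    ∀ x ∈ strip D.L, |satRate D P S x| ≤ max 0 (B - D.pc sstar) / (D.c * D.τ) := fun x hx => by
  rw [satRate, abs_of_nonneg (rate_nonneg hκ _ _)]
  exact rate_le hpc hκ hss hhi (h.mem hx.1 (le_of_lt hx.2)) (h.bound x.1 hx.1 x.2 (le_of_lt hx.2))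

lemma integrableOn_satRate (h : IsImbibitionField D sstar hi C B P S) (hκ : 0 < D.c * D.τ)
    (hss : 0 < sstar) (hhi : hi < 1) (hpc : CapillaryAssumption D.pc sstar)
    (hs0 : ContDiffOn ℝ 1 D.s0 (Ioo 0 D.L)) (R : ℝ) :
    IntegrableOn (satRate D P S) (rect D.L 0 R) := by
  have : IsFiniteMeasure ((volume : Measure (ℝ × ℝ)).restrict (rect D.L 0 R)) := inferInstance
  refine Integrable.of_bound ((h.aestronglyMeasurable_satRate hκ hss hhi hpc hs0).mono_measure
    (Measure.restrict_mono rect_subset_strip le_rfl)) (max 0 (B - D.pc sstar) / (D.c * D.τ)) ?_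
  filter_upwards [ae_restrict_mem (measurableSet_rect _ _ _)] with x hx
  exact h.abs_satRate_le hκ hss hhi hpc x (rect_subset_strip hx)

lemma ae_eq_slicePrim (h : IsImbibitionField D sstar hi C B P S) (R : ℝ) :
    slicePrim 0 D.s0 (satRate D P S) =ᵐ[volume.restrict (rect D.L 0 R)] S := by
  filter_upwards [ae_restrict_mem (measurableSet_rect _ _ _)] with x hx
  exact (h.eq_slicePrim hx.1 hx.2.1.le).symm

lemma satRate_eq_zero (h : IsImbibitionField D sstar hi C B P S)
    (hss : sstar ∈ Ioo (0 : ℝ) 1) (hhi : hi < 1) (hpc : CapillaryAssumption D.pc sstar) {z1 : ℝ}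
    (hP : ∀ y ∈ Ioo 0 D.L, ∀ z, z1 ≤ z → P (y, z) ≤ 0) {x : ℝ × ℝ} (hx : x ∈ strip D.L)
    (hz : z1 ≤ x.2) : satRate D P S x = 0 :=
  rate_eq_zero hpc hss hhi (h.mem hx.1 (le_of_lt hx.2)) (hP x.1 hx.1 x.2 hz)

/-- The rate is bounded, and it vanishes above height `z1`, so it is effectively supported in a
bounded rectangle. -/
lemma memLp_satRate (h : IsImbibitionField D sstar hi C B P S) (hκ : 0 < D.c * D.τ)
    (hss : sstar ∈ Ioo (0 : ℝ) 1) (hhi : hi < 1) (hpc : CapillaryAssumption D.pc sstar)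
    (hs0 : ContDiffOn ℝ 1 D.s0 (Ioo 0 D.L)) {z1 : ℝ}
    (hP : ∀ y ∈ Ioo 0 D.L, ∀ z, z1 ≤ z → P (y, z) ≤ 0) :
    InL2 (strip D.L) (satRate D P S) := by
  have h1 : MemLp (satRate D P S) 2 (volume.restrict (rect D.L 0 z1)) := by
    refine MemLp.of_bound ((h.aestronglyMeasurable_satRate hκ hss.1 hhi hpc hs0).mono_measure
      (Measure.restrict_mono rect_subset_strip le_rfl)) (max 0 (B - D.pc sstar) / (D.c * D.τ)) ?_
    filter_upwards [ae_restrict_mem (measurableSet_rect _ _ _)] with x hx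
    exact h.abs_satRate_le hκ hss.1 hhi hpc x (rect_subset_strip hx)
  rw [← memLp_indicator_iff_restrict (measurableSet_rect _ _ _)] at h1
  refine (h1.restrict (strip D.L)).ae_eq ?_
  filter_upwards [ae_restrict_mem (isOpen_strip D.L).measurableSet] with x hx
  by_cases hxr : x ∈ rect D.L 0 z1
  · rw [indicator_of_mem hxr]
  · rw [indicator_of_notMem hxr, h.satRate_eq_zero hss hhi hpc hP hx]
    by_contra! hlt
    exact hxr ⟨hx.1, hx.2, hlt⟩

lemma isWeakDz (h : IsImbibitionField D sstar hi C B P S) (hκ : 0 < D.c * D.τ)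
    (hss : 0 < sstar) (hhi : hi < 1) (hpc : CapillaryAssumption D.pc sstar)
    (hs0 : ContDiffOn ℝ 1 D.s0 (Ioo 0 D.L)) (hs0i : IntegrableOn D.s0 (Ioo 0 D.L)) :
    IsWeakDz (strip D.L) S (satRate D P S) := by
  have hSc := h.continuousOn hκ hss hhi hpc hs0
  refine ⟨hSc.locallyIntegrableOn (isOpen_strip _).measurableSet,
    ContinuousOn.locallyIntegrableOn (continuousOn_rate hpc h.lip.continuous.continuousOn hSc
      (h.range hss hhi)) (isOpen_strip _).measurableSet, fun φ hφ => ?_⟩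
  obtain ⟨R, hR, hsupp⟩ := exists_height hφ.compact
  have hφR : IsTestOn (rect D.L 0 R) φ := ⟨hφ.smooth, hφ.compact, fun x hx =>
    ⟨(hφ.supp hx).1, (hφ.supp hx).2, hsupp x hx⟩⟩
  have hw := (IsWeakD.congr (e := (0, 1)) (isWeakDz_slicePrim hR.le hs0i
    (h.integrableOn_satRate hκ hss hhi hpc hs0 R)) (h.ae_eq_slicePrim R) ae_eq_rfl).2.2 φ hφR
  rw [hφR.setIntegral_mul, hφR.setIntegral_mul_fderiv] at hw
  rw [hφ.setIntegral_mul]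
  exact (hφ.setIntegral_mul_fderiv S (0, 1)).trans hw

lemma isBottomTrace (h : IsImbibitionField D sstar hi C B P S) (hκ : 0 < D.c * D.τ)
    (hss : 0 < sstar) (hhi : hi < 1) (hpc : CapillaryAssumption D.pc sstar)
    (hs0 : ContDiffOn ℝ 1 D.s0 (Ioo 0 D.L)) (hs0i : MemLp D.s0 2 (volume.restrict (Ioo 0 D.L)))
    {R : ℝ} (hR : 0 < R) : IsBottomTrace D.L 0 R S (satRate D P S) D.s0 :=
  (isBottomTrace_slicePrim hR.le hs0i (h.integrableOn_satRate hκ hss hhi hpc hs0 R)).congr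
    (h.ae_eq_slicePrim R) ae_eq_rfl

lemma isBottomTrace_pressure (h : IsImbibitionField D sstar hi C B P S) {R : ℝ} (hR : 0 < R) :
    IsBottomTrace D.L 0 R P (dz P) D.p0 := by
  have h1 := isBottomTrace_lipschitz (L := D.L) hR.le h.lip
  have h2 : (fun y => P (y, 0)) =ᵐ[volume.restrict (Ioo 0 D.L)] D.p0 := by
    filter_upwards [ae_restrict_mem measurableSet_Ioo] with y hy using h.bottom y hy
  refine ⟨h1.1.ae_eq h2, fun φ hφ => (h1.2 φ hφ).trans ?_⟩
  congr 1
  refine integral_congr_ae ?_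
  filter_upwards [h2] with y hy
  rw [hy]

lemma monotone_slice (h : IsImbibitionField D sstar hi C B P S) (hκ : 0 < D.c * D.τ)
    (hss : 0 < sstar) (hhi : hi < 1) (hpc : CapillaryAssumption D.pc sstar) {y z z' : ℝ}
    (hy : y ∈ Ioo 0 D.L) (hz : 0 ≤ z) (hzz : z ≤ z') : S (y, z) ≤ S (y, z') := by
  have := (h.imb y hy z').sub_eq hpc hss hhi (h.continuous_slice y z') ⟨hz, hzz⟩ ⟨hz.trans hzz, le_rfl⟩
  have h2 : 0 ≤ ∫ ζ in z..z', rate (D.c * D.τ) D.pc (P (y, ζ)) (S (y, ζ)) :=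
    intervalIntegral.integral_nonneg hzz fun _ _ => rate_nonneg hκ _ _
  linarith

/-- The saturation is frozen above `z1`, so `s^*` is the slice at height `z1`. -/
lemma eq_of_ge (h : IsImbibitionField D sstar hi C B P S)
    (hss : sstar ∈ Ioo (0 : ℝ) 1) (hhi : hi < 1) (hpc : CapillaryAssumption D.pc sstar) {z1 : ℝ}
    (hz1 : 0 < z1) (hP : ∀ y ∈ Ioo 0 D.L, ∀ z, z1 ≤ z → P (y, z) ≤ 0) {y z : ℝ}
    (hy : y ∈ Ioo 0 D.L) (hz : z1 ≤ z) : S (y, z) = S (y, z1) := by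
  have := (h.imb y hy z).sub_eq hpc hss.1 hhi (h.continuous_slice y z) ⟨hz1.le, hz⟩
    ⟨hz1.le.trans hz, le_rfl⟩
  have h2 : ∫ ζ in z1..z, rate (D.c * D.τ) D.pc (P (y, ζ)) (S (y, ζ)) = 0 := by
    rw [← intervalIntegral.integral_zero (μ := volume) (a := z1) (b := z)]
    refine intervalIntegral.integral_congr fun ζ hζ => ?_
    rw [uIcc_of_le hz] at hζ
    exact h.satRate_eq_zero hss hhi hpc hP (x := (y, ζ)) ⟨hy, hz1.trans_le hζ.1⟩ hζ.1
  linarith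

end IsImbibitionField

end Fingering

namespace Fingering

/-! ### Passage to the limit in the equations -/

variable {D : TWData} {sstar hi B : ℝ} {C : NNReal} {P S : ℝ × ℝ → ℝ}

lemma ae_rect_of_ae {L a b : ℝ} {q : ℝ → Prop} (h : ∀ᵐ y ∂volume.restrict (Ioo 0 L), q y) :
    ∀ᵐ x ∂volume.restrict (rect L a b), q x.1 := by
  rw [volume_restrict_rect]
  exact Measure.quasiMeasurePreserving_fst.ae h

lemma tendsto_setIntegral_mul_of_bounded {U : Set (ℝ × ℝ)} {f : ℕ → ℝ × ℝ → ℝ} {f0 ψ : ℝ × ℝ → ℝ}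
    {M : ℝ} (hf : ∀ᶠ n in atTop, AEStronglyMeasurable (f n) (volume.restrict U))
    (hM : ∀ᶠ n in atTop, ∀ᵐ x ∂volume.restrict U, |f n x| ≤ M)
    (hlim : ∀ᵐ x ∂volume.restrict U, Tendsto (fun n => f n x) atTop (𝓝 (f0 x)))
    (hψ : IntegrableOn ψ U) :
    Tendsto (fun n => ∫ x in U, f n x * ψ x) atTop (𝓝 (∫ x in U, f0 x * ψ x)) := by
  refine tendsto_integral_filter_of_dominated_convergence (fun x => M * ‖ψ x‖) ?_ ?_
    (hψ.norm.const_mul M) ?_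
  · filter_upwards [hf] with n hn using hn.mul hψ.aestronglyMeasurable
  · filter_upwards [hM] with n hn
    filter_upwards [hn] with x hx
    rw [norm_mul, Real.norm_eq_abs]
    gcongr
  · filter_upwards [hlim] with x hx using hx.mul_const _

/-- The gradients converge only weakly, so the coefficient is split as `k(σ0) + (k(σ n) - k(σ0))`.
The fixed part is absorbed into the integrable weight; the difference tends to zero by dominated
convergence because the gradients are uniformly bounded. -/
lemma tendsto_setIntegral_kExt_mul_fderiv {k : ℝ → ℝ} (hk : PermeabilityAssumption k)
    {U : Set (ℝ × ℝ)} (hU : MeasurableSet U) {σ : ℕ → ℝ × ℝ → ℝ} {σ0 ψ : ℝ × ℝ → ℝ}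
    (hσ : ∀ᶠ n in atTop, AEStronglyMeasurable (σ n) (volume.restrict U))
    (hσ0 : AEStronglyMeasurable σ0 (volume.restrict U))
    (hlim : ∀ᵐ x ∂volume.restrict U, Tendsto (fun n => σ n x) atTop (𝓝 (σ0 x)))
    {Pn : ℕ → ℝ × ℝ → ℝ} (hPn : ∀ n, LipschitzWith C (Pn n)) (hP : LipschitzWith C P)
    (hPlim : ∀ x, Tendsto (fun n => Pn n x) atTop (𝓝 (P x))) (hψ : IntegrableOn ψ U) (e : ℝ × ℝ) :
    Tendsto (fun n => ∫ x in U, kExt k (σ n x) * (fderiv ℝ (Pn n) x e * ψ x)) atTop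
      (𝓝 (∫ x in U, kExt k (σ0 x) * (fderiv ℝ P x e * ψ x))) := by
  have hkc := continuous_kExt hk
  have hq : ∀ {f : ℝ × ℝ → ℝ}, LipschitzWith C f →
      IntegrableOn (fun x => fderiv ℝ f x e * ψ x) U := fun {f} hf =>
    Integrable.bdd_mul (c := C * ‖e‖) hψ (aestronglyMeasurable_fderiv f e _)
      (Eventually.of_forall fun x => norm_fderiv_apply_le hf x e)
  have hψk := integrableOn_kExt_mul hk hσ0 hψ
  have h1 : Tendsto (fun n => ∫ x in U, kExt k (σ0 x) * (fderiv ℝ (Pn n) x e * ψ x)) atTop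
      (𝓝 (∫ x in U, kExt k (σ0 x) * (fderiv ℝ P x e * ψ x))) := by
    have := tendsto_integral_fderiv_mul hPn hP hPlim (hψk.integrable_indicator hU) e
    have conv : ∀ f : ℝ × ℝ → ℝ, ∫ x, fderiv ℝ f x e *
        U.indicator (fun x => kExt k (σ0 x) * ψ x) x =
        ∫ x in U, kExt k (σ0 x) * (fderiv ℝ f x e * ψ x) := by
      intro f
      rw [← integral_indicator hU]
      refine integral_congr_ae (Eventually.of_forall fun x => ?_)
      by_cases hx : x ∈ U
      · simp only [indicator_of_mem hx]; ring
      · simp [indicator_of_notMem hx]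
    simpa only [conv] using this
  have h2 : Tendsto (fun n => ∫ x in U, (kExt k (σ n x) - kExt k (σ0 x)) *
      (fderiv ℝ (Pn n) x e * ψ x)) atTop (𝓝 0) := by
    have : Tendsto (fun n => ∫ x in U, (kExt k (σ n x) - kExt k (σ0 x)) *
        (fderiv ℝ (Pn n) x e * ψ x)) atTop (𝓝 (∫ _ in U, (0 : ℝ))) := by
      refine tendsto_integral_filter_of_dominated_convergence
        (fun x => (k 1 + k 1) * (C * ‖e‖ * ‖ψ x‖)) ?_ ?_ ((hψ.norm.const_mul _).const_mul _) ?_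
      · filter_upwards [hσ] with n hn
        exact ((hkc.comp_aestronglyMeasurable hn).sub (hkc.comp_aestronglyMeasurable hσ0)).mul
          (hq (hPn n)).aestronglyMeasurable
      · refine Eventually.of_forall fun n => Eventually.of_forall fun x => ?_
        rw [norm_mul, norm_mul]
        have hk1 := k_one_nonneg hk
        gcongr
        · exact (abs_sub _ _).trans (add_le_add (abs_kExt_le hk _) (abs_kExt_le hk _))
        · exact norm_fderiv_apply_le (hPn n) x e
      · filter_upwards [hlim] with x hx
        have e1 : Tendsto (fun n => kExt k (σ n x) - kExt k (σ0 x)) atTop (𝓝 0) := by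
          have := (((hkc.tendsto _).comp hx).sub_const (kExt k (σ0 x)))
          simpa using this
        refine squeeze_zero_norm (a := fun n => ‖kExt k (σ n x) - kExt k (σ0 x)‖ *
          (C * ‖e‖ * ‖ψ x‖)) (fun n => ?_) (by simpa using e1.norm.mul_const _)
        rw [norm_mul, norm_mul]
        gcongr
        exact norm_fderiv_apply_le (hPn n) x e
    simpa using this
  have h3 := h2.add h1
  rw [zero_add] at h3
  refine h3.congr' ?_
  filter_upwards [hσ] with n hn
  have i1 := integrableOn_kExt_mul hk hn (hq (hPn n))
  have i2 := integrableOn_kExt_mul hk hσ0 (hq (hPn n))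
  have e1 := integral_sub i1 i2
  have e2 : ∀ x, (kExt k (σ n x) - kExt k (σ0 x)) * (fderiv ℝ (Pn n) x e * ψ x) =
      kExt k (σ n x) * (fderiv ℝ (Pn n) x e * ψ x) - kExt k (σ0 x) * (fderiv ℝ (Pn n) x e * ψ x) :=
    fun x => by ring
  simp only [e2, e1]
  ring

section Limit

variable {H : ℕ → ℝ} {s sz p py pz Pn : ℕ → ℝ × ℝ → ℝ} {pstar : ℕ → ℝ}

lemma tendsto_ae_rect {a R : ℝ} (ha : 0 ≤ a)
    (hconv : ∀ᵐ y ∂volume.restrict (Ioo 0 D.L), ∀ z, 0 ≤ z →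
      Tendsto (fun n => slicePrim 0 D.s0 (sz n) (y, z)) atTop (𝓝 (S (y, z)))) :
    ∀ᵐ x ∂volume.restrict (rect D.L a R),
      Tendsto (fun n => slicePrim 0 D.s0 (sz n) x) atTop (𝓝 (S x)) := by
  filter_upwards [ae_rect_of_ae hconv, ae_restrict_mem (measurableSet_rect _ _ _)] with x hx hm
  exact hx x.2 (ha.trans hm.2.1.le)

lemma eventually_aestronglyMeasurable_rect
    (h : ∀ n, IsLipschitzSolution D sstar hi C B (H n) (s n) (sz n) (p n) (py n) (pz n) (pstar n)
      (Pn n))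
    (hH : Tendsto H atTop atTop) {a : ℝ} (ha : 0 ≤ a) (R : ℝ) : ∀ᶠ n in atTop,
    AEStronglyMeasurable (slicePrim 0 D.s0 (sz n)) (volume.restrict (rect D.L a R)) := by
  filter_upwards [hH.eventually_ge_atTop R] with n hn
  exact (aestronglyMeasurable_slicePrim (h n).sol.integrable_s0 (h n).sol.integrable_sz).mono_measure
    (Measure.restrict_mono (rect_mono ha hn) le_rfl)

lemma eventually_mem_rect
    (h : ∀ n, IsLipschitzSolution D sstar hi C B (H n) (s n) (sz n) (p n) (py n) (pz n) (pstar n)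
      (Pn n))
    (hH : Tendsto H atTop atTop) {a : ℝ} (ha : 0 ≤ a) (R : ℝ) : ∀ᶠ n in atTop,
    ∀ᵐ x ∂volume.restrict (rect D.L a R), slicePrim 0 D.s0 (sz n) x ∈ Icc sstar hi := by
  filter_upwards [hH.eventually_ge_atTop R] with n hn
  filter_upwards [ae_rect_of_ae (h n).imb, ae_restrict_mem (measurableSet_rect _ _ _)] with x hx hm
  exact hx.mem x.2 ⟨ha.trans hm.2.1.le, hm.2.2.le.trans hn⟩

lemma tendsto_integral_flux (hk : PermeabilityAssumption D.k)
    (h : ∀ n, IsLipschitzSolution D sstar hi C B (H n) (s n) (sz n) (p n) (py n) (pz n) (pstar n)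
      (Pn n))
    (hH : Tendsto H atTop atTop) (hP : LipschitzWith C P)
    (hlim : ∀ x, Tendsto (fun n => Pn n x) atTop (𝓝 (P x)))
    (hconv : ∀ᵐ y ∂volume.restrict (Ioo 0 D.L), ∀ z, 0 ≤ z →
      Tendsto (fun n => slicePrim 0 D.s0 (sz n) (y, z)) atTop (𝓝 (S (y, z)))) {a R : ℝ}
    (ha : 0 ≤ a) (hSm : AEStronglyMeasurable S (volume.restrict (rect D.L a R))) :
    Tendsto (fun n => ∫ x in rect D.L a R,
      kExt D.k (slicePrim 0 D.s0 (sz n) x) * (dz (Pn n) x + D.g)) atTop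
      (𝓝 (∫ x in rect D.L a R, kExt D.k (S x) * (dz P x + D.g))) := by
  have hm := eventually_aestronglyMeasurable_rect h hH ha R
  have hae := tendsto_ae_rect (D := D) (R := R) ha hconv
  have hkc := continuous_kExt hk
  have i1 : ∀ c : ℝ, IntegrableOn (fun _ : ℝ × ℝ => c) (rect D.L a R) := fun c =>
    (memLp_rect_of_continuous continuous_const D.L a R 1).integrable le_rfl
  have t1 := tendsto_setIntegral_kExt_mul_fderiv hk (measurableSet_rect D.L a R) hm hSm hae
    (fun n => (h n).lip) hP hlim (i1 1) (0, 1)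
  have t2 := tendsto_setIntegral_mul_of_bounded (M := D.k 1)
    (hm.mono fun n hn => hkc.comp_aestronglyMeasurable hn)
    (Eventually.of_forall fun n => Eventually.of_forall fun x => abs_kExt_le hk _)
    (hae.mono fun x hx => (hkc.tendsto _).comp hx) (i1 D.g)
  have key : ∀ {σ f : ℝ × ℝ → ℝ}, AEStronglyMeasurable σ (volume.restrict (rect D.L a R)) →
      LipschitzWith C f → ∫ x in rect D.L a R, kExt D.k (σ x) * (dz f x + D.g) =
      (∫ x in rect D.L a R, kExt D.k (σ x) * (fderiv ℝ f x (0, 1) * 1)) +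
        ∫ x in rect D.L a R, kExt D.k (σ x) * D.g := by
    intro σ f hσ hf
    have hfi : IntegrableOn (fun x => fderiv ℝ f x (0, 1) * 1) (rect D.L a R) := by
      have := integrableOn_dz_lipschitz (L := D.L) (a := a) (b := R) hf
      simp only [mul_one]
      exact this
    rw [← integral_add (integrableOn_kExt_mul hk hσ hfi) (integrableOn_kExt_mul hk hσ (i1 D.g))]
    congr 1 with x
    rw [dz]; ring
  rw [key hSm hP]
  refine (t1.add t2).congr' ?_
  filter_upwards [hm] with n hn
  exact (key hn (h n).lip).symm

/-- Each approximation satisfies this identity as soon as `H n ≥ R`. The gradient terms converge by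
weak-strong pairing, the lower-order terms by dominated convergence. -/
lemma limit_weak_eq (hk : PermeabilityAssumption D.k) (hss : 0 < sstar) (hhi : hi < 1)
    (h : ∀ n, IsLipschitzSolution D sstar hi C B (H n) (s n) (sz n) (p n) (py n) (pz n) (pstar n)
      (Pn n))
    (hH : Tendsto H atTop atTop) (hP : LipschitzWith C P)
    (hlim : ∀ x, Tendsto (fun n => Pn n x) atTop (𝓝 (P x)))
    (hconv : ∀ᵐ y ∂volume.restrict (Ioo 0 D.L), ∀ z, 0 ≤ z →
      Tendsto (fun n => slicePrim 0 D.s0 (sz n) (y, z)) atTop (𝓝 (S (y, z)))) {R : ℝ}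
    (hR : 0 < R) (hSm : AEStronglyMeasurable S (volume.restrict (rect D.L 0 R)))
    (hSb : ∀ᵐ x ∂volume.restrict (rect D.L 0 R), |S x| ≤ 1)
    {φ : ℝ × ℝ → ℝ} {C' : NNReal} (hφ : LipschitzWith C' φ)
    (h0 : ∀ y, φ (y, 0) = 0) (hφR : ∀ x : ℝ × ℝ, R ≤ x.2 → φ x = 0) :
    ∫ x in rect D.L 0 R, (kExt D.k (S x) * (dy P x * dy φ x + dz P x * dz φ x) +
      (D.g * kExt D.k (S x) - D.c * S x) * dz φ x) = 0 := by
  have hm := eventually_aestronglyMeasurable_rect h hH le_rfl R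
  have hb : ∀ᶠ n in atTop, ∀ᵐ x ∂volume.restrict (rect D.L 0 R),
      |slicePrim 0 D.s0 (sz n) x| ≤ 1 := by
    filter_upwards [eventually_mem_rect h hH le_rfl R] with n hn
    filter_upwards [hn] with x hx
    rw [abs_of_nonneg (hss.le.trans hx.1)]
    exact hx.2.trans hhi.le
  have hae := tendsto_ae_rect (D := D) (R := R) le_rfl hconv
  have hkc := continuous_kExt hk
  have iy : IntegrableOn (dy φ) (rect D.L 0 R) :=
    (isH1_of_lipschitz hφ D.L 0 R).mem_y.integrable one_le_two
  have iz : IntegrableOn (dz φ) (rect D.L 0 R) :=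
    (isH1_of_lipschitz hφ D.L 0 R).mem_z.integrable one_le_two
  have t1 := tendsto_setIntegral_kExt_mul_fderiv hk (measurableSet_rect D.L 0 R) hm hSm hae
    (fun n => (h n).lip) hP hlim iy (1, 0)
  have t2 := tendsto_setIntegral_kExt_mul_fderiv hk (measurableSet_rect D.L 0 R) hm hSm hae
    (fun n => (h n).lip) hP hlim iz (0, 1)
  have t3 := tendsto_setIntegral_mul_of_bounded (M := D.k 1)
    (hm.mono fun n hn => hkc.comp_aestronglyMeasurable hn)
    (Eventually.of_forall fun n => Eventually.of_forall fun x => abs_kExt_le hk _)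
    (hae.mono fun x hx => (hkc.tendsto _).comp hx) (iz.const_mul D.g)
  have t4 := tendsto_setIntegral_mul_of_bounded hm hb hae (iz.const_mul D.c)
  have key : ∀ {σ f : ℝ × ℝ → ℝ}, AEStronglyMeasurable σ (volume.restrict (rect D.L 0 R)) →
      (∀ᵐ x ∂volume.restrict (rect D.L 0 R), |σ x| ≤ 1) → LipschitzWith C f →
      ∫ x in rect D.L 0 R, (kExt D.k (σ x) * (dy f x * dy φ x + dz f x * dz φ x) +
        (D.g * kExt D.k (σ x) - D.c * σ x) * dz φ x) =
      (∫ x in rect D.L 0 R, kExt D.k (σ x) * (fderiv ℝ f x (1, 0) * dy φ x)) +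
      (∫ x in rect D.L 0 R, kExt D.k (σ x) * (fderiv ℝ f x (0, 1) * dz φ x)) +
      (∫ x in rect D.L 0 R, kExt D.k (σ x) * (D.g * dz φ x)) -
      ∫ x in rect D.L 0 R, σ x * (D.c * dz φ x) := by
    intro σ f hσ hσb hf
    have j1 := integrableOn_kExt_mul hk hσ (Integrable.bdd_mul (c := C * ‖((1 : ℝ), (0 : ℝ))‖) iy
      (aestronglyMeasurable_fderiv f (1, 0) _)
      (Eventually.of_forall fun x => norm_fderiv_apply_le hf x (1, 0)))
    have j2 := integrableOn_kExt_mul hk hσ (Integrable.bdd_mul (c := C * ‖((0 : ℝ), (1 : ℝ))‖) iz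
      (aestronglyMeasurable_fderiv f (0, 1) _)
      (Eventually.of_forall fun x => norm_fderiv_apply_le hf x (0, 1)))
    have j3 := integrableOn_kExt_mul hk hσ (iz.const_mul D.g)
    have j4 : IntegrableOn (fun x => σ x * (D.c * dz φ x)) (rect D.L 0 R) :=
      Integrable.bdd_mul (c := 1) (iz.const_mul D.c) hσ hσb
    have e1 := integral_add j1 j2
    have e2 := integral_add (j1.add j2) j3
    have e3 := integral_sub ((j1.add j2).add j3) j4
    simp only [Pi.add_apply] at e2 e3
    rw [← e1, ← e2, ← e3]
    congr 1 with x
    simp only [dy, dz]; ring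
  refine (key hSm hSb hP).trans (tendsto_nhds_unique (((t1.add t2).add t3).sub t4) ?_)
  refine tendsto_const_nhds.congr' ?_
  filter_upwards [hm, hb, hH.eventually_ge_atTop R] with n hn hbn hHn
  exact ((h n).weak_eq hk hR hHn hφ h0 hφR).symm.trans (key hn hbn (h n).lip)

end Limit

end Fingering

namespace Fingering

/-! ### Properties of the limit -/

variable {D : TWData} {sstar hi B : ℝ} {C : NNReal} {P S : ℝ × ℝ → ℝ}

lemma setIntegral_strip_eq_rect {L R : ℝ} {f : ℝ × ℝ → ℝ}
    (hf : ∀ x : ℝ × ℝ, R ≤ x.2 → f x = 0) : ∫ x in strip L, f x = ∫ x in rect L 0 R, f x :=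
  setIntegral_eq_of_subset_of_forall_sdiff_eq_zero (isOpen_strip L).measurableSet
    rect_subset_strip fun x hx => hf x (by
      by_contra! hlt
      exact hx.2 ⟨hx.1.1, hx.1.2, hlt⟩)

lemma eq_zero_of_notMem_tsupport {φ : ℝ × ℝ → ℝ} {x : ℝ × ℝ} (hx : x ∉ tsupport φ) :
    φ x = 0 ∧ fderiv ℝ φ x = 0 :=
  ⟨image_eq_zero_of_notMem_tsupport hx, by
    by_contra hne
    exact hx (tsupport_fderiv_subset ℝ (subset_tsupport _ hne))⟩

namespace IsImbibitionField

/-- `k(S)` is locally Lipschitz and at least `k(s_*) > 0`, so the limit equation is uniformly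
elliptic with coefficients regular enough for the difference quotient method. -/
lemma exists_second_derivatives (h : IsImbibitionField D sstar hi C B P S)
    (hk : PermeabilityAssumption D.k) (hκ : 0 < D.c * D.τ)
    (hss : 0 < sstar) (hhi : hi < 1) (hpc : CapillaryAssumption D.pc sstar)
    (hs0 : ContDiffOn ℝ 1 D.s0 (Ioo 0 D.L))
    (hweak : ∀ R, 0 < R → ∀ (φ : ℝ × ℝ → ℝ) (C' : NNReal), LipschitzWith C' φ →
      (∀ y, φ (y, 0) = 0) → (∀ x : ℝ × ℝ, R ≤ x.2 → φ x = 0) →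
      ∫ x in rect D.L 0 R, (kExt D.k (S x) * (dy P x * dy φ x + dz P x * dz φ x) +
        (D.g * kExt D.k (S x) - D.c * S x) * dz φ x) = 0) (e : ℝ × ℝ) :
    (∃ v, InL2loc (strip D.L) v ∧ IsWeakD e (strip D.L) (dy P) v) ∧
      ∃ v, InL2loc (strip D.L) v ∧ IsWeakD e (strip D.L) (dz P) v := by
  obtain ⟨Ck, hCk⟩ := exists_lipschitzOnWith_kExt hk hss hhi
  have ha : ∀ K, IsCompact K → K ⊆ strip D.L →
      ∃ Cs Ca, LipschitzOnWith Cs S K ∧ LipschitzOnWith Ca (fun x => kExt D.k (S x)) K := by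
    intro K hK hKs
    obtain ⟨Cs, hCs⟩ := h.exists_lipschitzOnWith hκ hss hhi hpc hs0 hK hKs
    exact ⟨Cs, _, hCs, hCk.comp hCs fun x hx => h.mem (hKs hx).1 (le_of_lt (hKs hx).2)⟩
  have key : ∀ K, IsCompact K → K ⊆ strip D.L →
      ∃ Cb, LipschitzOnWith Cb (fun x => D.g * kExt D.k (S x) - D.c * S x) K := by
    intro K hK hKs
    obtain ⟨Cs, Ca, hCs, hCa⟩ := ha K hK hKs
    exact ⟨_, ((lipschitzWith_smul D.g).comp_lipschitzOnWith hCa).sub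
      ((lipschitzWith_smul D.c).comp_lipschitzOnWith hCs)⟩
  refine exists_weakD_gradient (a := fun x => kExt D.k (S x))
    (b := fun x => D.g * kExt D.k (S x) - D.c * S x) h.lip (isOpen_strip D.L)
    ⟨(0, -1), fun hx => by have : (0 : ℝ) < -1 := hx.2; linarith⟩
    (fun K hK hKs => by obtain ⟨_, Ca, _, hCa⟩ := ha K hK hKs; exact ⟨Ca, hCa⟩) key
    (kExt_pos hk hss) (fun x hx => monotone_kExt hk (h.mem hx.1 (le_of_lt hx.2)).1)
    (fun φ C' hφ hc hsub => ?_) e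
  obtain ⟨R, hR, hsupp⟩ := exists_height hc
  have hz : ∀ x : ℝ × ℝ, R ≤ x.2 → φ x = 0 ∧ fderiv ℝ φ x = 0 := fun x hx =>
    eq_zero_of_notMem_tsupport fun hx' => absurd (hsupp x hx') (not_lt.2 hx)
  rw [setIntegral_strip_eq_rect (R := R) fun x hx => by simp [hz x hx, dy, dz]]
  exact hweak R hR φ C' hφ (fun y => image_eq_zero_of_notMem_tsupport fun hx =>
    lt_irrefl (0 : ℝ) (hsub hx).2) fun x hx => (hz x hx).1

/-- Gauss-Green is applied in the reverse direction to restore `∂_z s`; the boundary terms vanish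
because `φ` is zero at the bottom and above its support. -/
lemma weak (h : IsImbibitionField D sstar hi C B P S) (hκ : 0 < D.c * D.τ)
    (hss : 0 < sstar) (hhi : hi < 1) (hpc : CapillaryAssumption D.pc sstar)
    (hk : PermeabilityAssumption D.k)
    (hs0 : ContDiffOn ℝ 1 D.s0 (Ioo 0 D.L)) (hs0i : IntegrableOn D.s0 (Ioo 0 D.L))
    (hweak : ∀ R, 0 < R → ∀ (φ : ℝ × ℝ → ℝ) (C' : NNReal), LipschitzWith C' φ →
      (∀ y, φ (y, 0) = 0) → (∀ x : ℝ × ℝ, R ≤ x.2 → φ x = 0) →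
      ∫ x in rect D.L 0 R, (kExt D.k (S x) * (dy P x * dy φ x + dz P x * dz φ x) +
        (D.g * kExt D.k (S x) - D.c * S x) * dz φ x) = 0) {φ : ℝ × ℝ → ℝ}
    (hφ : IsTestOn {x | 0 < x.2} φ) :
    ∫ x in strip D.L, (D.c * satRate D P S x * φ x +
      D.k (S x) * (dy P x * dy φ x + (dz P x + D.g) * dz φ x)) = 0 := by
  obtain ⟨R, hR, hsupp⟩ := exists_height hφ.compact
  obtain ⟨C', hC'⟩ := hφ.lipschitz
  have hφ0 : ∀ y, φ (y, 0) = 0 := fun y => hφ.eq_zero (by simp)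
  have hz : ∀ x : ℝ × ℝ, R ≤ x.2 → φ x = 0 ∧ fderiv ℝ φ x = 0 := fun x hx =>
    eq_zero_of_notMem_tsupport fun hx' => absurd (hsupp x hx') (not_lt.2 hx)
  rw [setIntegral_strip_eq_rect (R := R) fun x hx => by simp [hz x hx, dy, dz]]
  have hw := hweak R hR φ C' hC' hφ0 fun x hx => (hz x hx).1
  have hsi := h.integrableOn_satRate hκ hss hhi hpc hs0 R
  have hgg := gauss_green hR.le hs0i hsi hC'
  have hb0 : ∫ y in Ioo 0 D.L, slicePrim 0 D.s0 (satRate D P S) (y, R) * φ (y, R) = 0 := by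
    simp [(hz (_, R) le_rfl).1]
  have hb1 : ∫ y in Ioo 0 D.L, D.s0 y * φ (y, 0) = 0 := by simp [hφ0]
  rw [hb0, hb1, sub_zero] at hgg
  have hSi := integrableOn_slicePrim hR.le hs0i hsi
  have hSi' : IntegrableOn S (rect D.L 0 R) := hSi.congr (h.ae_eq_slicePrim R)
  have iy : IntegrableOn (dy φ) (rect D.L 0 R) :=
    (isH1_of_lipschitz hC' D.L 0 R).mem_y.integrable one_le_two
  have iz : IntegrableOn (dz φ) (rect D.L 0 R) :=
    (isH1_of_lipschitz hC' D.L 0 R).mem_z.integrable one_le_two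
  have j1 : IntegrableOn (fun x => slicePrim 0 D.s0 (satRate D P S) x * dz φ x +
      satRate D P S x * φ x) (rect D.L 0 R) :=
    (integrableOn_rect_mul hSi (memLp_top_dz hC' _)).add (integrableOn_rect_mul hsi
      (memLp_rect_of_continuous hC'.continuous _ _ _ _))
  have j2 : IntegrableOn (fun x => kExt D.k (S x) * (dy P x * dy φ x + dz P x * dz φ x) +
        (D.g * kExt D.k (S x) - D.c * S x) * dz φ x) (rect D.L 0 R) := by
    have k1 := integrableOn_kExt_mul hk hSi'.aestronglyMeasurable
      (((integrableOn_rect_mul ((isH1_of_lipschitz h.lip D.L 0 R).mem_y.integrable one_le_two) (memLp_top_dy hC' _))).add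
      (integrableOn_rect_mul (integrableOn_dz_lipschitz h.lip) (memLp_top_dz hC' _)))
    have k2 := integrableOn_kExt_mul hk hSi'.aestronglyMeasurable (iz.const_mul D.g)
    have k3 := (integrableOn_rect_mul hSi' (memLp_top_dz hC' _)).const_mul D.c
    refine ((k1.add k2).sub k3).congr (Eventually.of_forall fun x => ?_)
    simp only [Pi.add_apply, Pi.sub_apply]
    ring
  have hsum := integral_add j2 (j1.const_mul D.c)
  rw [hw, integral_const_mul, hgg, mul_zero, add_zero] at hsum
  refine Eq.trans (integral_congr_ae ?_) hsum
  filter_upwards [h.ae_eq_slicePrim R, ae_restrict_mem (measurableSet_rect _ _ _)] with x hx hm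
  rw [hx, kExt_eq (Ioo_subset_Icc_self (h.range hss hhi x (rect_subset_strip hm)))]
  ring

/-- The integrated identity holds for every upper height `z2`, so it can be differentiated there. By
Lebesgue's theorem the flux through almost every horizontal section is `F_∞`. -/
lemma flux_ae_eq (h : IsImbibitionField D sstar hi C B P S) (hκ : 0 < D.c * D.τ)
    (hss : 0 < sstar) (hhi : hi < 1) (hpc : CapillaryAssumption D.pc sstar)
    (hk : PermeabilityAssumption D.k) (hs0 : ContDiffOn ℝ 1 D.s0 (Ioo 0 D.L)) {z1 : ℝ}
    (hz1 : 0 < z1) (hflux : ∀ z2, z1 < z2 → ∫ x in rect D.L z1 z2,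
      kExt D.k (S x) * (dz P x + D.g) = (z2 - z1) * D.Finf) :
    ∀ᵐ z : ℝ, z1 < z →
      ∫ y in Ioo 0 D.L, D.k (S (y, z)) * (dz P (y, z) + D.g) = D.Finf := by
  have hSc := h.continuousOn hκ hss hhi hpc hs0
  set f : ℝ × ℝ → ℝ := fun x => kExt D.k (S x) * (dz P x + D.g) with hf
  set G : ℝ → ℝ := fun z => ∫ y in Ioo 0 D.L, f (y, z) with hG
  have hfi : ∀ N, IntegrableOn f (rect D.L z1 N) := fun N => by
    have hsub : rect D.L z1 N ⊆ strip D.L := fun x hx => ⟨hx.1, hz1.trans hx.2.1⟩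
    have hSm : AEStronglyMeasurable S (volume.restrict (rect D.L z1 N)) :=
      (hSc.mono hsub).aestronglyMeasurable (measurableSet_rect _ _ _)
    exact integrableOn_kExt_mul hk hSm ((integrableOn_dz_lipschitz h.lip).add
      ((memLp_rect_of_continuous continuous_const D.L z1 N 1).integrable le_rfl))
  have hGint : ∀ z2, z1 < z2 → ∫ z in z1..z2, G z = (z2 - z1) * D.Finf := fun z2 h12 => by
    rw [intervalIntegral_eq_Ioo h12.le, ← hflux z2 h12]
    have := hfi z2
    rw [IntegrableOn, volume_restrict_rect] at this
    rw [volume_restrict_rect, integral_prod_symm _ this]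
  have hGi : ∀ N, z1 ≤ N → IntervalIntegrable G volume z1 N := fun N hN => by
    have := hfi N
    rw [IntegrableOn, volume_restrict_rect] at this
    rw [intervalIntegrable_iff_integrableOn_Ioo_of_le hN]
    exact this.integral_prod_right
  -- Lebesgue differentiation is available on bounded intervals; countably many of them exhaust the
  -- half-line with one null set.
  have hall : ∀ᵐ z : ℝ, ∀ n : ℕ, z ∈ uIcc z1 (z1 + n) → ∀ c ∈ uIcc z1 (z1 + n),
      HasDerivAt (fun b => ∫ t in c..b, G t) (G z) z :=
    ae_all_iff.2 fun n => (hGi (z1 + n) (by linarith [n.cast_nonneg (α := ℝ)])).ae_hasDerivAt_integral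
  filter_upwards [hall] with z hz hlt
  obtain ⟨n, hn⟩ := exists_nat_gt (z - z1)
  have hle : z1 ≤ z1 + n := by linarith
  have hd := hz n (by rw [uIcc_of_le hle]; exact ⟨hlt.le, by linarith⟩) z1 left_mem_uIcc
  have hd2 : HasDerivAt (fun b => ∫ t in z1..b, G t) D.Finf z := by
    have : HasDerivAt (fun b => (b - z1) * D.Finf) (1 * D.Finf) z :=
      ((hasDerivAt_id z).sub_const z1).mul_const _
    rw [one_mul] at this
    refine this.congr_of_eventuallyEq ?_
    filter_upwards [lt_mem_nhds hlt] with b hb using hGint b hb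
  rw [← hd.unique hd2]
  refine setIntegral_congr_fun measurableSet_Ioo fun y hy => ?_
  have := h.range hss hhi (y, z) ⟨hy, hz1.trans hlt⟩
  simp only [hf, kExt_eq (Ioo_subset_Icc_self this)]

end IsImbibitionField

lemma convergesL2loc_of_ae {L : ℝ} {u : ℕ → ℝ × ℝ → ℝ} {v : ℝ × ℝ → ℝ} {M : ℝ → ℝ}
    (hm : ∀ R, 0 < R → ∀ᶠ n in atTop, AEStronglyMeasurable (u n) (volume.restrict (rect L 0 R)))
    (hmv : ∀ R, 0 < R → AEStronglyMeasurable v (volume.restrict (rect L 0 R)))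
    (hb : ∀ R, 0 < R → ∀ᶠ n in atTop, ∀ᵐ x ∂volume.restrict (rect L 0 R), |u n x - v x| ≤ M R)
    (hlim : ∀ R, 0 < R → ∀ᵐ x ∂volume.restrict (rect L 0 R),
      Tendsto (fun n => u n x) atTop (𝓝 (v x))) : ConvergesL2loc L u v := by
  intro K hK hKs
  obtain ⟨α, β, R, hα, hβ, hR, hbox⟩ := exists_box_of_subset_strip hK hKs
  have hsub : K ⊆ rect L 0 R := fun x hx => ⟨(hKs hx).1, (hKs hx).2, (hbox x hx).2⟩
  have hle : ∀ n, eLpNorm (fun x => u n x - v x) 2 (volume.restrict K) ≤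
      eLpNorm (fun x => u n x - v x) 2 (volume.restrict (rect L 0 R)) := fun n =>
    eLpNorm_mono_measure _ (Measure.restrict_mono hsub le_rfl)
  refine tendsto_of_tendsto_of_tendsto_of_le_of_le tendsto_const_nhds ?_ (fun _ => zero_le) hle
  have hint : Tendsto (fun n => ∫⁻ x in rect L 0 R, ‖u n x - v x‖ₑ ^ (2 : ℝ)) atTop
      (𝓝 (∫⁻ _ in rect L 0 R, 0)) := by
    -- Measurability and the bound hold only once the truncated domain contains the rectangle, so
    -- the index is shifted by `N`.
    obtain ⟨N, hN⟩ := eventually_atTop.1 ((hm R hR).and (hb R hR))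
    rw [← tendsto_add_atTop_iff_nat N]
    refine tendsto_lintegral_of_dominated_convergence'
      (fun _ => ENNReal.ofReal (M R) ^ (2 : ℝ)) (fun n => ?_) (fun n => ?_) ?_ ?_
    · exact ((hN (n + N) (Nat.le_add_left _ _)).1.sub (hmv R hR)).enorm.pow_const _
    · filter_upwards [(hN (n + N) (Nat.le_add_left _ _)).2] with x hx
      gcongr
      rw [Real.enorm_eq_ofReal_abs]
      exact ENNReal.ofReal_le_ofReal hx
    · rw [lintegral_const]
      exact ENNReal.mul_ne_top (by simp) (measure_ne_top _ _)
    · filter_upwards [hlim R hR] with x hx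
      have h1 : Tendsto (fun n => ‖u (n + N) x - v x‖ₑ) atTop (𝓝 0) := by
        have := ((tendsto_add_atTop_iff_nat N).2 (hx.sub_const (v x))).enorm
        simpa using this
      have := h1.ennrpow_const (2 : ℝ)
      simpa using this
  have h2 : ∀ n, eLpNorm (fun x => u n x - v x) 2 (volume.restrict (rect L 0 R)) =
      (∫⁻ x in rect L 0 R, ‖u n x - v x‖ₑ ^ (2 : ℝ)) ^ (1 / (2 : ℝ)) := fun n => by
    have := eLpNorm_nnreal_eq_lintegral (p := 2) (f := fun x => u n x - v x)
      (μ := volume.restrict (rect L 0 R)) two_ne_zero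
    simpa using this
  simp only [h2]
  have := hint.ennrpow_const (1 / (2 : ℝ))
  simpa using this

end Fingering

namespace Fingering

/-! ### Existence of a large solution -/

variable {D : TWData} {sstar hi B : ℝ} {C : NNReal} {P S : ℝ × ℝ → ℝ}
  {H : ℕ → ℝ} {s sz p py pz Pn : ℕ → ℝ × ℝ → ℝ} {pstar : ℕ → ℝ}

lemma convergesL2loc_saturation (hss : 0 < sstar) (hhi : hi < 1)
    (h : ∀ n, IsLipschitzSolution D sstar hi C B (H n) (s n) (sz n) (p n) (py n) (pz n) (pstar n)
      (Pn n)) (hHpos : ∀ n, 0 < H n) (hH : Tendsto H atTop atTop)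
    (hconv : ∀ᵐ y ∂volume.restrict (Ioo 0 D.L), ∀ z, 0 ≤ z →
      Tendsto (fun n => slicePrim 0 D.s0 (sz n) (y, z)) atTop (𝓝 (S (y, z))))
    (hSc : ContinuousOn S (strip D.L)) (hSr : ∀ x ∈ strip D.L, S x ∈ Ioo (0 : ℝ) 1) :
    ConvergesL2loc D.L s S := by
  have hsn : ∀ R, ∀ n, R ≤ H n → s n =ᵐ[volume.restrict (rect D.L 0 R)] slicePrim 0 D.s0 (sz n) :=
    fun R n hn => ae_restrict_of_ae_restrict_of_subset (rect_mono le_rfl hn)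
      ((h n).sol.s_ae_eq (hHpos n).le)
  refine convergesL2loc_of_ae (M := fun _ => 1) (fun R _ => ?_) (fun R _ => ?_) (fun R _ => ?_)
    fun R _ => ?_
  · filter_upwards [hH.eventually_ge_atTop R, eventually_aestronglyMeasurable_rect h hH le_rfl R]
      with n hn hm using hm.congr (hsn R n hn).symm
  · exact (hSc.mono rect_subset_strip).aestronglyMeasurable (measurableSet_rect _ _ _)
  · filter_upwards [hH.eventually_ge_atTop R, eventually_mem_rect h hH le_rfl R] with n hn hm
    filter_upwards [hsn R n hn, hm, ae_restrict_mem (measurableSet_rect _ _ _)] with x h1 h2 hx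
    have h3 := hSr x (rect_subset_strip hx)
    rw [h1, abs_le]
    constructor <;> linarith [h2.1, h2.2, h3.1, h3.2]
  · have hall : ∀ᵐ x ∂volume.restrict (rect D.L 0 R), ∀ n, R ≤ H n →
        s n x = slicePrim 0 D.s0 (sz n) x := by
      rw [ae_all_iff]
      intro n
      by_cases hn : R ≤ H n
      · filter_upwards [hsn R n hn] with x hx _ using hx
      · exact Eventually.of_forall fun x hn' => absurd hn' hn
    filter_upwards [hall, tendsto_ae_rect (D := D) (R := R) le_rfl hconv] with x h1 h2
    refine h2.congr' ?_
    filter_upwards [hH.eventually_ge_atTop R] with n hn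
    exact (h1 n hn).symm

/-- Both pressures equal `p0` on the bottom and are `C`-Lipschitz, so on a rectangle of height `R`
they differ by at most `2 C R`. This is the dominating constant. -/
lemma convergesL2loc_pressure
    (h : ∀ n, IsLipschitzSolution D sstar hi C B (H n) (s n) (sz n) (p n) (py n) (pz n) (pstar n)
      (Pn n)) (hH : Tendsto H atTop atTop) (hP : LipschitzWith C P)
    (hbot : ∀ y ∈ Ioo 0 D.L, P (y, 0) = D.p0 y)
    (hlim : ∀ x, Tendsto (fun n => Pn n x) atTop (𝓝 (P x))) : ConvergesL2loc D.L p P := by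
  have hpn : ∀ R, ∀ n, R ≤ H n → p n =ᵐ[volume.restrict (rect D.L 0 R)] Pn n :=
    fun R n hn => ae_restrict_of_ae_restrict_of_subset (rect_mono le_rfl hn) (h n).p_eq
  refine convergesL2loc_of_ae (M := fun R => C * R + C * R) (fun R _ => ?_) (fun R _ => ?_)
    (fun R _ => ?_) fun R _ => ?_
  · filter_upwards [hH.eventually_ge_atTop R] with n hn
      using (h n).lip.continuous.aestronglyMeasurable.congr (hpn R n hn).symm
  · exact hP.continuous.aestronglyMeasurable
  · filter_upwards [hH.eventually_ge_atTop R] with n hn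
    filter_upwards [hpn R n hn, ae_restrict_mem (measurableSet_rect _ _ _)] with x h1 hx
    have e1 := abs_sub_base_le (h n).lip x.1 (Ioo_subset_Icc_self hx.2)
    have e2 := abs_sub_base_le hP x.1 (Ioo_subset_Icc_self hx.2)
    rw [(h n).bottom x.1 hx.1] at e1
    rw [hbot x.1 hx.1, abs_sub_comm] at e2
    rw [h1]
    calc |Pn n x - P x| = |(Pn n x - D.p0 x.1) + (D.p0 x.1 - P x)| := by ring_nf
      _ ≤ _ := (abs_add_le _ _).trans (add_le_add e1 e2)
  · have hall : ∀ᵐ x ∂volume.restrict (rect D.L 0 R), ∀ n, R ≤ H n → p n x = Pn n x := by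
      rw [ae_all_iff]
      intro n
      by_cases hn : R ≤ H n
      · filter_upwards [hpn R n hn] with x hx _ using hx
      · exact Eventually.of_forall fun x hn' => absurd hn' hn
    filter_upwards [hall] with x h1
    refine (hlim x).congr' ?_
    filter_upwards [hH.eventually_ge_atTop R] with n hn
    exact (h1 n hn).symm

/-- The slices at the fixed height `z0` converge for almost every `y`, and `k` is bounded, so the
hypothesis on the gravity flux is stable under the limit. -/
lemma le_integral_limit (hk : PermeabilityAssumption D.k) (hss : 0 < sstar) (hhi : hi < 1)
    (h : ∀ n, IsLipschitzSolution D sstar hi C B (H n) (s n) (sz n) (p n) (py n) (pz n) (pstar n)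
      (Pn n)) (hH : Tendsto H atTop atTop)
    (hconv : ∀ᵐ y ∂volume.restrict (Ioo 0 D.L), ∀ z, 0 ≤ z →
      Tendsto (fun n => slicePrim 0 D.s0 (sz n) (y, z)) atTop (𝓝 (S (y, z)))) {z0 Ck : ℝ}
    (hz0 : 0 < z0) (hlarge : ∀ n, z0 < H n → ∃ t : ℝ → ℝ, IsValueAtHeight D.L z0 (s n) t ∧
      Ck ≤ ∫ y in Ioo 0 D.L, D.g * D.k (t y)) :
    Ck ≤ ∫ y in Ioo 0 D.L, D.g * kExt D.k (S (y, z0)) := by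
  have hkc := continuous_kExt hk
  have hev : ∀ᶠ n in atTop, z0 < H n := hH.eventually_gt_atTop z0
  have hlim : Tendsto (fun n => ∫ y in Ioo 0 D.L, D.g * kExt D.k (slicePrim 0 D.s0 (sz n) (y, z0)))
      atTop (𝓝 (∫ y in Ioo 0 D.L, D.g * kExt D.k (S (y, z0)))) := by
    refine tendsto_integral_filter_of_dominated_convergence (fun _ => |D.g| * D.k 1) ?_ ?_
      (integrable_const _) ?_
    · filter_upwards [hev] with n hn
      exact (hkc.comp_aestronglyMeasurable (integrableOn_slicePrim_slice (h n).sol.integrable_s0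
        (h n).sol.integrable_sz ⟨hz0.le, hn.le⟩).aestronglyMeasurable).const_mul _
    · refine Eventually.of_forall fun n => Eventually.of_forall fun y => ?_
      rw [norm_mul, Real.norm_eq_abs]
      gcongr
      exact abs_kExt_le hk _
    · filter_upwards [hconv] with y hy
      exact ((hkc.tendsto _).comp (hy z0 hz0.le)).const_mul _
  refine ge_of_tendsto hlim ?_
  filter_upwards [hev] with n hn
  obtain ⟨t, ht, hle⟩ := hlarge n hn
  refine hle.trans (le_of_eq (integral_congr_ae ?_))
  filter_upwards [(h n).sol.value_ae_eq hz0 hn.le ht, (h n).imb] with y h1 h2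
  have h3 := Icc_sub_Ioo hss hhi (h2.mem z0 ⟨hz0.le, hn.le⟩)
  rw [h1, kExt_eq (Ioo_subset_Icc_self h3)]

lemma IsImbibitionField.isStripSolutionWith (h : IsImbibitionField D sstar hi C B P S)
    (hk : PermeabilityAssumption D.k) (hκ : 0 < D.c * D.τ)
    (hss : sstar ∈ Ioo (0 : ℝ) 1) (hhi : hi < 1) (hpc : CapillaryAssumption D.pc sstar)
    (hs0 : ContDiffOn ℝ 1 D.s0 (Ioo 0 D.L)) (hs0i : MemLp D.s0 2 (volume.restrict (Ioo 0 D.L)))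
    {z1 : ℝ} (hP : ∀ y ∈ Ioo 0 D.L, ∀ z, z1 ≤ z → P (y, z) ≤ 0)
    (hweak : ∀ R, 0 < R → ∀ (φ : ℝ × ℝ → ℝ) (C' : NNReal), LipschitzWith C' φ →
      (∀ y, φ (y, 0) = 0) → (∀ x : ℝ × ℝ, R ≤ x.2 → φ x = 0) →
      ∫ x in rect D.L 0 R, (kExt D.k (S x) * (dy P x * dy φ x + dz P x * dz φ x) +
        (D.g * kExt D.k (S x) - D.c * S x) * dz φ x) = 0) :
    IsStripSolutionWith D S (satRate D P S) P (dy P) (dz P) where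
  s_cont := h.continuousOn hκ hss.1 hhi hpc hs0
  s_range := h.range hss.1 hhi
  sz_mem := h.memLp_satRate hκ hss hhi hpc hs0 hP
  s_weak := h.isWeakDz hκ hss.1 hhi hpc hs0 (hs0i.integrable one_le_two)
  p_h1 := fun R _ => isH1_of_lipschitz h.lip D.L 0 R
  p_h2loc := by
    obtain ⟨⟨pyy, m1, w1⟩, ⟨pzy, m3, w3⟩⟩ :=
      h.exists_second_derivatives hk hκ hss.1 hhi hpc hs0 hweak (1, 0)
    obtain ⟨⟨pyz, m2, w2⟩, ⟨pzz, m4, w4⟩⟩ :=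
      h.exists_second_derivatives hk hκ hss.1 hhi hpc hs0 hweak (0, 1)
    exact ⟨pyy, pyz, pzy, pzz, ⟨m1, m2, m3, m4⟩, w1, w2, w3, w4⟩
  s_bottom := fun _ hR => h.isBottomTrace hκ hss.1 hhi hpc hs0 hs0i hR
  p_bottom := fun _ hR => h.isBottomTrace_pressure hR
  weak := fun _ hφ => h.weak hκ hss.1 hhi hpc hk hs0 (hs0i.integrable one_le_two) hweak hφ
  closure_eq := Eventually.of_forall fun x => by
    rw [satRate, rate, mul_div_cancel₀ _ hκ.ne']

lemma exists_typeI_limit (hL : 0 < D.L) (hg : 0 < D.g) (hc : 0 < D.c) (hτ : 0 < D.τ)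
    (hss : sstar ∈ Ioo (0 : ℝ) 1) (hk : PermeabilityAssumption D.k)
    (hpc : CapillaryAssumption D.pc sstar)
    (hs0 : ∀ y ∈ Ioo 0 D.L, sstar ≤ D.s0 y ∧ D.s0 y ≤ 1) (hHpos : ∀ n, 0 < H n)
    (hH : Tendsto H atTop atTop) (hsol : ∀ n, IsTWSolution D (H n) (s n) (p n)) {z0 Ck : ℝ}
    (hz0 : 0 < z0) (hCk : D.Finf < Ck)
    (hlarge : ∀ n, z0 < H n → ∃ t : ℝ → ℝ, IsValueAtHeight D.L z0 (s n) t ∧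
      Ck ≤ ∫ y in Ioo 0 D.L, D.g * D.k (t y))
    (hs0c : ContDiffOn ℝ 1 D.s0 (Ioo 0 D.L)) (hp0c : ContDiffOn ℝ 1 D.p0 (Ioo 0 D.L))
    (hcomp : ∀ y ∈ Ioo 0 D.L, D.s0 y < 1 ∧ D.pc (D.s0 y) < D.p0 y) {pbar : ℝ}
    (hpbar : ∀ n, ∀ᵐ x ∂volume.restrict (rect D.L 0 (H n)), p n x ≤ pbar) {CP : ℝ}
    (hCP : ∀ n, GradientBound (rect D.L 0 (H n)) (p n) CP) :
    ∃ (θ : ℕ → ℕ) (slim plim : ℝ × ℝ → ℝ), StrictMono θ ∧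
      ConvergesL2loc D.L (fun n => s (θ n)) slim ∧ ConvergesL2loc D.L (fun n => p (θ n)) plim ∧
      IsTypeI D slim plim := by
  have hκ : 0 < D.c * D.τ := mul_pos hc hτ
  choose sz py pz pstar hsol using hsol
  -- One barrier serves all `n`, since the pressure bound is uniform.
  obtain ⟨hi, hhi, -, hB⟩ := hpc.exists_ge hss pbar
  have hex : ∀ n, ∃ Pn, IsLipschitzSolution D sstar hi (2 * CP.toNNReal) pbar (H n) (s n) (sz n)
      (p n) (py n) (pz n) (pstar n) Pn := fun n =>
    (hsol n).exists_lipschitz hL hc hτ hss hpc hs0 hp0c.continuousOn hcomp hhi hB (hHpos n)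
      (hpbar n) (hCP n)
  choose Pn hPn using hex
  set C : NNReal := 2 * CP.toNNReal
  have hy0 : D.L / 2 ∈ Ioo 0 D.L := ⟨by linarith, by linarith⟩
  -- The compactness argument needs a bound at one point only; on the bottom every `Pn n` has the
  -- value `p0`.
  obtain ⟨θ, P, hθ, hP, hlim⟩ := exists_subseq_tendsto_of_lipschitz (fun n => (hPn n).lip)
    (x0 := (D.L / 2, 0)) (B := |D.p0 (D.L / 2)|) fun n => by rw [(hPn n).bottom _ hy0]
  have h := fun n => hPn (θ n)
  have hHθ : Tendsto (fun n => H (θ n)) atTop atTop := hH.comp hθ.tendsto_atTop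
  obtain ⟨S, hS⟩ := exists_imbibitionField hc hτ hss hhi.2 hpc hs0c.continuousOn hHθ h hP hlim
  have hconv := hS.tendsto_slices hc hτ hss hhi.2 hpc hHθ h hlim
  have hSc := hS.continuousOn hκ hss.1 hhi.2 hpc hs0c
  have hSr := hS.range hss.1 hhi.2
  have hdecay : ∀ M n, ∀ y ∈ Ioo 0 D.L, ∀ z, decayHeight D C pbar z0 Ck M ≤ z → z < H (θ n) →
      Pn (θ n) (y, z) ≤ M := by
    intro M n y hy z hz hzH
    obtain ⟨t, ht, hle⟩ := hlarge (θ n) (((lt_decayHeight hL hk hCk M).trans_le hz).trans hzH)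
    exact (h n).pressure_le hk hL hg hc hτ hss hs0 hz0 hCk ht hle hy hz hzH
  have hdecayP : ∀ M, ∀ y ∈ Ioo 0 D.L, ∀ z, decayHeight D C pbar z0 Ck M ≤ z → P (y, z) ≤ M := by
    intro M y hy z hz
    refine le_of_tendsto (hlim (y, z)) ?_
    filter_upwards [hHθ.eventually_gt_atTop z] with n hn using hdecay M n y hy z hz hn
  -- Above `z1` all pressures are nonpositive, the approximate ones up to their own height `H (θ
  -- n)`. It therefore serves as the free boundary height and as the start of the region with flux
  -- `F_∞`.
  set z1 := decayHeight D C pbar z0 Ck 0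
  have hz01 : z0 < z1 := lt_decayHeight hL hk hCk 0
  have hz1 : 0 < z1 := hz0.trans hz01
  have hSm : ∀ a R, 0 ≤ a → AEStronglyMeasurable S (volume.restrict (rect D.L a R)) :=
    fun a R ha => (hSc.mono ((rect_mono ha le_rfl).trans rect_subset_strip)).aestronglyMeasurable
      (measurableSet_rect _ _ _)
  have hweak : ∀ R, 0 < R → ∀ (φ : ℝ × ℝ → ℝ) (C' : NNReal), LipschitzWith C' φ →
      (∀ y, φ (y, 0) = 0) → (∀ x : ℝ × ℝ, R ≤ x.2 → φ x = 0) →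
      ∫ x in rect D.L 0 R, (kExt D.k (S x) * (dy P x * dy φ x + dz P x * dz φ x) +
        (D.g * kExt D.k (S x) - D.c * S x) * dz φ x) = 0 := by
    intro R hR φ C' hφ h0 hφR
    refine limit_weak_eq hk hss.1 hhi.2 h hHθ hP hlim hconv hR (hSm 0 R le_rfl) ?_ hφ h0 hφR
    filter_upwards [ae_restrict_mem (measurableSet_rect _ _ _)] with x hx
    have := hSr x (rect_subset_strip hx)
    rw [abs_of_pos this.1]
    exact this.2.le
  have hflux : ∀ z2, z1 < z2 → ∫ x in rect D.L z1 z2,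
      kExt D.k (S x) * (dz P x + D.g) = (z2 - z1) * D.Finf := by
    intro z2 h12
    refine tendsto_nhds_unique (tendsto_integral_flux hk h hHθ hP hlim hconv hz1.le
      (hSm z1 z2 hz1.le)) (tendsto_const_nhds.congr' ?_)
    filter_upwards [hHθ.eventually_ge_atTop z2] with n hn
    exact ((h n).flux_eq hk hpc hss hhi.2 hz1.le h12 hn (hdecay 0 n)).symm
  refine ⟨θ, S, P, hθ, convergesL2loc_saturation hss.1 hhi.2 h (fun n => hHpos _) hHθ hconv hSc hSr,
    convergesL2loc_pressure h hHθ hP hS.bottom hlim, satRate D P S, dy P, dz P,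
    hS.isStripSolutionWith hk hκ hss hhi.2 hpc hs0c (hsol 0).s_bottom.1 (hdecayP 0) hweak,
    ⟨z1, hz1, ?_⟩, ⟨fun y => S (y, z1), fun y hy => ?_, ?_⟩, fun M => ?_, ?_⟩
  · filter_upwards [ae_restrict_mem (isOpen_strip D.L).measurableSet] with x hx hle
    exact hS.satRate_eq_zero hss hhi.2 hpc (hdecayP 0) hx hle
  · refine tendsto_const_nhds.congr' ?_
    filter_upwards [eventually_ge_atTop z1] with z hz
    exact (hS.eq_of_ge hss hhi.2 hpc hz1 (hdecayP 0) hy hz).symm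
  -- The strict inequality holds at `z0` with the constant `Ck`; monotonicity of the slices and of
  -- `k` carries it up to `z1`, where the saturation equals its limit.
  · have hle := le_integral_limit hk hss.1 hhi.2 h hHθ hconv hz0 fun n => hlarge (θ n)
    have hsl : ∀ z, 0 < z → IntegrableOn (fun y => D.g * kExt D.k (S (y, z))) (Ioo 0 D.L) := by
      intro z hz
      have hcz : ContinuousOn (fun y => S (y, z)) (Ioo 0 D.L) :=
        hSc.comp (by fun_prop) fun y hy => ⟨hy, hz⟩
      refine Integrable.of_bound (((continuous_kExt hk).comp_aestronglyMeasurable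
        (hcz.aestronglyMeasurable measurableSet_Ioo)).const_mul _) (|D.g| * D.k 1)
        (Eventually.of_forall fun y => ?_)
      rw [norm_mul, Real.norm_eq_abs]
      gcongr
      exact abs_kExt_le hk _
    refine hCk.trans_le (hle.trans ?_)
    rw [← integral_const_mul]
    refine (setIntegral_mono_on (hsl z0 hz0) (hsl z1 hz1) measurableSet_Ioo fun y hy => ?_).trans
      (le_of_eq (setIntegral_congr_fun measurableSet_Ioo fun y hy => ?_))
    · exact mul_le_mul_of_nonneg_left (monotone_kExt hk
        (hS.monotone_slice hκ hss.1 hhi.2 hpc hy hz0.le hz01.le)) hg.le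
    · simp only [kExt_eq (Ioo_subset_Icc_self (hSr (y, z1) ⟨hy, hz1⟩))]
  · refine ⟨decayHeight D C pbar z0 Ck M, ?_⟩
    filter_upwards [ae_restrict_mem (isOpen_strip D.L).measurableSet] with x hx hle
    exact hdecayP M x.1 hx.1 x.2 hle
  · refine tendsto_const_nhds.congr' ?_
    filter_upwards [(eventually_gt_atTop z1).filter_mono inf_le_left,
      (hS.flux_ae_eq hκ hss.1 hhi.2 hpc hk hs0c hz1 hflux).filter_mono inf_le_right] with z h1 h2
    exact (h2 h1).symm

end Fingering

theorem mainTheorem5 (D : Fingering.TWData) (sstar : ℝ)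
    (hL : 0 < D.L) (hg : 0 < D.g) (hc : 0 < D.c) (hτ : 0 < D.τ) (hF : 0 < D.Finf)
    (hsstar : sstar ∈ Ioo (0 : ℝ) 1)
    (hk : Fingering.PermeabilityAssumption D.k)
    (hpc : Fingering.CapillaryAssumption D.pc sstar)
    (hs0 : ∀ y ∈ Ioo 0 D.L, sstar ≤ D.s0 y ∧ D.s0 y ≤ 1)
    (H : ℕ → ℝ) (hHpos : ∀ n, 0 < H n) (hH : Tendsto H atTop atTop)
    (s p : ℕ → ℝ × ℝ → ℝ)
    (hsol : ∀ n, Fingering.IsTWSolution D (H n) (s n) (p n))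
    (z0 Ck : ℝ) (hz0 : 0 < z0) (hCk : D.Finf < Ck)
    (hlarge : ∀ n, z0 < H n → ∃ t : ℝ → ℝ, Fingering.IsValueAtHeight D.L z0 (s n) t ∧
      Ck ≤ ∫ y in Ioo 0 D.L, D.g * D.k (t y)) :
    Tendsto (fun n => eLpNorm (p n) ⊤ (volume.restrict (Fingering.rect D.L 0 (H n))))
      atTop (𝓝 ⊤) ∧
    (ContDiffOn ℝ 1 D.s0 (Ioo 0 D.L) → ContDiffOn ℝ 1 D.p0 (Ioo 0 D.L) →
      (∀ y ∈ Ioo 0 D.L, D.s0 y < 1 ∧ D.pc (D.s0 y) < D.p0 y) →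
      (∃ pbar : ℝ, ∀ n, ∀ᵐ x ∂volume.restrict (Fingering.rect D.L 0 (H n)), p n x ≤ pbar) →
      (∃ CP : ℝ, ∀ n, Fingering.GradientBound (Fingering.rect D.L 0 (H n)) (p n) CP) →
      ∃ (θ : ℕ → ℕ) (slim plim : ℝ × ℝ → ℝ), StrictMono θ ∧
        Fingering.ConvergesL2loc D.L (fun n => s (θ n)) slim ∧
        Fingering.ConvergesL2loc D.L (fun n => p (θ n)) plim ∧
        Fingering.IsTypeI D slim plim) := by
  refine ⟨Fingering.tendsto_norm_pressure sstar hL hg hc hτ hsstar hk hs0 hH hsol hz0 hCk hlarge,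
    ?_⟩
  rintro hs0c hp0c hcomp ⟨pbar, hpbar⟩ ⟨CP, hCP⟩
  exact Fingering.exists_typeI_limit hL hg hc hτ hsstar hk hpc hs0 hHpos hH hsol hz0 hCk hlarge
    hs0c hp0c hcomp hpbar hCP
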